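/- Let $n\ge 2$, $0<\alpha<1$, $M>0$, and let $B_1$ be the open unit ball of $\mathbb{R}^n$. Let $A$ be a field of symmetric real $n\times n$ matrices on $B_1$ which is uniformly elliptic, $$\lambda|\xi|^2\le\langle A(x)\xi,\xi\rangle\le\Lambda|\xi|^2\qquad(x\in B_1,\ \xi\in\mathbb{R}^n),$$ with $0<\lambda\le 1\le\Lambda$, $\lambda^{-1}\le M$, $\Lambda\le M$, and Hölder continuous with $\|A\|_{C^{0,\alpha}(B_1)}\le M$ (for the operator norm on matrices). Let $\omega:(0,1)\to[0,\infty)$ be nondecreasing with $\omega(0+)=0$ and $\omega(r)\le Mr^\alpha$. For $x_0\in B_1$ and $r>0$ let $E_r(x_0)=A^{1/2}(x_0)(B_r)+x_0$, where $B_r$ is the open ball of radius $r$ centered at $0$. Write $K\Subset\Omega$ if the closure of $K$ is compact and contained in $\Omega$. Let $U\in W^{1,2}(B_1)$ be almost $A$-harmonic in $B_1$ with gauge $\omega$, that is, $$\int_{E_r(x_0)}\langle A\nabla U,\nabla U\rangle\le(1+\omega(r))\int_{E_r(x_0)}\langle A\nabla V,\nabla V\rangle$$ for all $x_0\in B_1$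 and $0<r<1$ with $E_r(x_0)\Subset B_1$, and all $V\in U+W^{1,2}_0(E_r(x_0))$. Then, after modification on a null set, $U\in C^{1,\alpha/2}(B_1)$, in the sense that $U$ is continuously differentiable in $B_1$ and $\|U\|_{C^{1,\alpha/2}(K)}<\infty$ for every $K\Subset B_1$; moreover, for every $K\Subset B_1$, $$\|U\|_{C^{1,\alpha/2}(K)}\le C\,\|U\|_{W^{1,2}(B_1)},$$ where $C$ depends only on $n,\alpha,M,K$. Here $\|U\|_{C^{1,\beta}(K)}=\sup_K|U|+\sup_K|\nabla U|+\sup_{x\ne y\in K}\frac{|\nabla U(x)-\nabla U(y)|}{|x-y|^\beta}$ and $\|U\|_{W^{1,2}(B_1)}=\big(\int_{B_1}|U|^2+\int_{B_1}|\nabla U|^2\big)^{1/2}$. -/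

import Mathlib

open MeasureTheory Set Topology
open scoped NNReal ENNReal MatrixOrder

noncomputable section

namespace AlmostHarmonic

/-- The Euclidean space `ℝⁿ`. -/
abbrev Sp (n : ℕ) := EuclideanSpace ℝ (Fin n)

/-- The open unit ball `B_1`. -/
abbrev unitBall (n : ℕ) : Set (Sp n) := Metric.ball 0 1

/-- `K ⋐ Ω`: the closure of `K` is compact and contained in `Ω`. -/
def CompactlyIn {n : ℕ} (K Ω : Set (Sp n)) : Prop :=
  IsCompact (closure K) ∧ closure K ⊆ Ω

/-! ### Sobolev spaces -/

/-- Test functions: smooth functions with compact support contained in `Ω`. -/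
def IsTestFun {n : ℕ} (Ω : Set (Sp n)) (φ : Sp n → ℝ) : Prop :=
  ContDiff ℝ ((⊤ : ℕ∞) : WithTop ℕ∞) φ ∧ HasCompactSupport φ ∧ tsupport φ ⊆ Ω

/-- `G` is a weak gradient of `u` in `Ω`: both are locally integrable in `Ω` and
`∫_Ω u ∂ᵢφ = - ∫_Ω Gᵢ φ` for every test function `φ` and every `i`. -/
def IsWeakGrad {n : ℕ} (Ω : Set (Sp n)) (u : Sp n → ℝ) (G : Sp n → Sp n) : Prop :=
  LocallyIntegrableOn u Ω ∧ LocallyIntegrableOn G Ω ∧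
    ∀ φ : Sp n → ℝ, IsTestFun Ω φ → ∀ i : Fin n,
      ∫ x in Ω, u x * fderiv ℝ φ x (EuclideanSpace.single i 1) = - ∫ x in Ω, G x i * φ x

open Classical in
/-- The weak gradient of `u` in `Ω` (unique up to null sets); zero if there is none. -/
def weakGrad {n : ℕ} (Ω : Set (Sp n)) (u : Sp n → ℝ) : Sp n → Sp n :=
  if h : ∃ G, IsWeakGrad Ω u G then h.choose else 0

theorem isWeakGrad_weakGrad {n : ℕ} {Ω : Set (Sp n)} {u : Sp n → ℝ}
    (h : ∃ G, IsWeakGrad Ω u G) : IsWeakGrad Ω u (weakGrad Ω u) := by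
  rw [weakGrad, dif_pos h]
  exact h.choose_spec

/-- `u ∈ W^{1,2}(Ω)`. Only the values of `u` in `Ω` matter. -/
def MemW12 {n : ℕ} (Ω : Set (Sp n)) (u : Sp n → ℝ) : Prop :=
  (∃ G, IsWeakGrad Ω u G) ∧ MemLp u 2 (volume.restrict Ω) ∧
    MemLp (weakGrad Ω u) 2 (volume.restrict Ω)

/-- `‖u‖_{W^{1,2}(Ω)} = (∫_Ω |u|² + ∫_Ω |∇u|²)^{1/2}`. -/
def W12ENorm {n : ℕ} (Ω : Set (Sp n)) (u : Sp n → ℝ) : ℝ≥0∞ :=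
  ((∫⁻ x in Ω, ‖u x‖ₑ ^ 2) + ∫⁻ x in Ω, ‖weakGrad Ω u x‖ₑ ^ 2) ^ (1 / 2 : ℝ)

/-- `u ∈ W^{1,2}_0(Ω)`: the closure of the test functions in `W^{1,2}(Ω)`. -/
def MemW12Zero {n : ℕ} (Ω : Set (Sp n)) (u : Sp n → ℝ) : Prop :=
  MemW12 Ω u ∧ ∀ ε : ℝ≥0∞, 0 < ε → ∃ φ : Sp n → ℝ, IsTestFun Ω φ ∧ W12ENorm Ω (u - φ) < ε

/-! ### Hölder norms -/

/-- `‖f‖_{C^{0,β}(S)} = sup_S |f| + sup_{x ≠ y ∈ S} |f x - f y| / |x - y|^β`. -/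
def holderENorm {n : ℕ} {F : Type*} [NormedAddCommGroup F] (β : ℝ≥0) (S : Set (Sp n))
    (f : Sp n → F) : ℝ≥0∞ :=
  (⨆ x ∈ S, ‖f x‖ₑ) + eHolderNorm β (S.domRestrict f)

/-- `‖u‖_{C^{1,β}(S)} = sup_S |u| + ‖∇u‖_{C^{0,β}(S)}`, with the classical gradient of `u`. -/
def C1HolderENorm {n : ℕ} (β : ℝ≥0) (S : Set (Sp n)) (u : Sp n → ℝ) : ℝ≥0∞ :=
  (⨆ x ∈ S, ‖u x‖ₑ) + holderENorm β S (gradient u)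

/-- `u ∈ C^{1,β}(Ω)` for open `Ω`: `u` is continuously differentiable in `Ω`, with finite
`C^{1,β}` norm on every `K ⋐ Ω`. -/
def MemC1Holder {n : ℕ} (β : ℝ≥0) (Ω : Set (Sp n)) (u : Sp n → ℝ) : Prop :=
  ContDiffOn ℝ 1 u Ω ∧ ∀ K, CompactlyIn K Ω → C1HolderENorm β K u < ∞

/-! ### Coefficients, gauges and almost `A`-harmonic functions -/

/-- The matrix `B` acting as a linear operator of the Euclidean space. -/
abbrev op {n : ℕ} (B : Matrix (Fin n) (Fin n) ℝ) : Sp n →L[ℝ] Sp n :=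
  Matrix.toEuclideanCLM (n := Fin n) (𝕜 := ℝ) B

/-- `⟨B ξ, ξ⟩`. -/
def quad {n : ℕ} (B : Matrix (Fin n) (Fin n) ℝ) (ξ : Sp n) : ℝ := inner ℝ (op B ξ) ξ

/-- The coefficients: `A` is symmetric in `B_1`, uniformly elliptic with constants
`0 < l ≤ 1 ≤ L`, `l⁻¹ ≤ M`, `L ≤ M`, and `‖A‖_{C^{0,α}(B_1)} ≤ M` (for the operator norm). -/
def IsCoeff {n : ℕ} (α : ℝ≥0) (M : ℝ) (A : Sp n → Matrix (Fin n) (Fin n) ℝ) : Prop :=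
  (∀ x ∈ unitBall n, (A x).IsSymm) ∧
  (∃ l L : ℝ, 0 < l ∧ l ≤ 1 ∧ 1 ≤ L ∧ l⁻¹ ≤ M ∧ L ≤ M ∧
    ∀ x ∈ unitBall n, ∀ ξ : Sp n, l * ‖ξ‖ ^ 2 ≤ quad (A x) ξ ∧ quad (A x) ξ ≤ L * ‖ξ‖ ^ 2) ∧
  holderENorm α (unitBall n) (fun x => op (A x)) ≤ ENNReal.ofReal M

/-- Gauge functions `ω : (0,1) → [0,∞)`: nondecreasing, `ω(0+) = 0`, `ω(r) ≤ M r^α`.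
Only the values of `ω` in `(0,1)` matter. -/
def IsGauge (α : ℝ≥0) (M : ℝ) (ω : ℝ → ℝ) : Prop :=
  (∀ r ∈ Ioo (0 : ℝ) 1, 0 ≤ ω r) ∧ MonotoneOn ω (Ioo 0 1) ∧
    Filter.Tendsto ω (𝓝[>] 0) (𝓝 0) ∧ ∀ r ∈ Ioo (0 : ℝ) 1, ω r ≤ M * r ^ (α : ℝ)

/-- The ellipsoid `E_r(x₀) = A^{1/2}(x₀)(B_r) + x₀`, where `A^{1/2}(x₀)` is the positive
semidefinite square root of `A(x₀)`. -/
def ellipsoid {n : ℕ} (A : Sp n → Matrix (Fin n) (Fin n) ℝ) (x₀ : Sp n) (r : ℝ) : Set (Sp n) :=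
  (fun y => op (CFC.sqrt (A x₀)) y + x₀) '' Metric.ball 0 r

/-- `U` is almost `A`-harmonic in `B_1` with gauge `ω`: `U ∈ W^{1,2}(B_1)` and
`∫_E ⟨A∇U,∇U⟩ ≤ (1 + ω(r)) ∫_E ⟨A∇V,∇V⟩` for every ellipsoid `E = E_r(x₀) ⋐ B_1`, `0 < r < 1`,
and every `V ∈ U + W^{1,2}_0(E)`. -/
def IsAlmostHarmonic {n : ℕ} (A : Sp n → Matrix (Fin n) (Fin n) ℝ) (ω : ℝ → ℝ)
    (U : Sp n → ℝ) : Prop :=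
  MemW12 (unitBall n) U ∧
  ∀ x₀ ∈ unitBall n, ∀ r ∈ Ioo (0 : ℝ) 1, CompactlyIn (ellipsoid A x₀ r) (unitBall n) →
    ∀ V : Sp n → ℝ, MemW12Zero (ellipsoid A x₀ r) (V - U) →
      ∫ x in ellipsoid A x₀ r, quad (A x) (weakGrad (unitBall n) U x) ≤
        (1 + ω r) * ∫ x in ellipsoid A x₀ r, quad (A x) (weakGrad (ellipsoid A x₀ r) V x)

end AlmostHarmonic

end

namespace AlmostHarmonic

/-! ### Test functions -/

/-! The proof is an excess decay argument for the gradient, in the manner of Campanato. Fix `x₀`,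
let `T` be the square root of `A x₀`, and consider on the unit ball the field g(y) = T ∇U(x₀ + r T
y). It is the weak gradient of a rescaling of `U`, hence curl free. Freezing the coefficients at
`x₀` costs a factor 1 + O(r^α), as does the gauge. Almost minimality therefore becomes ∫|g|² ≤ (1 +
κ) ∫|g - ∇ψ|² for every test function ψ, with κ = O(r^α); see `IsAlmostHarmonic.transport`.

The harmonic replacement is made by Hilbert space projection, without solving a boundary value
problem (`exists_harmonic_part`). Let P be the projection of g onto the L²-closure of the gradients
of test functions, and H = g - P. Then H is curl free and divergence free, so it is weakly harmonic.
Almost minimality extends to P, and with Pythagoras it gives ‖P‖ ≤ √κ ‖g‖. Weakly harmonic fields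
oscillate linearly near the centre (`exists_decay_of_weakly_harmonic`, which rests on Weyl's lemma).
Shrinking the scale by θ thus turns the L² distance e of g from a constant into at most C θ e + D √κ
‖g‖, with C independent of θ (`exists_one_step_decay`).

Since √κ is of order r^(α/2), the attainable exponent is α/2. Choose θ with C θ ≤ θ^(α/2) / 2 and
iterate over the radii θ^k R: the errors form a geometric series, ‖g‖ stays bounded and the excess
decays like θ^(k α/2) (`exists_bound_of_decay`, `exists_geometric_limit`). Undoing the change of
variables gives a Campanato estimate at every point, uniform on smaller balls (`exists_campanato`).
Comparison of nearby points yields a Hölder continuous representative of the weak gradient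
(`exists_holder_gradient`). Finally, a function with continuous weak gradient is classically
differentiable after modification on a null set, by mollification
(`IsWeakGrad.exists_hasGradientAt`), and its sup norm is controlled by its L² norm and the gradient
bound. -/

theorem _root_.MeasureTheory.LocallyIntegrableOn.integrable_smul_of_tsupport_subset
    {n : ℕ} {F : Type*} [NormedAddCommGroup F] [NormedSpace ℝ F]
    {Ω : Set (Sp n)} {f : Sp n → F} (hf : LocallyIntegrableOn f Ω)
    {g : Sp n → ℝ} (hg : Continuous g) (hc : HasCompactSupport g) (hs : tsupport g ⊆ Ω) :
    IntegrableOn (fun x => g x • f x) Ω := by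
  have hK : IsCompact (tsupport g) := hc
  have h1 : IntegrableOn (fun x => g x • f x) (tsupport g) :=
    (hf.integrableOn_compact_subset hs hK).continuousOn_smul hg.continuousOn hK
  refine (integrableOn_iff_integrable_of_support_subset ?_).1 h1 |>.integrableOn
  intro x hx
  apply subset_tsupport
  intro h0
  simp [h0] at hx

namespace IsTestFun

variable {n : ℕ} {Ω : Set (Sp n)} {φ ψ : Sp n → ℝ}

theorem mono {Ω' : Set (Sp n)} (h : IsTestFun Ω φ) (hΩ : Ω ⊆ Ω') : IsTestFun Ω' φ :=
  ⟨h.1, h.2.1, h.2.2.trans hΩ⟩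

theorem continuous (h : IsTestFun Ω φ) : Continuous φ := h.1.continuous

theorem differentiable (h : IsTestFun Ω φ) : Differentiable ℝ φ :=
  h.1.differentiable (by simp)

theorem zero : IsTestFun Ω (0 : Sp n → ℝ) :=
  ⟨contDiff_const, HasCompactSupport.zero, by simp [tsupport]⟩

theorem const_smul (h : IsTestFun Ω φ) (c : ℝ) : IsTestFun Ω (c • φ) :=
  ⟨h.1.const_smul c, h.2.1.smul_left (f := fun _ => c),
    (tsupport_smul_subset_right (fun _ => c) φ).trans h.2.2⟩

theorem neg (h : IsTestFun Ω φ) : IsTestFun Ω (-φ) := by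
  simpa using h.const_smul (-1)

theorem add (h : IsTestFun Ω φ) (h' : IsTestFun Ω ψ) : IsTestFun Ω (φ + ψ) :=
  ⟨h.1.add h'.1, h.2.1.add h'.2.1,
    (tsupport_add φ ψ).trans (union_subset h.2.2 h'.2.2)⟩

theorem dir (h : IsTestFun Ω φ) (v : Sp n) : IsTestFun Ω (fun x => fderiv ℝ φ x v) :=
  ⟨(h.1.fderiv_right (m := ((⊤ : ℕ∞) : WithTop ℕ∞)) (by simp)).clm_apply contDiff_const,
    h.2.1.fderiv_apply ℝ v, (tsupport_fderiv_apply_subset ℝ v).trans h.2.2⟩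

theorem continuous_gradient (h : IsTestFun Ω φ) : Continuous (gradient φ) :=
  (InnerProductSpace.toDual ℝ (Sp n)).symm.continuous.comp (h.1.continuous_fderiv (by simp))

theorem hasCompactSupport_gradient (h : IsTestFun Ω φ) : HasCompactSupport (gradient φ) :=
  (h.2.1.fderiv ℝ).comp_left (g := (InnerProductSpace.toDual ℝ (Sp n)).symm) (map_zero _)

theorem fderiv_fderiv_comm (h : IsTestFun Ω φ) (v w x : Sp n) :
    fderiv ℝ (fun y => fderiv ℝ φ y v) x w = fderiv ℝ (fun y => fderiv ℝ φ y w) x v := by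
  have hd : DifferentiableAt ℝ (fderiv ℝ φ) x :=
    (h.1.fderiv_right (m := 1) (by norm_cast)).differentiable (by simp) x
  have hs : IsSymmSndFDerivAt ℝ φ x :=
    (h.1.contDiffAt).isSymmSndFDerivAt (by
      simpa using WithTop.coe_le_coe.2 (le_top : (2 : ℕ∞) ≤ ⊤))
  have e : ∀ v w, fderiv ℝ (fun y => fderiv ℝ φ y v) x w = fderiv ℝ (fderiv ℝ φ) x w v := by
    intro v w
    rw [fderiv_clm_apply hd (differentiableAt_const v)]
    simp
  rw [e, e, hs.eq]

end IsTestFun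

/-! ### Weak gradients -/

namespace IsWeakGrad

variable {n : ℕ} {Ω : Set (Sp n)} {u : Sp n → ℝ} {G G' : Sp n → Sp n}

/-- Linearity in the direction. The frames below send coordinate vectors to arbitrary ones, so the
coordinate form of the definition does not suffice. -/
theorem integral_mul_fderiv (h : IsWeakGrad Ω u G) {φ : Sp n → ℝ}
    (hφ : IsTestFun Ω φ) (v : Sp n) :
    ∫ x in Ω, u x * fderiv ℝ φ x v = - ∫ x in Ω, inner ℝ (G x) v * φ x := by
  have hv : v = ∑ i, v i • EuclideanSpace.single i (1 : ℝ) := by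
    have := (EuclideanSpace.basisFun (Fin n) ℝ).sum_repr v
    simpa using this.symm
  have h1 : ∀ x, u x * fderiv ℝ φ x v
      = ∑ i, v i * (u x * fderiv ℝ φ x (EuclideanSpace.single i 1)) := by
    intro x
    conv_lhs => rw [hv]
    simp only [map_sum, map_smul, Finset.mul_sum, smul_eq_mul]
    exact Finset.sum_congr rfl fun i _ => by ring
  have h2 : ∀ x, inner ℝ (G x) v * φ x = ∑ i, v i * (G x i * φ x) := by
    intro x
    simp only [PiLp.inner_apply, Finset.sum_mul]
    exact Finset.sum_congr rfl fun i _ => by simp; ring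
  simp only [h1, h2]
  rw [integral_finsetSum, integral_finsetSum, ← Finset.sum_neg_distrib]
  · refine Finset.sum_congr rfl fun i _ => ?_
    rw [integral_const_mul, integral_const_mul, h.2.2 φ hφ i]
    ring
  · intro i _
    have := h.2.1.integrable_smul_of_tsupport_subset hφ.continuous hφ.2.1 hφ.2.2
    have h3 := (EuclideanSpace.proj (𝕜 := ℝ) i).integrable_comp this
    refine (h3.congr (Filter.Eventually.of_forall fun x => ?_)).const_mul (v i)
    simp [mul_comm]
  · intro i _
    have hd := hφ.dir (EuclideanSpace.single i 1)
    have := h.1.integrable_smul_of_tsupport_subset hd.continuous hd.2.1 hd.2.2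
    refine (this.congr (Filter.Eventually.of_forall fun x => ?_)).const_mul (v i)
    simp [mul_comm]

theorem mono {Ω' : Set (Sp n)} (h : IsWeakGrad Ω u G) (hsub : Ω' ⊆ Ω)
    (hΩ : MeasurableSet Ω) :
    IsWeakGrad Ω' u G := by
  refine ⟨h.1.mono_set hsub, h.2.1.mono_set hsub, fun φ hφ i => ?_⟩
  have := h.2.2 φ (hφ.mono hsub) i
  have e : ∀ f : Sp n → ℝ, (∀ x, x ∉ tsupport φ → f x = 0) →
      ∫ x in Ω', f x = ∫ x in Ω, f x := by
    intro f hf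
    refine (setIntegral_eq_of_subset_of_forall_sdiff_eq_zero hΩ hsub fun x hx => ?_).symm
    exact hf x fun h => hx.2 (hφ.2.2 h)
  rw [e, e, this]
  · intro x hx
    simp [image_eq_zero_of_notMem_tsupport hx]
  · intro x hx
    have : fderiv ℝ φ x = 0 :=
      image_eq_zero_of_notMem_tsupport fun h => hx (tsupport_fderiv_subset ℝ h)
    simp [this]

theorem unique (hΩ : IsOpen Ω) (h : IsWeakGrad Ω u G) (h' : IsWeakGrad Ω u G') :
    G =ᵐ[volume.restrict Ω] G' := by
  have key : ∀ᵐ x ∂(volume : Measure (Sp n)), x ∈ Ω → (G - G') x = 0 := by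
    refine hΩ.ae_eq_zero_of_integral_contDiff_smul_eq_zero (h.2.1.sub h'.2.1) ?_
    intro φ hφ hc hs
    have ht : IsTestFun Ω φ := ⟨hφ, hc, hs⟩
    have i1 := h.2.1.integrable_smul_of_tsupport_subset ht.continuous hc hs
    have i2 := h'.2.1.integrable_smul_of_tsupport_subset ht.continuous hc hs
    have e1 : ∫ x, φ x • (G - G') x = ∫ x in Ω, φ x • (G - G') x := by
      refine (setIntegral_eq_integral_of_forall_compl_eq_zero fun x hx => ?_).symm
      rw [image_eq_zero_of_notMem_tsupport fun h => hx (hs h), zero_smul]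
    have e2 : ∫ x in Ω, φ x • (G - G') x
        = (∫ x in Ω, φ x • G x) - ∫ x in Ω, φ x • G' x := by
      rw [← integral_sub i1 i2]
      simp [smul_sub]
    rw [e1, e2]
    refine ext_inner_right ℝ fun v => ?_
    rw [inner_sub_left, real_inner_comm, real_inner_comm v,
      ← integral_inner i1, ← integral_inner i2, inner_zero_left, sub_eq_zero]
    have a1 := h.integral_mul_fderiv ht v
    have a2 := h'.integral_mul_fderiv ht v
    have a3 := a1.symm.trans a2
    simp only [real_inner_smul_right]
    simpa [mul_comm, real_inner_comm] using a3
  filter_upwards [ae_restrict_of_ae key, ae_restrict_mem hΩ.measurableSet] with x hx hxΩ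
  simpa [sub_eq_zero] using hx hxΩ

/-- `weakGrad` is an arbitrary choice among weak gradients; this is how it gets computed for
competitors. -/
theorem weakGrad_ae_eq (hΩ : IsOpen Ω) (h : IsWeakGrad Ω u G) :
    weakGrad Ω u =ᵐ[volume.restrict Ω] G :=
  unique hΩ (isWeakGrad_weakGrad ⟨G, h⟩) h

theorem of_contDiff {φ : Sp n → ℝ} (hφ : IsTestFun (univ : Set (Sp n)) φ) :
    IsWeakGrad Ω φ (gradient φ) := by
  refine ⟨hφ.continuous.locallyIntegrable.locallyIntegrableOn _,
    hφ.continuous_gradient.locallyIntegrable.locallyIntegrableOn _, fun ψ hψ i => ?_⟩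
  have e : ∀ f : Sp n → ℝ, (∀ x, x ∉ tsupport ψ → f x = 0) →
      ∫ x in Ω, f x = ∫ x, f x := by
    intro f hf
    exact setIntegral_eq_integral_of_forall_compl_eq_zero fun x hx =>
      hf x fun h => hx (hψ.2.2 h)
  rw [e, e]
  · have hd := hψ.dir (EuclideanSpace.single i 1)
    have hd' := hφ.dir (EuclideanSpace.single i 1)
    rw [integral_mul_fderiv_eq_neg_fderiv_mul_of_integrable]
    · congr 1
      refine integral_congr_ae (Filter.Eventually.of_forall fun x => ?_)
      have : (gradient φ x) i = inner ℝ (gradient φ x) (EuclideanSpace.single i (1 : ℝ)) := by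
        rw [EuclideanSpace.inner_single_right]
        simp
      simp only [this, inner_gradient_left]
    · exact (hd'.continuous.mul hψ.continuous).integrable_of_hasCompactSupport hψ.2.1.mul_left
    · exact (hφ.continuous.mul hd.continuous).integrable_of_hasCompactSupport hd.2.1.mul_left
    · exact (hφ.continuous.mul hψ.continuous).integrable_of_hasCompactSupport hψ.2.1.mul_left
    · exact fun x _ => hφ.differentiable x
    · exact fun x _ => hψ.differentiable x
  · intro x hx
    simp [image_eq_zero_of_notMem_tsupport hx]
  · intro x hx
    have : fderiv ℝ ψ x = 0 :=
      image_eq_zero_of_notMem_tsupport fun h => hx (tsupport_fderiv_subset ℝ h)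
    simp [this]

theorem sub {u' : Sp n → ℝ} (h : IsWeakGrad Ω u G)
    (h' : IsWeakGrad Ω u' G') : IsWeakGrad Ω (u - u') (G - G') := by
  refine ⟨h.1.sub h'.1, h.2.1.sub h'.2.1, fun φ hφ i => ?_⟩
  have hd := hφ.dir (EuclideanSpace.single i 1)
  have iu := h.1.integrable_smul_of_tsupport_subset hd.continuous hd.2.1 hd.2.2
  have iu' := h'.1.integrable_smul_of_tsupport_subset hd.continuous hd.2.1 hd.2.2
  have ig := (EuclideanSpace.proj (𝕜 := ℝ) i).integrable_comp
    (h.2.1.integrable_smul_of_tsupport_subset hφ.continuous hφ.2.1 hφ.2.2)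
  have ig' := (EuclideanSpace.proj (𝕜 := ℝ) i).integrable_comp
    (h'.2.1.integrable_smul_of_tsupport_subset hφ.continuous hφ.2.1 hφ.2.2)
  simp only [smul_eq_mul, map_smul, PiLp.proj_apply, mul_comm (fderiv ℝ φ _ _),
    mul_comm (φ _)] at iu iu' ig ig'
  simp only [Pi.sub_apply, sub_mul, PiLp.sub_apply]
  rw [integral_sub iu iu', integral_sub ig ig', h.2.2 φ hφ i, h'.2.2 φ hφ i]
  ring

end IsWeakGrad

theorem IsTestFun.memW12Zero {n : ℕ} {Ω : Set (Sp n)} (hΩ : IsOpen Ω) {φ : Sp n → ℝ}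
    (hφ : IsTestFun Ω φ) : MemW12Zero Ω φ := by
  have hw := IsWeakGrad.of_contDiff (Ω := Ω) (hφ.mono (subset_univ Ω))
  refine ⟨⟨⟨_, hw⟩, hφ.continuous.memLp_of_hasCompactSupport hφ.2.1, ?_⟩, fun ε hε =>
    ⟨φ, hφ, ?_⟩⟩
  · exact (memLp_congr_ae (hw.weakGrad_ae_eq hΩ)).2
      (hφ.continuous_gradient.memLp_of_hasCompactSupport hφ.hasCompactSupport_gradient)
  · have h0 : weakGrad Ω (φ - φ) =ᵐ[volume.restrict Ω] 0 := by
      have := (hw.sub hw).weakGrad_ae_eq hΩ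
      simpa using this
    have h1 : ∫⁻ x in Ω, ‖weakGrad Ω (φ - φ) x‖ₑ ^ 2 = 0 := by
      rw [lintegral_congr_ae (g := fun _ => 0)]
      · simp
      · filter_upwards [h0] with x hx
        rw [hx]
        simp
    rw [W12ENorm, h1]
    simpa using hε

end AlmostHarmonic

namespace AlmostHarmonic

/-! ### A radial mollifier whose time derivative is a Laplacian -/

/-- A smooth profile vanishing on `[1, ∞)` and positive on `(-∞, 1)`. -/
noncomputable def profile (s : ℝ) : ℝ := expNegInvGlue (1 - s)

/-- Half of the primitive of `profile` vanishing on `[1, ∞)`. -/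
noncomputable def profilePrim (s : ℝ) : ℝ := (∫ τ in (1 : ℝ)..s, profile τ) / 2

theorem contDiff_profile {k : ℕ∞} : ContDiff ℝ k profile :=
  expNegInvGlue.contDiff.comp (contDiff_const.sub contDiff_id)

theorem continuous_profile : Continuous profile := (contDiff_profile (k := 0)).continuous

theorem profile_nonneg (s : ℝ) : 0 ≤ profile s := expNegInvGlue.nonneg _

theorem profile_pos {s : ℝ} (hs : s < 1) : 0 < profile s :=
  expNegInvGlue.pos_of_pos (by linarith)

theorem profile_eq_zero {s : ℝ} (hs : 1 ≤ s) : profile s = 0 :=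
  expNegInvGlue.zero_of_nonpos (by linarith)

theorem profile_le_one (s : ℝ) : profile s ≤ 1 := by
  unfold profile expNegInvGlue
  split_ifs with h
  · exact zero_le_one
  · rw [Real.exp_le_one_iff, neg_nonpos, inv_nonneg]
    linarith

theorem hasDerivAt_profile (s : ℝ) : HasDerivAt profile (deriv profile s) s :=
  ((contDiff_profile (k := 1)).differentiable (by simp) s).hasDerivAt

theorem continuous_deriv_profile : Continuous (deriv profile) :=
  (contDiff_profile (k := 1)).continuous_deriv le_rfl

theorem hasDerivAt_profilePrim (s : ℝ) : HasDerivAt profilePrim (profile s / 2) s :=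
  (intervalIntegral.integral_hasDerivAt_right (continuous_profile.intervalIntegrable _ _)
    (continuous_profile.stronglyMeasurableAtFilter _ _) continuous_profile.continuousAt).div_const 2

theorem contDiff_profilePrim : ContDiff ℝ ((⊤ : ℕ∞) : WithTop ℕ∞) profilePrim := by
  rw [contDiff_infty_iff_deriv]
  refine ⟨fun s => (hasDerivAt_profilePrim s).differentiableAt, ?_⟩
  have : deriv profilePrim = fun s => profile s / 2 :=
    funext fun s => (hasDerivAt_profilePrim s).deriv
  rw [this]
  exact contDiff_profile.div_const 2

theorem profilePrim_eq_zero {s : ℝ} (hs : 1 ≤ s) : profilePrim s = 0 := by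
  have : ∫ τ in (1 : ℝ)..s, profile τ = ∫ τ in (1 : ℝ)..s, (0 : ℝ) := by
    refine intervalIntegral.integral_congr fun τ hτ => ?_
    rw [uIcc_of_le hs] at hτ
    exact profile_eq_zero hτ.1
  simp [profilePrim, this]

/-- The Laplacian `∑ᵢ ∂ᵢ∂ᵢ ψ`. -/
noncomputable def lap {n : ℕ} (ψ : Sp n → ℝ) (y : Sp n) : ℝ :=
  ∑ i, fderiv ℝ (fun z => fderiv ℝ ψ z (EuclideanSpace.single i 1)) y (EuclideanSpace.single i 1)

/-- The squared distance to `x` in units of `t`. -/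
noncomputable def sqDist {n : ℕ} (x : Sp n) (t : ℝ) (y : Sp n) : ℝ := ‖y - x‖ ^ 2 / t ^ 2

theorem contDiff_sqDist {n : ℕ} (x : Sp n) (t : ℝ) {k : WithTop ℕ∞} :
    ContDiff ℝ k (sqDist x t) :=
  ((contDiff_id.sub contDiff_const).norm_sq ℝ).div_const _

theorem hasFDerivAt_sqDist {n : ℕ} (x : Sp n) (t : ℝ) (y : Sp n) :
    HasFDerivAt (sqDist x t) ((2 / t ^ 2) • innerSL ℝ (y - x)) y := by
  have h := ((hasFDerivAt_id (𝕜 := ℝ) y).sub_const x).norm_sq.const_mul (t ^ 2)⁻¹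
  refine (h.congr_fderiv ?_).congr_of_eventuallyEq (Filter.Eventually.of_forall fun z => ?_)
  · ext v
    simp
    ring
  · simp [sqDist]
    ring

theorem one_le_sqDist {n : ℕ} {x y : Sp n} {t : ℝ} (ht : 0 < t) (h : t ≤ ‖y - x‖) :
    1 ≤ sqDist x t y := by
  rw [sqDist, one_le_div (by positivity)]
  exact pow_le_pow_left₀ ht.le h 2

theorem isTestFun_profilePrim {n : ℕ} {x : Sp n} {t : ℝ} (ht : 0 < t) {Ω : Set (Sp n)}
    (h : Metric.closedBall x t ⊆ Ω) : IsTestFun Ω (fun y => profilePrim (sqDist x t y)) := by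
  have hs : tsupport (fun y => profilePrim (sqDist x t y)) ⊆ Metric.closedBall x t := by
    refine closure_minimal (fun y hy => ?_) Metric.isClosed_closedBall
    by_contra hc
    rw [Metric.mem_closedBall, dist_eq_norm, not_le] at hc
    exact hy (profilePrim_eq_zero (one_le_sqDist ht hc.le))
  exact ⟨contDiff_profilePrim.comp (contDiff_sqDist x t),
    (isCompact_closedBall x t).of_isClosed_subset (isClosed_tsupport _) hs, hs.trans h⟩

/-- Chain rule twice. The factor 1/2 in `profilePrim` cancels the 2 in the derivative of the squared
norm. -/
theorem lap_profilePrim {n : ℕ} (x : Sp n) (t : ℝ) (y : Sp n) :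
    lap (fun y => profilePrim (sqDist x t y)) y =
      (n * profile (sqDist x t y) + 2 * sqDist x t y * deriv profile (sqDist x t y)) / t ^ 2 := by
  have h1 : ∀ v z, fderiv ℝ (fun y => profilePrim (sqDist x t y)) z v
      = profile (sqDist x t z) * (inner ℝ (z - x) v / t ^ 2) := by
    intro v z
    have := ((hasDerivAt_profilePrim _).comp_hasFDerivAt z (hasFDerivAt_sqDist x t z)).fderiv
    simp only [Function.comp_def] at this
    rw [this]
    simp only [_root_.smul_apply, innerSL_apply_apply, smul_eq_mul]
    ring
  have h2 : ∀ v, fderiv ℝ (fun z => profile (sqDist x t z) * (inner ℝ (z - x) v / t ^ 2)) y v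
      = (2 * (inner ℝ (y - x) v) ^ 2 / t ^ 2 * deriv profile (sqDist x t y)
        + profile (sqDist x t y) * ‖v‖ ^ 2) / t ^ 2 := by
    intro v
    have a := (hasDerivAt_profile _).comp_hasFDerivAt y (hasFDerivAt_sqDist x t y)
    have b : HasFDerivAt (fun z => (inner ℝ (z - x) v : ℝ) / t ^ 2)
        ((t ^ 2)⁻¹ • innerSL ℝ v) y := by
      have := (((innerSL ℝ v).hasFDerivAt (x := y - x)).comp y
        ((hasFDerivAt_id (𝕜 := ℝ) y).sub_const x)).const_mul (t ^ 2)⁻¹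
      refine (this.congr_fderiv ?_).congr_of_eventuallyEq
        (Filter.Eventually.of_forall fun z => ?_)
      · ext w
        simp
      · simp [real_inner_comm]
        ring
    have := (a.mul b).fderiv
    simp only [Function.comp_def] at this
    rw [show (fun z => profile (sqDist x t z) * (inner ℝ (z - x) v / t ^ 2)) =
      ((fun z => profile (sqDist x t z)) * fun z => (inner ℝ (z - x) v / t ^ 2)) from rfl, this]
    simp only [_root_.add_apply, _root_.smul_apply, innerSL_apply_apply,
      real_inner_self_eq_norm_sq, smul_eq_mul]
    ring
  have h3 : ∑ i, (inner ℝ (y - x) (EuclideanSpace.single i (1 : ℝ))) ^ 2 = ‖y - x‖ ^ 2 := by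
    rw [EuclideanSpace.norm_sq_eq]
    refine Finset.sum_congr rfl fun i _ => ?_
    rw [EuclideanSpace.inner_single_right]
    simp
  simp only [lap, h1, h2]
  rw [← Finset.sum_div, Finset.sum_add_distrib, ← Finset.sum_mul, ← Finset.sum_div,
    ← Finset.mul_sum, h3]
  simp [sqDist]
  ring

/-- The radial mollifier of width `t` centred at `x` (not normalized). -/
noncomputable def radialKer {n : ℕ} (x : Sp n) (t : ℝ) (y : Sp n) : ℝ := (t ^ n)⁻¹ * profile (sqDist x t y)

theorem continuous_radialKer {n : ℕ} (x : Sp n) (t : ℝ) : Continuous (radialKer x t) :=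
  continuous_const.mul (continuous_profile.comp (contDiff_sqDist x t (k := 0)).continuous)

theorem radialKer_eq_zero {n : ℕ} {x y : Sp n} {t : ℝ} (ht : 0 < t) (h : t ≤ ‖y - x‖) :
    radialKer x t y = 0 := by
  rw [radialKer, profile_eq_zero (one_le_sqDist ht h), mul_zero]

/-- With σ = `sqDist x t y` and η = `profile`, both sides are -t^(-n-1) (n η(σ) + 2 σ η'(σ)). The
derivative in the scale is thus a multiple of the Laplacian of a test function, which is what makes
Weyl's lemma work. -/
theorem hasDerivAt_radialKer {n : ℕ} (x y : Sp n) {t : ℝ} (ht : 0 < t) :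
    HasDerivAt (fun t => radialKer x t y)
      (-(t * (t ^ n)⁻¹) * lap (fun y => profilePrim (sqDist x t y)) y) t := by
  have a : HasDerivAt (fun t : ℝ => (t ^ n)⁻¹) (-(n * (t ^ n)⁻¹ / t)) t := by
    have := (hasDerivAt_pow n t).inv (by positivity)
    refine this.congr_deriv ?_
    rcases n with _ | n
    · simp
    · field_simp
      simp [pow_succ]
  have b : HasDerivAt (fun t => sqDist x t y) (-(2 * sqDist x t y / t)) t := by
    have := ((hasDerivAt_pow 2 t).inv (by positivity)).const_mul (‖y - x‖ ^ 2)
    refine this.congr_deriv ?_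
    simp [sqDist]
    field_simp
  have c := a.mul ((hasDerivAt_profile (sqDist x t y)).comp t b)
  refine c.congr_deriv ?_
  rw [lap_profilePrim]
  simp only [Function.comp_def]
  field_simp
  ring

end AlmostHarmonic

namespace AlmostHarmonic

/-! ### Weyl's lemma -/

section Weyl

variable {n : ℕ} {F : Type*} [NormedAddCommGroup F] [NormedSpace ℝ F]

/-- Differentiation under the integral produces the Laplacian of a test function against `h`, which
vanishes. The condition on `‖x‖ + t` keeps the support inside the ball. -/
theorem hasDerivAt_integral_radialKer {h : Sp n → F} (hi : IntegrableOn h (unitBall n))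
    (hw : ∀ ψ, IsTestFun (unitBall n) ψ → ∫ y in unitBall n, lap ψ y • h y = 0)
    {x : Sp n} {t : ℝ} (ht : 0 < t) (hxt : ‖x‖ + t < 1) :
    HasDerivAt (fun t => ∫ y in unitBall n, radialKer x t y • h y) 0 t := by
  set q : ℝ → Sp n → ℝ := fun τ y =>
    -(τ * (τ ^ n)⁻¹) * lap (fun y => profilePrim (sqDist x τ y)) y with hq
  -- Domination: the scale derivative of the kernel is continuous, hence bounded, on a compact set
  -- of scales away from 0 and points of the closed ball.
  obtain ⟨b, hb⟩ : ∃ b, ∀ p ∈ Icc (t / 2) (2 * t) ×ˢ Metric.closedBall (0 : Sp n) 1,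
      ‖q p.1 p.2‖ ≤ b := by
    refine (isCompact_Icc.prod (isCompact_closedBall (0 : Sp n) 1)).exists_bound_of_continuousOn
      (f := fun p : ℝ × Sp n => q p.1 p.2) ?_
    simp only [hq, lap_profilePrim]
    have hne : ∀ p ∈ Icc (t / 2) (2 * t) ×ˢ Metric.closedBall (0 : Sp n) 1, p.1 ≠ 0 := by
      rintro p ⟨hp, -⟩
      have := hp.1
      exact (lt_of_lt_of_le (half_pos ht) this).ne'
    have hσ : ContinuousOn (fun p : ℝ × Sp n => sqDist x p.1 p.2)
        (Icc (t / 2) (2 * t) ×ˢ Metric.closedBall (0 : Sp n) 1) := by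
      refine ContinuousOn.div (by fun_prop) (by fun_prop) fun p hp => pow_ne_zero _ (hne p hp)
    have h1 := continuous_profile.comp_continuousOn hσ
    have h2 := continuous_deriv_profile.comp_continuousOn hσ
    refine ContinuousOn.mul (ContinuousOn.neg (continuousOn_fst.mul
      (ContinuousOn.inv₀ (by fun_prop) fun p hp => pow_ne_zero _ (hne p hp))))
      (ContinuousOn.div ?_ (by fun_prop) fun p hp => pow_ne_zero _ (hne p hp))
    exact (continuousOn_const.mul h1).add ((continuousOn_const.mul hσ).mul h2)
  have key := (hasDerivAt_integral_of_dominated_loc_of_deriv_le (μ := volume.restrict (unitBall n))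
    (F := fun t y => radialKer x t y • h y) (F' := fun t y => q t y • h y)
    (x₀ := t) (s := Ioo (t / 2) (2 * t)) (bound := fun y => b * ‖h y‖)
    (Ioo_mem_nhds (by linarith) (by linarith)) ?_ ?_ ?_ ?_ ?_ ?_).2
  · refine key.congr_deriv ?_
    have := hw _ (isTestFun_profilePrim (x := x) ht (Ω := unitBall n) ?_)
    · simp only [hq, mul_smul]
      rw [integral_smul, this, smul_zero]
    · intro y hy
      rw [Metric.mem_closedBall, dist_eq_norm] at hy
      rw [unitBall, mem_ball_zero_iff]
      calc ‖y‖ = ‖x + (y - x)‖ := by congr 1; abel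
        _ ≤ ‖x‖ + ‖y - x‖ := norm_add_le _ _
        _ < 1 := by linarith
  · exact Filter.Eventually.of_forall fun τ =>
      (continuous_radialKer x τ).aestronglyMeasurable.smul hi.aestronglyMeasurable
  · refine Integrable.mono' (g := fun y => (t ^ n)⁻¹ * ‖h y‖) (hi.norm.const_mul _)
      ((continuous_radialKer x t).aestronglyMeasurable.smul hi.aestronglyMeasurable)
      (Filter.Eventually.of_forall fun y => ?_)
    rw [norm_smul]
    refine mul_le_mul_of_nonneg_right ?_ (norm_nonneg _)
    rw [radialKer, norm_mul, Real.norm_of_nonneg (profile_nonneg _),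
      Real.norm_of_nonneg (by positivity)]
    exact mul_le_of_le_one_right (by positivity) (profile_le_one _)
  · simp only [hq, lap_profilePrim]
    have hσ := (contDiff_sqDist x t (k := 0)).continuous
    have h1 := continuous_profile.comp hσ
    have h2 := continuous_deriv_profile.comp hσ
    refine Continuous.aestronglyMeasurable ?_ |>.smul hi.aestronglyMeasurable
    refine continuous_const.mul (Continuous.div_const ?_ _)
    exact (continuous_const.mul h1).add ((continuous_const.mul hσ).mul h2)
  · filter_upwards [ae_restrict_mem Metric.isOpen_ball.measurableSet] with y hy τ hτ
    rw [norm_smul]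
    exact mul_le_mul_of_nonneg_right
      (hb (τ, y) ⟨Ioo_subset_Icc_self hτ, Metric.ball_subset_closedBall hy⟩) (norm_nonneg _)
  · exact hi.norm.const_mul b
  · refine Filter.Eventually.of_forall fun y τ hτ => ?_
    have : 0 < τ := by linarith [hτ.1]
    exact (hasDerivAt_radialKer x y this).smul_const (h y)

theorem integral_radialKer_eq {h : Sp n → F} (hi : IntegrableOn h (unitBall n))
    (hw : ∀ ψ, IsTestFun (unitBall n) ψ → ∫ y in unitBall n, lap ψ y • h y = 0)
    {x : Sp n} {r s t : ℝ} (hxr : ‖x‖ + r ≤ 1) (hs : s ∈ Ioo 0 r) (ht : t ∈ Ioo 0 r) :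
    ∫ y in unitBall n, radialKer x s y • h y = ∫ y in unitBall n, radialKer x t y • h y := by
  have hd : ∀ τ ∈ Ioo 0 r, HasDerivAt (fun t => ∫ y in unitBall n, radialKer x t y • h y) 0 τ :=
    fun τ hτ => hasDerivAt_integral_radialKer hi hw hτ.1 (by linarith [hτ.2])
  exact isOpen_Ioo.is_const_of_deriv_eq_zero isPreconnected_Ioo
    (fun τ hτ => (hd τ hτ).differentiableAt.differentiableWithinAt)
    (fun τ hτ => (hd τ hτ).deriv) hs ht

variable (n) in
/-- The total mass of the kernels `radialKer x t`. -/
noncomputable def kerMass : ℝ := ∫ z : Sp n, profile (‖z‖ ^ 2)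

theorem integral_radialKer (x : Sp n) {t : ℝ} (ht : 0 < t) :
    ∫ y, radialKer x t y = kerMass n := by
  have h1 : ∫ y, radialKer x t y = ∫ y, radialKer (0 : Sp n) t y := by
    rw [← integral_add_right_eq_self _ x]
    simp [radialKer, sqDist]
  have h2 : ∀ y : Sp n, radialKer (0 : Sp n) t y = (t ^ n)⁻¹ * profile (‖t⁻¹ • y‖ ^ 2) := by
    intro y
    simp only [radialKer, sqDist, sub_zero, norm_smul, mul_pow, norm_inv, Real.norm_eq_abs,
      inv_pow, sq_abs]
    congr 2
    field_simp
  rw [h1]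
  simp only [h2]
  rw [integral_const_mul, Measure.integral_comp_inv_smul volume
    (fun y : Sp n => profile (‖y‖ ^ 2)) t]
  simp only [finrank_euclideanSpace, Fintype.card_fin, smul_eq_mul]
  rw [abs_of_pos (by positivity), ← mul_assoc, inv_mul_cancel₀ (by positivity), one_mul, kerMass]

theorem hasCompactSupport_radialKer (x : Sp n) {t : ℝ} (ht : 0 < t) :
    HasCompactSupport (radialKer x t) := by
  refine HasCompactSupport.intro (isCompact_closedBall x t) fun y hy => ?_
  rw [Metric.mem_closedBall, dist_eq_norm, not_le] at hy
  exact radialKer_eq_zero ht hy.le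

theorem kerMass_pos : 0 < kerMass n := by
  have hc : Continuous (fun z : Sp n => profile (‖z‖ ^ 2)) :=
    continuous_profile.comp (continuous_norm.pow 2)
  refine hc.integral_pos_of_hasCompactSupport_nonneg_nonzero ?_ (fun z => profile_nonneg _)
    (x := 0) ?_
  · refine HasCompactSupport.intro (isCompact_closedBall 0 1) fun y hy => ?_
    rw [mem_closedBall_zero_iff, not_le] at hy
    exact profile_eq_zero (one_le_pow₀ hy.le)
  · exact (profile_pos (by simp)).ne'

theorem setIntegral_radialKer {x : Sp n} {t : ℝ} (ht : 0 < t) (hxt : ‖x‖ + t ≤ 1) :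
    ∫ y in unitBall n, radialKer x t y = kerMass n := by
  rw [← integral_radialKer x ht]
  refine setIntegral_eq_integral_of_forall_compl_eq_zero fun y hy => radialKer_eq_zero ht ?_
  rw [unitBall, mem_ball_zero_iff, not_lt] at hy
  have : ‖y‖ ≤ ‖x‖ + ‖y - x‖ := by
    calc ‖y‖ = ‖x + (y - x)‖ := by congr 1; abel
      _ ≤ _ := norm_add_le _ _
  linarith

theorem integrableOn_radialKer_smul {h : Sp n → F} (hi : IntegrableOn h (unitBall n))
    (x : Sp n) {t : ℝ} (ht : 0 < t) :
    IntegrableOn (fun y => radialKer x t y • h y) (unitBall n) := by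
  refine Integrable.mono' (g := fun y => (t ^ n)⁻¹ * ‖h y‖) (hi.norm.const_mul _)
    ((continuous_radialKer x t).aestronglyMeasurable.smul hi.aestronglyMeasurable)
    (Filter.Eventually.of_forall fun y => ?_)
  rw [norm_smul]
  refine mul_le_mul_of_nonneg_right ?_ (norm_nonneg _)
  rw [radialKer, norm_mul, Real.norm_of_nonneg (profile_nonneg _),
    Real.norm_of_nonneg (by positivity)]
  exact mul_le_of_le_one_right (by positivity) (profile_le_one _)

/-- At a Lebesgue point of the extension of `h` by zero, the kernel is at most t^(-n) and lives in
the ball of radius t, so the error is at most the mean oscillation times the volume of the unit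
ball. -/
theorem tendsto_integral_radialKer [CompleteSpace F] {h : Sp n → F}
    (hi : IntegrableOn h (unitBall n)) :
    ∀ᵐ x ∂volume, x ∈ unitBall n →
      Filter.Tendsto (fun t => ∫ y in unitBall n, radialKer x t y • h y) (𝓝[>] 0)
        (𝓝 (kerMass n • h x)) := by
  set f := (unitBall n).indicator h with hf
  have hfi : Integrable f := hi.integrable_indicator Metric.isOpen_ball.measurableSet
  have hL := IsUnifLocDoublingMeasure.ae_tendsto_average_norm_sub volume
    hfi.locallyIntegrable 1
  filter_upwards [hL] with x hx hxB
  have h1 := hx (ι := ℝ) (l := 𝓝[>] 0) (fun _ => x) id Filter.tendsto_id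
    (by
      filter_upwards [self_mem_nhdsWithin] with t ht
      exact Metric.mem_closedBall_self (by simpa using (mem_Ioi.1 ht).le))
  have hv : 0 < volume.real (Metric.closedBall (0 : Sp n) 1) :=
    ENNReal.toReal_pos (Metric.measure_closedBall_pos volume _ one_pos).ne'
      (measure_closedBall_lt_top).ne
  rw [tendsto_iff_norm_sub_tendsto_zero]
  have h2 : Filter.Tendsto (fun t => volume.real (Metric.closedBall (0 : Sp n) 1) *
      ⨍ y in Metric.closedBall x t, ‖f y - f x‖) (𝓝[>] 0) (𝓝 0) := by
    simpa using h1.const_mul (volume.real (Metric.closedBall (0 : Sp n) 1))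
  refine squeeze_zero' (Filter.Eventually.of_forall fun _ => norm_nonneg _) ?_ h2
  filter_upwards [self_mem_nhdsWithin] with t ht
  rw [mem_Ioi] at ht
  have e1 : ∫ y in unitBall n, radialKer x t y • h y = ∫ y, radialKer x t y • f y := by
    rw [← integral_indicator Metric.isOpen_ball.measurableSet]
    congr 1
    ext1 y
    by_cases hy : y ∈ unitBall n <;> simp only [hf, hy, indicator_of_mem,
      indicator_of_notMem, not_false_eq_true, smul_zero]
  have hfx : f x = h x := indicator_of_mem hxB h
  have hki : Integrable (radialKer x t) :=
    (continuous_radialKer x t).integrable_of_hasCompactSupport (hasCompactSupport_radialKer x ht)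
  have hfi' : Integrable (fun y => radialKer x t y • f y) := by
    have := (integrableOn_radialKer_smul hi x ht).integrable_indicator
      Metric.isOpen_ball.measurableSet
    refine this.congr (Filter.Eventually.of_forall fun y => ?_)
    by_cases hy : y ∈ unitBall n <;> simp only [hf, hy, indicator_of_mem,
      indicator_of_notMem, not_false_eq_true, smul_zero]
  have e2 : (∫ y, radialKer x t y • f y) - kerMass n • h x
      = ∫ y in Metric.closedBall x t, radialKer x t y • (f y - f x) := by
    rw [setIntegral_eq_integral_of_forall_compl_eq_zero]
    · simp only [smul_sub]
      rw [integral_sub hfi' (hki.smul_const _), integral_smul_const, integral_radialKer x ht, hfx]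
    · intro y hy
      rw [Metric.mem_closedBall, dist_eq_norm, not_le] at hy
      rw [radialKer_eq_zero ht hy.le, zero_smul]
  have hint : IntegrableOn (fun y => ‖f y - f x‖) (Metric.closedBall x t) :=
    (hfi.integrableOn.sub (integrableOn_const measure_closedBall_lt_top.ne)).norm
  have hvol : volume.real (Metric.closedBall x t)
      = t ^ n * volume.real (Metric.closedBall (0 : Sp n) 1) := by
    rw [Measure.addHaar_real_closedBall' _ _ ht.le, finrank_euclideanSpace, Fintype.card_fin]
  rw [e1, e2, setAverage_eq, hvol]
  calc ‖∫ y in Metric.closedBall x t, radialKer x t y • (f y - f x)‖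
      ≤ ∫ y in Metric.closedBall x t, (t ^ n)⁻¹ * ‖f y - f x‖ := by
        refine norm_integral_le_of_norm_le (hint.const_mul _)
          (Filter.Eventually.of_forall fun y => ?_)
        rw [norm_smul]
        refine mul_le_mul_of_nonneg_right ?_ (norm_nonneg _)
        rw [radialKer, norm_mul, Real.norm_of_nonneg (profile_nonneg _),
          Real.norm_of_nonneg (by positivity)]
        exact mul_le_of_le_one_right (by positivity) (profile_le_one _)
    _ = _ := by
        rw [integral_const_mul, smul_eq_mul]
        field_simp

/-- Weyl's lemma: the mollified value does not depend on the scale, and as the scale tends to 0 it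
converges to a multiple of `h x`. For `‖x‖ < 1/2` all scales below 1/2 are admissible. -/
theorem weyl_ae_eq [CompleteSpace F] {h : Sp n → F} (hi : IntegrableOn h (unitBall n))
    (hw : ∀ ψ, IsTestFun (unitBall n) ψ → ∫ y in unitBall n, lap ψ y • h y = 0) :
    ∀ᵐ x ∂volume, x ∈ Metric.ball (0 : Sp n) (1 / 2) →
      ∫ y in unitBall n, radialKer x (1 / 4) y • h y = kerMass n • h x := by
  filter_upwards [tendsto_integral_radialKer hi] with x hx hxB
  have hx' : ‖x‖ < 1 / 2 := by simpa using hxB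
  refine tendsto_nhds_unique (Filter.Tendsto.congr' ?_ tendsto_const_nhds)
    (hx (by rw [unitBall, mem_ball_zero_iff]; linarith))
  filter_upwards [Ioo_mem_nhdsGT (show (0 : ℝ) < 1 / 2 by norm_num)] with t ht
  exact integral_radialKer_eq hi hw (r := 1 / 2) (by linarith) (by norm_num) ht

/-- The kernel at `x` is a translate of the kernel at 0, which is C¹ with compact support. -/
theorem exists_lipschitz_radialKer (n : ℕ) :
    ∃ L : ℝ, 0 ≤ L ∧ ∀ x y : Sp n, |radialKer x (1 / 4) y - radialKer 0 (1 / 4) y| ≤ L * ‖x‖ := by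
  have hs : ContDiff ℝ 1 (radialKer (0 : Sp n) (1 / 4)) :=
    contDiff_const.mul ((contDiff_profile (k := 1)).comp (contDiff_sqDist 0 (1 / 4)))
  obtain ⟨K, hK⟩ := ContDiff.lipschitzWith_of_hasCompactSupport
    (hasCompactSupport_radialKer (0 : Sp n) (t := 1 / 4) (by norm_num)) hs (by simp)
  refine ⟨K, K.2, fun x y => ?_⟩
  have := hK.dist_le_mul (y - x) y
  rw [Real.dist_eq] at this
  simpa [radialKer, sqDist] using this

/-- Weakly harmonic integrable maps on the unit ball oscillate linearly at the centre. -/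
theorem exists_decay_of_weakly_harmonic (n : ℕ) :
    ∃ C : ℝ, 0 ≤ C ∧ ∀ {F : Type} [NormedAddCommGroup F] [NormedSpace ℝ F] [CompleteSpace F]
      (h : Sp n → F), IntegrableOn h (unitBall n) →
      (∀ ψ, IsTestFun (unitBall n) ψ → ∫ y in unitBall n, lap ψ y • h y = 0) →
      ∀ m : F, ∃ m' : F, ∀ᵐ x ∂volume, x ∈ Metric.ball (0 : Sp n) (1 / 2) →
        ‖h x - m'‖ ≤ C * ‖x‖ * ∫ y in unitBall n, ‖h y - m‖ := by
  obtain ⟨L, hL0, hL⟩ := exists_lipschitz_radialKer n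
  have hc := kerMass_pos (n := n)
  refine ⟨(kerMass n)⁻¹ * L, by positivity, fun {F} _ _ _ h hi hw m => ?_⟩
  refine ⟨(kerMass n)⁻¹ • ∫ y in unitBall n, radialKer 0 (1 / 4) y • h y, ?_⟩
  filter_upwards [weyl_ae_eq hi hw] with x hx hxB
  have hx' : ‖x‖ < 1 / 2 := by simpa using hxB
  have hker : ∀ z : Sp n, IntegrableOn (radialKer z (1 / 4)) (unitBall n) := fun z =>
    ((continuous_radialKer z (1 / 4)).integrable_of_hasCompactSupport
      (hasCompactSupport_radialKer z (by norm_num))).integrableOn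
  -- All kernels have the same mass, so the constant `m` can be subtracted from `h` and cancels in
  -- the difference of two mollified values.
  have hm : ∀ z : Sp n, ‖z‖ < 1 / 2 → ∫ y in unitBall n, radialKer z (1 / 4) y • h y
      = (∫ y in unitBall n, radialKer z (1 / 4) y • (h y - m)) + kerMass n • m := by
    intro z hz
    rw [← setIntegral_radialKer (x := z) (t := 1 / 4) (by norm_num) (by linarith),
      ← integral_smul_const, ← integral_add]
    · simp [smul_sub]
    · simp only [smul_sub]
      exact (integrableOn_radialKer_smul hi z (by norm_num)).sub ((hker z).smul_const m)
    · exact (hker z).smul_const m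
  have e : h x - (kerMass n)⁻¹ • ∫ y in unitBall n, radialKer 0 (1 / 4) y • h y
      = (kerMass n)⁻¹ • ∫ y in unitBall n,
          (radialKer x (1 / 4) y - radialKer 0 (1 / 4) y) • (h y - m) := by
    have e0 : h x = (kerMass n)⁻¹ • ∫ y in unitBall n, radialKer x (1 / 4) y • h y := by
      rw [hx hxB, inv_smul_smul₀ hc.ne']
    have him : IntegrableOn (fun y => h y - m) (unitBall n) :=
      hi.sub (integrableOn_const measure_ball_lt_top.ne)
    rw [e0, ← smul_sub, hm x hx', hm 0 (by simp), add_sub_add_right_eq_sub, ← integral_sub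
      (integrableOn_radialKer_smul him x (by norm_num))
      (integrableOn_radialKer_smul him 0 (by norm_num))]
    simp [sub_smul]
  have him : IntegrableOn (fun y => ‖h y - m‖) (unitBall n) :=
    (hi.sub (integrableOn_const measure_ball_lt_top.ne)).norm
  rw [e, norm_smul, norm_inv, Real.norm_of_nonneg hc.le, mul_assoc, mul_assoc]
  refine mul_le_mul_of_nonneg_left ?_ (by positivity)
  rw [← mul_assoc, ← integral_const_mul]
  refine norm_integral_le_of_norm_le (him.const_mul _) (Filter.Eventually.of_forall fun y => ?_)
  rw [norm_smul]
  exact mul_le_mul_of_nonneg_right (hL x y) (norm_nonneg _)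

end Weyl

end AlmostHarmonic

namespace AlmostHarmonic

/-! ### The `L²` norm on a set -/

section L2

variable {n : ℕ} {F : Type*} [NormedAddCommGroup F]

/-- The norm of `L²(S; F)`. -/
noncomputable def l2norm (S : Set (Sp n)) (f : Sp n → F) : ℝ :=
  (eLpNorm f 2 (volume.restrict S)).toReal

theorem l2norm_nonneg (S : Set (Sp n)) (f : Sp n → F) : 0 ≤ l2norm S f := ENNReal.toReal_nonneg

theorem l2norm_add_le {S : Set (Sp n)} {f g : Sp n → F} (hf : MemLp f 2 (volume.restrict S))
    (hg : MemLp g 2 (volume.restrict S)) :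
    l2norm S (fun x => f x + g x) ≤ l2norm S f + l2norm S g := by
  rw [l2norm, l2norm, l2norm, ← ENNReal.toReal_add hf.eLpNorm_ne_top hg.eLpNorm_ne_top]
  exact ENNReal.toReal_mono (ENNReal.add_ne_top.2 ⟨hf.eLpNorm_ne_top, hg.eLpNorm_ne_top⟩)
    (eLpNorm_add_le hf.aestronglyMeasurable hg.aestronglyMeasurable (by norm_num))

theorem l2norm_mono_set {S T : Set (Sp n)} (h : S ⊆ T) {f : Sp n → F}
    (hf : MemLp f 2 (volume.restrict T)) : l2norm S f ≤ l2norm T f :=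
  ENNReal.toReal_mono hf.eLpNorm_ne_top (eLpNorm_mono_measure f (Measure.restrict_mono h le_rfl))

theorem l2norm_congr {S : Set (Sp n)} {f g : Sp n → F} (h : f =ᵐ[volume.restrict S] g) :
    l2norm S f = l2norm S g := by
  rw [l2norm, eLpNorm_congr_ae h, l2norm]

theorem l2norm_sub_comm (S : Set (Sp n)) (f g : Sp n → F) :
    l2norm S (fun x => f x - g x) = l2norm S (fun x => g x - f x) := by
  rw [l2norm, l2norm, ← eLpNorm_neg]
  congr 2
  ext x
  simp

theorem l2norm_le_of_bound {S : Set (Sp n)} (hS : volume S ≠ ∞) {f : Sp n → F} {c : ℝ}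
    (hc : 0 ≤ c) (h : ∀ᵐ x ∂volume.restrict S, ‖f x‖ ≤ c) :
    l2norm S f ≤ c * √(volume.real S) := by
  have := eLpNorm_le_of_ae_bound (p := 2) h
  have h2 := ENNReal.toReal_mono (ENNReal.mul_ne_top (ENNReal.rpow_ne_top_of_nonneg (by norm_num)
    (by simpa using hS)) ENNReal.ofReal_ne_top) this
  rw [ENNReal.toReal_mul, ← ENNReal.toReal_rpow, ENNReal.toReal_ofReal hc] at h2
  rw [mul_comm, Real.sqrt_eq_rpow]
  simpa [l2norm, measureReal_def] using h2

theorem l2norm_const {S : Set (Sp n)} (c : F) :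
    l2norm S (fun _ => c) = ‖c‖ * √(volume.real S) := by
  rw [l2norm, eLpNorm_const' c (by norm_num) (by norm_num), ENNReal.toReal_mul,
    ← ENNReal.toReal_rpow, Real.sqrt_eq_rpow]
  simp [measureReal_def]

theorem l2norm_sq {S : Set (Sp n)} {f : Sp n → F} (hf : MemLp f 2 (volume.restrict S)) :
    l2norm S f ^ 2 = ∫ x in S, ‖f x‖ ^ 2 := by
  have h := hf.eLpNorm_eq_integral_rpow_norm (by norm_num) (by norm_num)
  rw [l2norm, h, ENNReal.toReal_ofReal (by positivity), ← Real.rpow_natCast, ← Real.rpow_mul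
    (integral_nonneg fun _ => by positivity)]
  simp

theorem integral_norm_le_l2norm {S : Set (Sp n)} (hS : volume S ≠ ∞) {f : Sp n → F}
    (hf : MemLp f 2 (volume.restrict S)) :
    ∫ x in S, ‖f x‖ ≤ √(volume.real S) * l2norm S f := by
  have h := eLpNorm_le_eLpNorm_mul_rpow_measure_univ (p := 1) (q := 2) (by norm_num)
    hf.aestronglyMeasurable
  have h2 := ENNReal.toReal_mono (ENNReal.mul_ne_top hf.eLpNorm_ne_top
    (ENNReal.rpow_ne_top_of_nonneg (by norm_num) (by simpa using hS))) h
  have h1 : (eLpNorm f 1 (volume.restrict S)).toReal = ∫ x in S, ‖f x‖ := by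
    rw [eLpNorm_one_eq_lintegral_enorm, integral_norm_eq_lintegral_enorm hf.aestronglyMeasurable]
  rw [h1, ENNReal.toReal_mul, ← ENNReal.toReal_rpow] at h2
  rw [mul_comm, Real.sqrt_eq_rpow]
  refine h2.trans (le_of_eq ?_)
  norm_num [l2norm, measureReal_def]

end L2

/-! ### Affine changes of variables -/

section Affine

variable {n : ℕ} {F : Type*} [NormedAddCommGroup F]

/-- The map `y ↦ L y + x₀`. -/
noncomputable def aff (L : Sp n ≃L[ℝ] Sp n) (x₀ : Sp n) : Sp n ≃ₜ Sp n :=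
  L.toHomeomorph.trans (Homeomorph.addRight x₀)

@[simp] theorem aff_apply (L : Sp n ≃L[ℝ] Sp n) (x₀ y : Sp n) : aff L x₀ y = L y + x₀ := rfl

@[simp] theorem aff_symm_apply (L : Sp n ≃L[ℝ] Sp n) (x₀ y : Sp n) :
    (aff L x₀).symm y = L.symm (y - x₀) := by
  rw [Homeomorph.symm_apply_eq]
  simp

/-- The factor by which `aff L x₀` contracts the Lebesgue measure. -/
noncomputable def jac (L : Sp n ≃L[ℝ] Sp n) : ℝ :=
  |(LinearMap.det ((L : Sp n →L[ℝ] Sp n) : Sp n →ₗ[ℝ] Sp n))⁻¹|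

theorem det_ne_zero (L : Sp n ≃L[ℝ] Sp n) :
    LinearMap.det ((L : Sp n →L[ℝ] Sp n) : Sp n →ₗ[ℝ] Sp n) ≠ 0 :=
  (LinearEquiv.isUnit_det' L.toLinearEquiv).ne_zero

theorem jac_pos (L : Sp n ≃L[ℝ] Sp n) : 0 < jac L :=
  abs_pos.2 (inv_ne_zero (det_ne_zero L))

theorem map_aff_restrict (L : Sp n ≃L[ℝ] Sp n) (x₀ : Sp n) (S : Set (Sp n)) :
    Measure.map (aff L x₀) (volume.restrict S)
      = ENNReal.ofReal (jac L) • volume.restrict (aff L x₀ '' S) := by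
  have h1 : Measure.map (aff L x₀) volume = ENNReal.ofReal (jac L) • volume := by
    have : (aff L x₀ : Sp n → Sp n)
        = (fun y => y + x₀) ∘ ((L : Sp n →L[ℝ] Sp n) : Sp n →ₗ[ℝ] Sp n) := rfl
    have hm : Measurable ((L : Sp n →L[ℝ] Sp n) : Sp n →ₗ[ℝ] Sp n) := L.continuous.measurable
    rw [this, ← Measure.map_map (measurable_add_const x₀) hm,
      Measure.map_linearMap_addHaar_eq_smul_addHaar volume (det_ne_zero L), Measure.map_smul,
      map_add_right_eq_self]
    rfl
  have h2 := (aff L x₀).measurableEmbedding.restrict_map volume (aff L x₀ '' S)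
  rw [preimage_image_eq _ (aff L x₀).injective, h1, Measure.restrict_smul] at h2
  exact h2.symm

theorem integral_comp_aff [NormedSpace ℝ F] (L : Sp n ≃L[ℝ] Sp n) (x₀ : Sp n) (S : Set (Sp n))
    (f : Sp n → F) :
    ∫ y in S, f (aff L x₀ y) = jac L • ∫ x in aff L x₀ '' S, f x := by
  rw [← (aff L x₀).measurableEmbedding.integral_map, map_aff_restrict, integral_smul_measure,
    ENNReal.toReal_ofReal (jac_pos L).le]

theorem memLp_comp_aff_iff (L : Sp n ≃L[ℝ] Sp n) (x₀ : Sp n) {S : Set (Sp n)}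
    {f : Sp n → F} {p : ℝ≥0∞} :
    MemLp (fun y => f (aff L x₀ y)) p (volume.restrict S) ↔
      MemLp f p (volume.restrict (aff L x₀ '' S)) := by
  have h := (aff L x₀).measurableEmbedding.memLp_map_measure_iff (g := f) (p := p)
    (μ := volume.restrict S)
  rw [Function.comp_def] at h
  rw [← h, map_aff_restrict]
  refine ⟨fun h => ?_, fun h => h.smul_measure ENNReal.ofReal_ne_top⟩
  have := h.smul_measure (c := (ENNReal.ofReal (jac L))⁻¹)
    (ENNReal.inv_ne_top.2 (by simpa using jac_pos L))
  rwa [smul_smul, ENNReal.inv_mul_cancel (by simpa using jac_pos L) ENNReal.ofReal_ne_top,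
    one_smul] at this

theorem l2norm_comp_aff (L : Sp n ≃L[ℝ] Sp n) (x₀ : Sp n) (S : Set (Sp n)) (f : Sp n → F) :
    l2norm S (fun y => f (aff L x₀ y)) = √(jac L) * l2norm (aff L x₀ '' S) f := by
  have h := (aff L x₀).measurableEmbedding.eLpNorm_map_measure (g := f) (p := 2)
    (μ := volume.restrict S)
  rw [map_aff_restrict, Function.comp_def,
    eLpNorm_smul_measure_of_ne_top (by norm_num)] at h
  rw [l2norm, ← h, l2norm, Real.sqrt_eq_rpow, smul_eq_mul, ENNReal.toReal_mul,
    ← ENNReal.toReal_rpow, ENNReal.toReal_ofReal (jac_pos L).le]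
  norm_num

theorem jac_mul_volume (L : Sp n ≃L[ℝ] Sp n) (x₀ : Sp n) (S : Set (Sp n)) :
    jac L * volume.real (aff L x₀ '' S) = volume.real S := by
  have h := integral_comp_aff L x₀ S (fun _ => (1 : ℝ))
  simp only [integral_const, smul_eq_mul, mul_one] at h
  simpa [measureReal_def] using h.symm

theorem ae_comp_aff (L : Sp n ≃L[ℝ] Sp n) (x₀ : Sp n) {S : Set (Sp n)} {p : Sp n → Prop}
    (h : ∀ᵐ x ∂volume.restrict (aff L x₀ '' S), p x) :
    ∀ᵐ y ∂volume.restrict S, p (aff L x₀ y) := by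
  have h2 : ∀ᵐ x ∂Measure.map (aff L x₀) (volume.restrict S), p x := by
    rw [map_aff_restrict]
    exact Measure.ae_smul_measure h _
  exact ((aff L x₀).measurableEmbedding.ae_map_iff).1 h2

theorem IsTestFun.comp_aff {Ω : Set (Sp n)} {φ : Sp n → ℝ} (h : IsTestFun Ω φ)
    (L : Sp n ≃L[ℝ] Sp n) (x₀ : Sp n) :
    IsTestFun (aff L x₀ ⁻¹' Ω) (fun y => φ (aff L x₀ y)) :=
  ⟨h.1.comp (L.contDiff.add contDiff_const), h.2.1.comp_homeomorph (aff L x₀), by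
    have := tsupport_comp_eq_preimage φ (aff L x₀)
    simp only [Function.comp_def] at this
    rw [this]
    exact preimage_mono h.2.2⟩

theorem IsTestFun.fderiv_comp_aff {Ω : Set (Sp n)} {φ : Sp n → ℝ} (h : IsTestFun Ω φ)
    (L : Sp n ≃L[ℝ] Sp n) (x₀ y v : Sp n) :
    fderiv ℝ (fun y => φ (aff L x₀ y)) y v = fderiv ℝ φ (aff L x₀ y) (L v) := by
  have h1 : HasFDerivAt (fun y => aff L x₀ y) (L : Sp n →L[ℝ] Sp n) y :=
    L.hasFDerivAt.add_const x₀
  have := ((h.differentiable (aff L x₀ y)).hasFDerivAt.comp y h1).fderiv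
  simp only [Function.comp_def] at this
  rw [this]
  rfl

end Affine

end AlmostHarmonic

namespace AlmostHarmonic

/-! ### The harmonic part of a square integrable gradient field -/

section Projection

variable {n : ℕ}

theorem integrable_inner_of_memLp {μ : Measure (Sp n)} {f g : Sp n → Sp n} (hf : MemLp f 2 μ)
    (hg : MemLp g 2 μ) : Integrable (fun y => inner ℝ (f y) (g y)) μ := by
  refine (L2.integrable_inner (𝕜 := ℝ) hf.toLp hg.toLp).congr ?_
  filter_upwards [hf.coeFn_toLp, hg.coeFn_toLp] with y h1 h2
  rw [h1, h2]

instance : IsFiniteMeasure (volume.restrict (unitBall n)) :=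
  ⟨by simpa using measure_ball_lt_top⟩

/-- `g` is curl free in the unit ball, in the sense of distributions. -/
def CurlFree (g : Sp n → Sp n) : Prop :=
  ∀ ψ : Sp n → ℝ, IsTestFun (unitBall n) ψ → ∀ v w : Sp n,
    ∫ y in unitBall n, inner ℝ (g y) v * fderiv ℝ ψ y w
      = ∫ y in unitBall n, inner ℝ (g y) w * fderiv ℝ ψ y v

/-- The energy of `g` decreases by at most the factor `1 + κ` when the gradient of a test
function is subtracted. -/
def AlmostMinimal (κ : ℝ) (g : Sp n → Sp n) : Prop :=
  ∀ ψ : Sp n → ℝ, IsTestFun (unitBall n) ψ →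
    ∫ y in unitBall n, ‖g y‖ ^ 2 ≤ (1 + κ) * ∫ y in unitBall n, ‖g y - gradient ψ y‖ ^ 2

/-- Second derivatives of the test function commute. -/
theorem IsWeakGrad.curlFree {u : Sp n → ℝ} {g : Sp n → Sp n} (h : IsWeakGrad (unitBall n) u g) :
    CurlFree g := by
  intro ψ hψ v w
  have h1 := h.integral_mul_fderiv (hψ.dir w) v
  have h2 := h.integral_mul_fderiv (hψ.dir v) w
  simp only [hψ.fderiv_fderiv_comm w v] at h1
  linarith

theorem IsTestFun.memLp_gradient {ψ : Sp n → ℝ} {Ω : Set (Sp n)} (h : IsTestFun Ω ψ) :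
    MemLp (gradient ψ) 2 (volume.restrict (unitBall n)) :=
  h.continuous_gradient.memLp_of_hasCompactSupport h.hasCompactSupport_gradient

variable (n) in
/-- The gradients of test functions, as a subspace of `L²`. -/
noncomputable def gradSubmodule : Submodule ℝ (Lp (Sp n) 2 (volume.restrict (unitBall n))) where
  carrier := {f | ∃ ψ, IsTestFun (unitBall n) ψ ∧ f =ᵐ[volume.restrict (unitBall n)] gradient ψ}
  add_mem' := by
    rintro f g ⟨ψ, hψ, hf⟩ ⟨χ, hχ, hg⟩
    refine ⟨ψ + χ, hψ.add hχ, ?_⟩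
    filter_upwards [hf, hg, Lp.coeFn_add f g] with x h1 h2 h3
    rw [h3, Pi.add_apply, h1, h2]
    simp only [gradient]
    rw [fderiv_add (hψ.differentiable x) (hχ.differentiable x), map_add]
  zero_mem' := ⟨0, IsTestFun.zero, by
    filter_upwards [Lp.coeFn_zero (Sp n) 2 (volume.restrict (unitBall n))] with x hx
    rw [hx]
    simp [gradient]⟩
  smul_mem' := by
    rintro c f ⟨ψ, hψ, hf⟩
    refine ⟨c • ψ, hψ.const_smul c, ?_⟩
    filter_upwards [hf, Lp.coeFn_smul c f] with x h1 h3
    rw [h3, Pi.smul_apply, h1]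
    simp only [gradient]
    rw [fderiv_const_smul (hψ.differentiable x)]
    simp

/-! ### Vanishing curl as an orthogonality condition in L². -/

theorem IsTestFun.memLp_fderiv_smul {ψ : Sp n → ℝ} {Ω : Set (Sp n)} (h : IsTestFun Ω ψ)
    (v w : Sp n) :
    MemLp (fun y => fderiv ℝ ψ y w • v) 2 (volume.restrict (unitBall n)) := by
  have hd := h.dir w
  exact (hd.continuous.smul continuous_const).memLp_of_hasCompactSupport hd.2.1.smul_right

/-- The field `∂_w ψ v - ∂_v ψ w`, to which curl free fields are orthogonal. -/
theorem inner_curlField {ψ : Sp n → ℝ} (h : IsTestFun (unitBall n) ψ) (v w : Sp n)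
    (f : Lp (Sp n) 2 (volume.restrict (unitBall n))) :
    inner ℝ (((h.memLp_fderiv_smul v w).sub (h.memLp_fderiv_smul w v)).toLp) f
      = (∫ y in unitBall n, inner ℝ (f y) v * fderiv ℝ ψ y w)
        - ∫ y in unitBall n, inner ℝ (f y) w * fderiv ℝ ψ y v := by
  have i : ∀ v w, Integrable (fun y => inner ℝ (f y) v * fderiv ℝ ψ y w)
      (volume.restrict (unitBall n)) := by
    intro v w
    refine (integrable_inner_of_memLp (Lp.memLp f) (h.memLp_fderiv_smul v w)).congr
      (Filter.Eventually.of_forall fun y => ?_)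
    simp only [real_inner_smul_right, mul_comm]
  rw [L2.inner_def, ← integral_sub (i v w) (i w v)]
  refine integral_congr_ae ?_
  filter_upwards [((h.memLp_fderiv_smul v w).sub (h.memLp_fderiv_smul w v)).coeFn_toLp] with y hy
  rw [hy, real_inner_comm]
  simp only [Pi.sub_apply, inner_sub_right, real_inner_smul_right]
  ring

theorem CurlFree.congr {g g' : Sp n → Sp n} (h : CurlFree g)
    (he : g =ᵐ[volume.restrict (unitBall n)] g') : CurlFree g' := by
  intro ψ hψ v w
  have e : ∀ v w, ∫ y in unitBall n, inner ℝ (g' y) v * fderiv ℝ ψ y w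
      = ∫ y in unitBall n, inner ℝ (g y) v * fderiv ℝ ψ y w := fun v w =>
    integral_congr_ae (by filter_upwards [he] with y hy; rw [hy])
  rw [e, e, h ψ hψ]

/-- The identity Δ = ∇ div on curl free fields, in weak form: tested in the direction v, the curl
condition applied to each ∂ᵢψ turns Σ ⟨H, v⟩ ∂ᵢ∂ᵢψ into Σ ⟨H, eᵢ⟩ ∂_v∂ᵢψ = ⟨H, ∇∂_vψ⟩, whose
integral is zero because H is divergence free. -/
theorem weakly_harmonic_of_curlFree {H : Sp n → Sp n}
    (hH : MemLp H 2 (volume.restrict (unitBall n))) (hc : CurlFree H)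
    (hd : ∀ χ, IsTestFun (unitBall n) χ →
      ∫ y in unitBall n, inner ℝ (H y) (gradient χ y) = 0)
    {ψ : Sp n → ℝ} (hψ : IsTestFun (unitBall n) ψ) :
    ∫ y in unitBall n, lap ψ y • H y = 0 := by
  set e : Fin n → Sp n := fun i => EuclideanSpace.single i 1 with he
  have hi : ∀ {χ : Sp n → ℝ}, IsTestFun (unitBall n) χ → ∀ v w,
      Integrable (fun y => inner ℝ (H y) v * fderiv ℝ χ y w) (volume.restrict (unitBall n)) := by
    intro χ hχ v w
    refine (integrable_inner_of_memLp hH (hχ.memLp_fderiv_smul v w)).congr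
      (Filter.Eventually.of_forall fun y => ?_)
    simp only [real_inner_smul_right, mul_comm]
  have hlap : Integrable (fun y => lap ψ y • H y) (volume.restrict (unitBall n)) := by
    simp only [lap, Finset.sum_smul]
    refine integrable_finsetSum _ fun i _ => ?_
    have h1 := (hψ.dir (e i)).dir (e i)
    have hHi : IntegrableOn H (unitBall n) := hH.integrable (by norm_num)
    exact hHi.locallyIntegrableOn.integrable_smul_of_tsupport_subset h1.continuous h1.2.1 h1.2.2
  refine ext_inner_left ℝ fun v => ?_
  rw [← integral_inner hlap, inner_zero_right]
  have h1 : ∀ y, inner ℝ v (lap ψ y • H y)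
      = ∑ i, inner ℝ (H y) v * fderiv ℝ (fun z => fderiv ℝ ψ z (e i)) y (e i) := by
    intro y
    rw [real_inner_smul_right, ← Finset.mul_sum, real_inner_comm, mul_comm]
    rfl
  have h2 : ∀ y, inner ℝ (H y) (gradient (fun z => fderiv ℝ ψ z v) y)
      = ∑ i, inner ℝ (H y) (e i) * fderiv ℝ (fun z => fderiv ℝ ψ z (e i)) y v := by
    intro y
    rw [← (EuclideanSpace.basisFun (Fin n) ℝ).sum_inner_mul_inner]
    refine Finset.sum_congr rfl fun i _ => ?_
    rw [EuclideanSpace.basisFun_apply, real_inner_comm (gradient _ y), inner_gradient_left,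
      hψ.fderiv_fderiv_comm]
  simp only [h1]
  rw [integral_finsetSum _ fun i _ => hi (hψ.dir (e i)) v (e i)]
  have h3 := hd _ (hψ.dir v)
  simp only [h2] at h3
  rw [integral_finsetSum _ fun i _ => hi (hψ.dir (e i)) (e i) v] at h3
  rw [← h3]
  exact Finset.sum_congr rfl fun i _ => hc _ (hψ.dir (e i)) v (e i)

/-- `H` is the component of `g` orthogonal to the closed span of test gradients. Orthogonality says
that it is divergence free; both `g` and the limits of gradients are curl free, so `H` is too. -/
theorem exists_harmonic_part {g : Sp n → Sp n} (hg : MemLp g 2 (volume.restrict (unitBall n)))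
    (hc : CurlFree g) {κ : ℝ} (hκ : 0 ≤ κ) (hm : AlmostMinimal κ g) :
    ∃ H : Sp n → Sp n, MemLp H 2 (volume.restrict (unitBall n)) ∧
      (∀ ψ, IsTestFun (unitBall n) ψ → ∫ y in unitBall n, lap ψ y • H y = 0) ∧
      l2norm (unitBall n) (fun y => g y - H y) ≤ √κ * l2norm (unitBall n) g := by
  set S := (gradSubmodule n).topologicalClosure with hS
  set gL := hg.toLp with hgL
  set P := S.starProjection gL with hP
  set H := gL - P with hH
  have hPS : P ∈ S := S.starProjection_apply_mem gL
  have hHS : ∀ f ∈ S, inner ℝ f H = 0 := fun f hf =>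
    S.sub_starProjection_mem_orthogonal gL f hf
  have hgradS : ∀ {χ} (hχ : IsTestFun (unitBall n) χ), hχ.memLp_gradient.toLp ∈ S := fun hχ =>
    Submodule.le_topologicalClosure _ ⟨_, hχ, hχ.memLp_gradient.coeFn_toLp⟩
  have hcurl : CurlFree H := by
    intro ψ hψ v w
    rw [← sub_eq_zero, ← inner_curlField hψ, hH, inner_sub_right]
    set Z := ((hψ.memLp_fderiv_smul v w).sub (hψ.memLp_fderiv_smul w v)).toLp with hZ
    have z1 : inner ℝ Z gL = 0 := by
      rw [hZ, inner_curlField hψ, sub_eq_zero]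
      exact hc.congr hg.coeFn_toLp.symm ψ hψ v w
    -- Orthogonality to the curl field is a closed condition, so it is enough to check it on
    -- gradients of test functions.
    have z2 : ∀ f ∈ S, inner ℝ Z f = 0 := by
      have hcl : IsClosed {f : Lp (Sp n) 2 (volume.restrict (unitBall n)) | inner ℝ Z f = 0} :=
        isClosed_eq (continuous_const.inner continuous_id) continuous_const
      intro f hf
      refine closure_minimal (s := (gradSubmodule n : Set (Lp (Sp n) 2 _))) ?_ hcl
        (by rw [← Submodule.topologicalClosure_coe]; exact hf)
      rintro f ⟨χ, hχ, hf⟩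
      rw [mem_ofPred_eq, hZ, inner_curlField hψ, sub_eq_zero]
      exact (IsWeakGrad.of_contDiff (hχ.mono (subset_univ _))).curlFree.congr hf.symm ψ hψ v w
    rw [z1, z2 P hPS, sub_zero]
  -- The almost minimality inequality is closed in L², so it passes from test gradients to their
  -- limit `P`.
  have hmin : ‖gL‖ ^ 2 ≤ (1 + κ) * ‖gL - P‖ ^ 2 := by
    have hcl : IsClosed {f : Lp (Sp n) 2 (volume.restrict (unitBall n)) |
        ‖gL‖ ^ 2 ≤ (1 + κ) * ‖gL - f‖ ^ 2} :=
      isClosed_le continuous_const (by fun_prop)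
    refine closure_minimal (s := (gradSubmodule n : Set (Lp (Sp n) 2 _))) ?_ hcl
      (by rw [← Submodule.topologicalClosure_coe]; exact hPS)
    rintro f ⟨χ, hχ, hf⟩
    have := hm χ hχ
    rw [← l2norm_sq hg, ← l2norm_sq (f := fun y => g y - gradient χ y)
      (hg.sub hχ.memLp_gradient)] at this
    rw [mem_ofPred_eq, Lp.norm_def, Lp.norm_def]
    rw [l2norm, l2norm] at this
    rw [eLpNorm_congr_ae hg.coeFn_toLp]
    have e : (gL - f : Lp (Sp n) 2 (volume.restrict (unitBall n)))
        =ᵐ[volume.restrict (unitBall n)] fun y => g y - gradient χ y := by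
      filter_upwards [Lp.coeFn_sub gL f, hf, hg.coeFn_toLp] with y h1 h2 h3
      rw [h1, Pi.sub_apply, h2, h3]
    rwa [eLpNorm_congr_ae e]
  have hpyth : ‖gL‖ ^ 2 = ‖P‖ ^ 2 + ‖H‖ ^ 2 := by
    have : gL = P + H := by rw [hH]; abel
    have h0 := norm_add_sq_eq_norm_sq_add_norm_sq_real (hHS P hPS)
    rw [← this] at h0
    nlinarith
  have hP2 : ‖P‖ ≤ √κ * ‖gL‖ := by
    -- By Pythagoras ‖P‖² = ‖g‖² - ‖H‖² ≤ κ ‖H‖² ≤ κ ‖g‖².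
    have h1 : ‖P‖ ^ 2 ≤ κ * ‖gL‖ ^ 2 := by
      rw [← hH] at hmin
      nlinarith [sq_nonneg ‖P‖, mul_nonneg hκ (sq_nonneg ‖P‖)]
    rw [← Real.sqrt_sq (norm_nonneg P), ← Real.sqrt_sq (norm_nonneg gL), ← Real.sqrt_mul hκ]
    exact Real.sqrt_le_sqrt h1
  refine ⟨H, Lp.memLp H, fun ψ hψ => weakly_harmonic_of_curlFree (Lp.memLp H) hcurl ?_ hψ, ?_⟩
  · intro χ hχ
    have := hHS _ (hgradS hχ)
    rw [real_inner_comm, L2.inner_def] at this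
    rw [← this]
    refine integral_congr_ae ?_
    filter_upwards [hχ.memLp_gradient.coeFn_toLp] with y hy
    rw [hy]
  · have e : (fun y => g y - H y) =ᵐ[volume.restrict (unitBall n)] P := by
      filter_upwards [Lp.coeFn_sub gL P, hg.coeFn_toLp] with y h1 h2
      rw [hH, h1, Pi.sub_apply, h2, sub_sub_cancel]
    rw [l2norm_congr e]
    rw [Lp.norm_def, Lp.norm_def, eLpNorm_congr_ae hg.coeFn_toLp] at hP2
    exact hP2

end Projection

/-! ### Excess decay at one scale -/

section OneStep

/-- The dilation `y ↦ θ y` as a continuous linear equivalence. -/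
noncomputable def dil (n : ℕ) (θ : ℝ) (hθ : θ ≠ 0) : Sp n ≃L[ℝ] Sp n :=
  ContinuousLinearEquiv.smulLeft (Units.mk0 θ hθ)

/-- Linear decay of the harmonic part, plus the distance to it. Only `D` depends on θ, through the
Jacobian of the dilation; this order of quantifiers lets θ be chosen afterwards according to `C`. -/
theorem exists_one_step_decay (n : ℕ) :
    ∃ C : ℝ, 0 ≤ C ∧ ∀ θ : ℝ, 0 < θ → θ ≤ 1 / 2 → ∃ D : ℝ, 0 ≤ D ∧
      ∀ g : Sp n → Sp n, MemLp g 2 (volume.restrict (unitBall n)) → CurlFree g →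
      ∀ κ : ℝ, 0 ≤ κ → AlmostMinimal κ g → ∀ m : Sp n, ∃ m' : Sp n,
        l2norm (unitBall n) (fun y => g (θ • y) - m') ≤
          C * θ * l2norm (unitBall n) (fun y => g y - m)
            + D * √κ * l2norm (unitBall n) g := by
  obtain ⟨C, hC0, hC⟩ := exists_decay_of_weakly_harmonic n
  set b := volume.real (unitBall n) with hb
  have hb0 : 0 ≤ b := measureReal_nonneg
  refine ⟨C * b, by positivity, fun θ hθ hθ2 => ?_⟩
  have hdil : ∀ y, dil n θ hθ.ne' y = θ • y := fun y => rfl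
  have hsub : aff (dil n θ hθ.ne') 0 '' unitBall n ⊆ Metric.ball 0 (1 / 2) := by
    rintro _ ⟨y, hy, rfl⟩
    rw [unitBall, mem_ball_zero_iff] at hy
    rw [mem_ball_zero_iff, aff_apply, hdil, add_zero, norm_smul, Real.norm_of_nonneg hθ.le]
    nlinarith [norm_nonneg y]
  have hsub1 : aff (dil n θ hθ.ne') 0 '' unitBall n ⊆ unitBall n :=
    hsub.trans (Metric.ball_subset_ball (by norm_num))
  have hmem : ∀ {f : Sp n → Sp n}, MemLp f 2 (volume.restrict (unitBall n)) →
      MemLp (fun y => f (θ • y)) 2 (volume.restrict (unitBall n)) := by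
    intro f hf
    have := (memLp_comp_aff_iff (dil n θ hθ.ne') 0).2
      (hf.mono_measure (Measure.restrict_mono hsub1 le_rfl))
    simpa [hdil] using this
  refine ⟨C * θ * b + √(jac (dil n θ hθ.ne')), by positivity,
    fun g hg hc κ hκ hm m => ?_⟩
  obtain ⟨H, hH, hw, hgH⟩ := exists_harmonic_part hg hc hκ hm
  obtain ⟨m', hm'⟩ := hC H (hH.integrable (by norm_num)) hw m
  refine ⟨m', ?_⟩
  have hvol : volume (unitBall n) ≠ ∞ := measure_ball_lt_top.ne
  have hconst : ∀ c : Sp n, MemLp (fun _ : Sp n => c) 2 (volume.restrict (unitBall n)) :=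
    fun c => memLp_const c
  have h1 : l2norm (unitBall n) (fun y => g (θ • y) - H (θ • y))
      ≤ √(jac (dil n θ hθ.ne')) * (√κ * l2norm (unitBall n) g) := by
    have := l2norm_comp_aff (dil n θ hθ.ne') 0 (unitBall n) (fun y => g y - H y)
    simp only [aff_apply, hdil, add_zero] at this
    rw [this]
    exact mul_le_mul_of_nonneg_left ((l2norm_mono_set hsub1 (hg.sub hH)).trans hgH)
      (Real.sqrt_nonneg _)
  have h2 : l2norm (unitBall n) (fun y => H y - m) ≤
      l2norm (unitBall n) (fun y => g y - m) + √κ * l2norm (unitBall n) g := by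
    have := l2norm_add_le (S := unitBall n) (f := fun y => H y - g y) (g := fun y => g y - m)
      (hH.sub hg) (hg.sub (hconst m))
    have e : ∀ y, H y - g y + (g y - m) = H y - m := fun y => by abel
    simp only [e] at this
    rw [l2norm_sub_comm _ H g] at this
    linarith
  have h3 : l2norm (unitBall n) (fun y => H (θ • y) - m') ≤
      C * θ * b * l2norm (unitBall n) (fun y => H y - m) := by
    -- The factor `b` arises as √b · √b: once from Cauchy–Schwarz here, once from bounding an L²
    -- norm by a supremum.
    have hi := integral_norm_le_l2norm hvol (hH.sub (hconst m))
    have hl := l2norm_nonneg (unitBall n) (fun y => H y - m)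
    have := l2norm_le_of_bound hvol (f := fun y => H (θ • y) - m')
      (c := C * θ * (√b * l2norm (unitBall n) (fun y => H y - m))) (by positivity) ?_
    · refine this.trans (le_of_eq ?_)
      rw [← hb]
      calc _ = C * θ * (√b * √b) * l2norm (unitBall n) (fun y => H y - m) := by ring
        _ = _ := by rw [Real.mul_self_sqrt hb0]
    · have h4 := ae_comp_aff (dil n θ hθ.ne') 0 (S := unitBall n)
        (ae_restrict_of_ae_restrict_of_subset (s := aff (dil n θ hθ.ne') 0 '' unitBall n)
          (t := univ) (subset_univ _) (by simpa using hm'))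
      filter_upwards [h4, ae_restrict_mem Metric.isOpen_ball.measurableSet] with y hy hyB
      have hy2 := hsub (mem_image_of_mem _ hyB)
      rw [mem_ball_zero_iff] at hy2
      have hyB' : ‖y‖ ≤ 1 := by
        rw [mem_ball_zero_iff] at hyB
        exact hyB.le
      simp only [aff_apply, hdil, add_zero] at hy hy2
      refine (hy (by simpa using hy2)).trans ?_
      rw [norm_smul, Real.norm_of_nonneg hθ.le]
      have hi0 : 0 ≤ ∫ y in unitBall n, ‖H y - m‖ := integral_nonneg fun _ => norm_nonneg _
      have : C * (θ * ‖y‖) ≤ C * θ := by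
        have := mul_le_mul_of_nonneg_left hyB' (mul_nonneg hC0 hθ.le)
        linarith
      exact (mul_le_mul_of_nonneg_right this hi0).trans
        (mul_le_mul_of_nonneg_left hi (by positivity))
  have h5 := l2norm_add_le (S := unitBall n) (f := fun y => g (θ • y) - H (θ • y))
    (g := fun y => H (θ • y) - m') ((hmem hg).sub (hmem hH)) ((hmem hH).sub (hconst m'))
  have e5 : ∀ y, g (θ • y) - H (θ • y) + (H (θ • y) - m') = g (θ • y) - m' := fun y => by abel
  simp only [e5] at h5
  have h6 := mul_le_mul_of_nonneg_left h2 (show 0 ≤ C * θ * b by positivity)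
  calc _ ≤ _ := h5
    _ ≤ √(jac (dil n θ hθ.ne')) * (√κ * l2norm (unitBall n) g)
        + C * θ * b * (l2norm (unitBall n) (fun y => g y - m)
          + √κ * l2norm (unitBall n) g) := add_le_add h1 (h3.trans h6)
    _ = _ := by ring

end OneStep

end AlmostHarmonic

namespace AlmostHarmonic

/-! ### Coefficients -/

section Coeff

variable {n : ℕ}

theorem inner_op_left (B : Matrix (Fin n) (Fin n) ℝ) (v w : Sp n) :
    inner ℝ (op B v) w = inner ℝ v (op (star B) w) := by
  rw [op, op, map_star, ContinuousLinearMap.star_eq_adjoint,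
    ContinuousLinearMap.adjoint_inner_right]

theorem nonneg_of_quad_nonneg {B : Matrix (Fin n) (Fin n) ℝ} (hs : B.IsSymm)
    (h : ∀ ξ, 0 ≤ quad B ξ) : 0 ≤ B := by
  rw [Matrix.nonneg_iff_posSemidef]
  refine Matrix.PosSemidef.of_dotProduct_mulVec_nonneg
    (by rw [Matrix.IsHermitian, Matrix.conjTranspose_eq_transpose_of_trivial]; exact hs) fun x => ?_
  have := h (WithLp.toLp 2 x)
  simpa [quad, PiLp.inner_apply, dotProduct, mul_comm] using this

/-- The square root of a positive definite matrix as an invertible operator. -/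
theorem exists_sqrt_equiv {B : Matrix (Fin n) (Fin n) ℝ} (hs : B.IsSymm) {l : ℝ} (hl : 0 < l)
    (h : ∀ ξ, l * ‖ξ‖ ^ 2 ≤ quad B ξ) :
    ∃ T : Sp n ≃L[ℝ] Sp n, (∀ y, T y = op (CFC.sqrt B) y) ∧
      (∀ v w, inner ℝ (T v) w = inner ℝ v (T w)) ∧ ∀ ξ, ‖T ξ‖ ^ 2 = quad B ξ := by
  have hB : 0 ≤ B := nonneg_of_quad_nonneg hs fun ξ => (by positivity : (0:ℝ) ≤ _).trans (h ξ)
  have hstar : star (CFC.sqrt B) = CFC.sqrt B := (CFC.sqrt_nonneg B).isSelfAdjoint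
  have hsymm : ∀ v w, inner ℝ (op (CFC.sqrt B) v) w = inner ℝ v (op (CFC.sqrt B) w) := by
    intro v w
    rw [inner_op_left, hstar]
  have hq : ∀ ξ, ‖op (CFC.sqrt B) ξ‖ ^ 2 = quad B ξ := by
    intro ξ
    rw [← real_inner_self_eq_norm_sq, hsymm, ← mul_apply_eq_comp, ← map_mul,
      CFC.sqrt_mul_sqrt_self B hB, real_inner_comm]
    rfl
  have hinj : Function.Injective (op (CFC.sqrt B)) := by
    rw [injective_iff_map_eq_zero]
    intro ξ hξ
    have h1 := h ξ
    rw [← hq, hξ, norm_zero] at h1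
    have : ‖ξ‖ ^ 2 ≤ 0 := by nlinarith
    simpa using this
  refine ⟨(LinearEquiv.ofInjectiveEndo (op (CFC.sqrt B) : Sp n →ₗ[ℝ] Sp n)
    hinj).toContinuousLinearEquiv, fun y => rfl, hsymm, hq⟩

variable {α : ℝ≥0} {M : ℝ} {A : Sp n → Matrix (Fin n) (Fin n) ℝ}

theorem IsCoeff.one_le (h : IsCoeff α M A) : 1 ≤ M := by
  obtain ⟨-, ⟨l, L, hl, hl1, hL, hlM, hLM, -⟩, -⟩ := h
  exact hL.trans hLM

theorem IsCoeff.quad_le (h : IsCoeff α M A) {x : Sp n} (hx : x ∈ unitBall n) (ξ : Sp n) :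
    quad (A x) ξ ≤ M * ‖ξ‖ ^ 2 := by
  obtain ⟨-, ⟨l, L, hl, hl1, hL, hlM, hLM, hq⟩, -⟩ := h
  exact (hq x hx ξ).2.trans (by gcongr)

theorem IsCoeff.le_quad (h : IsCoeff α M A) {x : Sp n} (hx : x ∈ unitBall n) (ξ : Sp n) :
    ‖ξ‖ ^ 2 ≤ M * quad (A x) ξ := by
  have hM := h.one_le
  obtain ⟨-, ⟨l, L, hl, hl1, hL, hlM, hLM, hq⟩, -⟩ := h
  have h1 := (hq x hx ξ).1
  have h2 : 1 ≤ M * l := by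
    rw [inv_le_iff_one_le_mul₀ hl] at hlM
    exact hlM
  nlinarith [sq_nonneg ‖ξ‖, mul_le_mul_of_nonneg_left h1 (by linarith : (0 : ℝ) ≤ M)]

theorem IsCoeff.norm_op_sub_le (h : IsCoeff α M A) {x y : Sp n} (hx : x ∈ unitBall n)
    (hy : y ∈ unitBall n) : ‖op (A x) - op (A y)‖ ≤ M * ‖x - y‖ ^ (α : ℝ) := by
  have hM := h.one_le
  have h1 : eHolderNorm α ((unitBall n).domRestrict fun x => op (A x)) ≤ ENNReal.ofReal M :=
    le_trans le_add_self h.2.2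
  have h2 : MemHolder α ((unitBall n).domRestrict fun x => op (A x)) := by
    rw [← eHolderNorm_ne_top]
    exact (h1.trans_lt ENNReal.ofReal_lt_top).ne
  have h3 := h2.holderWith.dist_le ⟨x, hx⟩ ⟨y, hy⟩
  have h4 : (nnHolderNorm α ((unitBall n).domRestrict fun x => op (A x)) : ℝ) ≤ M := by
    rw [← h2.coe_nnHolderNorm_eq_eHolderNorm, ENNReal.ofReal] at h1
    have := ENNReal.coe_le_coe.1 h1
    rw [← NNReal.coe_le_coe, Real.coe_toNNReal _ (by linarith)] at this
    exact this
  rw [← dist_eq_norm, ← dist_eq_norm]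
  refine h3.trans ?_
  rw [Subtype.dist_eq]
  exact mul_le_mul_of_nonneg_right h4 (by positivity)

theorem IsCoeff.abs_quad_sub_le (h : IsCoeff α M A) {x y : Sp n} (hx : x ∈ unitBall n)
    (hy : y ∈ unitBall n) (ξ : Sp n) :
    |quad (A x) ξ - quad (A y) ξ| ≤ M * ‖x - y‖ ^ (α : ℝ) * ‖ξ‖ ^ 2 := by
  rw [quad, quad, ← inner_sub_left, ← sub_apply]
  refine (abs_real_inner_le_norm _ _).trans ?_
  rw [sq, ← mul_assoc]
  refine mul_le_mul_of_nonneg_right ?_ (norm_nonneg _)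
  exact ((op (A x) - op (A y)).le_opNorm ξ).trans
    (mul_le_mul_of_nonneg_right (h.norm_op_sub_le hx hy) (norm_nonneg _))

theorem IsCoeff.continuousOn (h : IsCoeff α M A) (hα : 0 < α) :
    ContinuousOn (fun x => op (A x)) (unitBall n) := by
  intro x hx
  rw [ContinuousWithinAt, tendsto_iff_norm_sub_tendsto_zero]
  have h1 : Filter.Tendsto (fun y : Sp n => M * ‖y - x‖ ^ (α : ℝ)) (𝓝[unitBall n] x) (𝓝 0) := by
    have hc : Continuous fun y : Sp n => M * ‖y - x‖ ^ (α : ℝ) :=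
      continuous_const.mul ((continuous_id.sub continuous_const).norm.rpow_const
        fun _ => Or.inr (by positivity))
    have := hc.tendsto x
    simp only [sub_self, norm_zero] at this
    rw [Real.zero_rpow (by positivity), mul_zero] at this
    exact this.mono_left nhdsWithin_le_nhds
  refine squeeze_zero' (Filter.Eventually.of_forall fun _ => norm_nonneg _) ?_ h1
  filter_upwards [self_mem_nhdsWithin] with y hy
  exact h.norm_op_sub_le hy hx

theorem IsCoeff.integrableOn_quad (h : IsCoeff α M A) (hα : 0 < α) {S : Set (Sp n)}
    (hS : MeasurableSet S) (hSB : S ⊆ unitBall n) {G : Sp n → Sp n}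
    (hG : MemLp G 2 (volume.restrict S)) : IntegrableOn (fun x => quad (A x) (G x)) S := by
  have hm : AEStronglyMeasurable (fun x => op (A x)) (volume.restrict S) :=
    ((h.continuousOn hα).mono hSB).aestronglyMeasurable hS
  refine Integrable.mono' ((integrable_inner_of_memLp hG hG).const_mul M)
    (((isBoundedBilinearMap_apply (𝕜 := ℝ) (E := Sp n) (F := Sp n)).continuous
      |>.comp_aestronglyMeasurable (hm.prodMk hG.aestronglyMeasurable)).inner
      hG.aestronglyMeasurable) ?_
  filter_upwards [ae_restrict_mem hS] with x hx
  have h1 := h.quad_le (hSB hx) (G x)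
  have h2 := h.le_quad (hSB hx) (G x)
  have hM := h.one_le
  change ‖quad (A x) (G x)‖ ≤ _
  rw [real_inner_self_eq_norm_sq, Real.norm_of_nonneg]
  · exact h1
  · by_contra hc
    nlinarith [sq_nonneg ‖G x‖]

end Coeff

end AlmostHarmonic

namespace AlmostHarmonic

/-! ### Transport of an almost harmonic function to the unit ball -/

section Transport

variable {n : ℕ}

/-- The map `y ↦ x₀ + T (r y)`. -/
noncomputable def frame (T : Sp n ≃L[ℝ] Sp n) (x₀ : Sp n) {r : ℝ} (hr : 0 < r) : Sp n ≃ₜ Sp n :=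
  aff ((dil n r hr.ne').trans T) x₀

theorem frame_apply (T : Sp n ≃L[ℝ] Sp n) (x₀ : Sp n) {r : ℝ} (hr : 0 < r) (y : Sp n) :
    frame T x₀ hr y = r • T y + x₀ := by
  rw [← map_smul]
  rfl

theorem image_frame_unitBall {A : Sp n → Matrix (Fin n) (Fin n) ℝ} {T : Sp n ≃L[ℝ] Sp n}
    {x₀ : Sp n} (hT : ∀ y, T y = op (CFC.sqrt (A x₀)) y) {r : ℝ} (hr : 0 < r) :
    frame T x₀ hr '' unitBall n = ellipsoid A x₀ r := by
  have h1 : Metric.ball (0 : Sp n) r = (fun y => r • y) '' unitBall n := by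
    have := smul_unitBall_of_pos (E := Sp n) hr
    rw [← this]
    rfl
  rw [ellipsoid, h1, image_image]
  refine image_congr fun y _ => ?_
  rw [frame_apply, ← hT, map_smul]

theorem isOpen_image_frame (T : Sp n ≃L[ℝ] Sp n) (x₀ : Sp n) {r : ℝ} (hr : 0 < r) :
    IsOpen (frame T x₀ hr '' unitBall n) :=
  (frame T x₀ hr).isOpenMap _ Metric.isOpen_ball

/-- Test functions on the ellipsoid from test functions on the unit ball. -/
theorem IsTestFun.exists_frame {T : Sp n ≃L[ℝ] Sp n} {x₀ : Sp n} {r : ℝ} (hr : 0 < r)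
    {ψ : Sp n → ℝ} (hψ : IsTestFun (unitBall n) ψ) :
    ∃ χ : Sp n → ℝ, IsTestFun (frame T x₀ hr '' unitBall n) χ ∧
      (∀ y, χ (frame T x₀ hr y) = r * ψ y) ∧
      ∀ y v, fderiv ℝ χ (frame T x₀ hr y) (T v) = fderiv ℝ ψ y v := by
  set L := (dil n r hr.ne').trans T with hL
  have hLapp : ∀ y, L y = r • T y := fun y => by
    rw [← map_smul]
    rfl
  have hinv : ∀ z, aff L.symm (-(L.symm x₀)) z = (frame T x₀ hr).symm z := by
    intro z
    rw [frame, aff_symm_apply, aff_apply, ← hL, map_sub, sub_eq_add_neg]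
  have h0 := hψ.comp_aff L.symm (-(L.symm x₀))
  simp only [hinv] at h0
  have hpre : aff L.symm (-(L.symm x₀)) ⁻¹' unitBall n = frame T x₀ hr '' unitBall n := by
    ext z
    rw [mem_preimage, hinv, ← Homeomorph.preimage_symm, mem_preimage]
  rw [hpre] at h0
  refine ⟨_, h0.const_smul r, fun y => by simp, fun y v => ?_⟩
  have h2 := (h0.const_smul r).fderiv_comp_aff L x₀ y v
  have e : (fun y => (r • fun y => ψ ((frame T x₀ hr).symm y)) (aff L x₀ y)) = r • ψ := by
    ext y
    have : (frame T x₀ hr).symm (aff L x₀ y) = y := (frame T x₀ hr).symm_apply_apply y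
    simp only [Pi.smul_apply, this]
  rw [e, hLapp, map_smul, fderiv_const_smul (hψ.differentiable y)] at h2
  simp only [_root_.smul_apply, smul_eq_mul] at h2
  exact (mul_left_cancel₀ hr.ne' h2).symm

/-- Weak chain rule: the factor r⁻¹ compensates the dilation, and symmetry of `T` replaces the
adjoint by `T`. -/
theorem IsWeakGrad.comp_frame {T : Sp n ≃L[ℝ] Sp n} (hsymm : ∀ v w, inner ℝ (T v) w = inner ℝ v (T w))
    {x₀ : Sp n} {r : ℝ} (hr : 0 < r) {u : Sp n → ℝ} {G : Sp n → Sp n}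
    (h : IsWeakGrad (frame T x₀ hr '' unitBall n) u G)
    (hu : MemLp u 2 (volume.restrict (frame T x₀ hr '' unitBall n)))
    (hG : MemLp G 2 (volume.restrict (frame T x₀ hr '' unitBall n))) :
    IsWeakGrad (unitBall n) (fun y => r⁻¹ * u (frame T x₀ hr y))
      (fun y => T (G (frame T x₀ hr y))) := by
  have hu' := (memLp_comp_aff_iff ((dil n r hr.ne').trans T) x₀).2 hu
  have hG' := (memLp_comp_aff_iff ((dil n r hr.ne').trans T) x₀).2 hG
  have hGi : IntegrableOn (fun y => G (frame T x₀ hr y)) (unitBall n) :=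
    hG'.integrable (by norm_num)
  have hui : IntegrableOn (fun y => u (frame T x₀ hr y)) (unitBall n) :=
    hu'.integrable (by norm_num)
  have hTG : IntegrableOn (fun y => T (G (frame T x₀ hr y))) (unitBall n) :=
    (T : Sp n →L[ℝ] Sp n).integrable_comp hGi
  have hui' : IntegrableOn (fun y => r⁻¹ * u (frame T x₀ hr y)) (unitBall n) :=
    hui.const_mul r⁻¹
  refine ⟨hui'.locallyIntegrableOn, hTG.locallyIntegrableOn, fun φ hφ i => ?_⟩
  obtain ⟨χ, hχ, hχ1, hχ2⟩ := hφ.exists_frame (T := T) (x₀ := x₀) hr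
  have key := h.integral_mul_fderiv hχ (T (EuclideanSpace.single i 1))
  have c1 := integral_comp_aff ((dil n r hr.ne').trans T) x₀ (unitBall n)
    (fun x => u x * fderiv ℝ χ x (T (EuclideanSpace.single i 1)))
  have c2 := integral_comp_aff ((dil n r hr.ne').trans T) x₀ (unitBall n)
    (fun x => inner ℝ (G x) (T (EuclideanSpace.single i 1)) * χ x)
  change _ = _ • ∫ x in frame T x₀ hr '' unitBall n, _ at c1 c2
  rw [key] at c1
  rw [smul_neg, ← c2] at c1
  change ∫ y in unitBall n, u (frame T x₀ hr y) *
    fderiv ℝ χ (frame T x₀ hr y) (T (EuclideanSpace.single i 1)) = - ∫ y in unitBall n,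
      inner ℝ (G (frame T x₀ hr y)) (T (EuclideanSpace.single i 1)) * χ (frame T x₀ hr y) at c1
  simp only [hχ1, hχ2, ← hsymm] at c1
  have e1 : ∀ y, r⁻¹ * u (frame T x₀ hr y) * fderiv ℝ φ y (EuclideanSpace.single i 1)
      = r⁻¹ * (u (frame T x₀ hr y) * fderiv ℝ φ y (EuclideanSpace.single i 1)) :=
    fun y => by ring
  have e2 : ∀ y, inner ℝ (T (G (frame T x₀ hr y))) (EuclideanSpace.single i (1 : ℝ))
      * (r * φ y) = r * (T (G (frame T x₀ hr y)) i * φ y) := by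
    intro y
    rw [EuclideanSpace.inner_single_right]
    simp
    ring
  simp only [e2] at c1
  simp only [e1]
  rw [integral_const_mul, c1, integral_const_mul]
  field_simp

/-! ### Freezing the coefficients at the centre of the ellipsoid. -/

variable {α : ℝ≥0} {M : ℝ} {A : Sp n → Matrix (Fin n) (Fin n) ℝ}

/-- The natural constant is √M; since M ≥ 1 it is replaced by M. -/
theorem IsCoeff.norm_sqrt_le (h : IsCoeff α M A) {x₀ : Sp n} (hx₀ : x₀ ∈ unitBall n)
    {T : Sp n ≃L[ℝ] Sp n} (hq : ∀ ξ, ‖T ξ‖ ^ 2 = quad (A x₀) ξ) (ξ : Sp n) :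
    ‖T ξ‖ ≤ M * ‖ξ‖ := by
  have hM := h.one_le
  have h1 := h.quad_le hx₀ ξ
  rw [← hq] at h1
  refine abs_le_of_sq_le_sq' ?_ (by positivity) |>.2
  nlinarith [sq_nonneg ‖ξ‖, mul_nonneg (by linarith : (0 : ℝ) ≤ M) (sq_nonneg ‖ξ‖)]

theorem IsCoeff.le_norm_sqrt (h : IsCoeff α M A) {x₀ : Sp n} (hx₀ : x₀ ∈ unitBall n)
    {T : Sp n ≃L[ℝ] Sp n} (hq : ∀ ξ, ‖T ξ‖ ^ 2 = quad (A x₀) ξ) (ξ : Sp n) :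
    ‖ξ‖ ≤ M * ‖T ξ‖ := by
  have hM := h.one_le
  have h1 := h.le_quad hx₀ ξ
  rw [← hq] at h1
  refine abs_le_of_sq_le_sq' ?_ (by positivity) |>.2
  nlinarith [sq_nonneg ‖T ξ‖, mul_nonneg (by linarith : (0 : ℝ) ≤ M) (sq_nonneg ‖T ξ‖)]

/-- In the ellipsoid of size `r`, freezing the coefficients costs a factor `1 + M³ r ^ α`. -/
theorem IsCoeff.quad_freeze (h : IsCoeff α M A) {x₀ : Sp n} (hx₀ : x₀ ∈ unitBall n)
    {T : Sp n ≃L[ℝ] Sp n} (hq : ∀ ξ, ‖T ξ‖ ^ 2 = quad (A x₀) ξ) (hα : α < 1) {r : ℝ} (hr : 0 < r)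
    {y : Sp n} (hy : y ∈ unitBall n) (hx : frame T x₀ hr y ∈ unitBall n) (ξ : Sp n) :
    ‖T ξ‖ ^ 2 ≤ (1 + M ^ 3 * r ^ (α : ℝ)) * quad (A (frame T x₀ hr y)) ξ ∧
      quad (A (frame T x₀ hr y)) ξ ≤ (1 + M ^ 3 * r ^ (α : ℝ)) * ‖T ξ‖ ^ 2 := by
  have hM := h.one_le
  have hM0 : (0 : ℝ) ≤ M := by linarith
  rw [unitBall, mem_ball_zero_iff] at hy
  have hd : ‖frame T x₀ hr y - x₀‖ ≤ M * r := by
    rw [frame_apply, add_sub_cancel_right, norm_smul, Real.norm_of_nonneg hr.le, mul_comm]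
    refine mul_le_mul_of_nonneg_right ((h.norm_sqrt_le hx₀ hq y).trans ?_) hr.le
    nlinarith
  -- One power of M comes from the size of the ellipsoid, one from the Hölder bound; the third comes
  -- from ellipticity, when |ξ|² is returned to a quadratic form.
  have hd2 : ‖frame T x₀ hr y - x₀‖ ^ (α : ℝ) ≤ M * r ^ (α : ℝ) := by
    refine (Real.rpow_le_rpow (norm_nonneg _) hd (by positivity)).trans ?_
    rw [Real.mul_rpow hM0 hr.le]
    refine mul_le_mul_of_nonneg_right ?_ (by positivity)
    calc M ^ (α : ℝ) ≤ M ^ (1 : ℝ) := Real.rpow_le_rpow_of_exponent_le hM (by exact_mod_cast hα.le)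
      _ = M := Real.rpow_one M
  have h1 := h.abs_quad_sub_le hx hx₀ ξ
  have hs : 0 ≤ r ^ (α : ℝ) := by positivity
  have h2 : |quad (A (frame T x₀ hr y)) ξ - quad (A x₀) ξ| ≤ M ^ 2 * r ^ (α : ℝ) * ‖ξ‖ ^ 2 := by
    refine h1.trans (mul_le_mul_of_nonneg_right ?_ (sq_nonneg _))
    nlinarith
  have h3 := abs_le.1 h2
  have h4 := h.le_quad hx ξ
  have h5 := h.le_quad hx₀ ξ
  rw [hq]
  have h6 : 0 ≤ M ^ 2 * r ^ (α : ℝ) := by positivity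
  have h7 := mul_le_mul_of_nonneg_left h4 h6
  have h8 := mul_le_mul_of_nonneg_left h5 h6
  constructor
  · linarith [h3.1]
  · linarith [h3.2]

/-- Used with two freezing factors and one gauge factor: for s ≤ 1 all higher powers of s are
absorbed in s. -/
theorem freeze_constant_le {a b s : ℝ} (ha : 0 ≤ a) (hb : 0 ≤ b) (hs : 0 ≤ s) (hs1 : s ≤ 1) :
    (1 + a * s) ^ 2 * (1 + b * s) ≤ 1 + (1 + a) ^ 2 * (1 + b) * s := by
  have h2 : s ^ 2 ≤ s := by nlinarith
  have h3 : s ^ 3 ≤ s := by nlinarith [mul_nonneg hs hs]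
  have e1 : 0 ≤ (a ^ 2 + 2 * a * b) * (s - s ^ 2) := mul_nonneg (by positivity) (by linarith)
  have e2 : 0 ≤ (a ^ 2 * b) * (s - s ^ 3) := mul_nonneg (by positivity) (by linarith)
  nlinarith

/-- The constant in the energy comparison for frozen coefficients. -/
noncomputable def freezeConst (M : ℝ) : ℝ := (1 + M ^ 3) ^ 2 * (1 + M)

/-- In the coordinates of the ellipsoid the frozen energy is the Dirichlet integral on the unit
ball. The coefficients are frozen once for `U` and once for the competitor. -/
theorem IsAlmostHarmonic.transport (hA : IsCoeff α M A) (hα : 0 < α) (hα₁ : α < 1) {ω : ℝ → ℝ}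
    (hω : IsGauge α M ω) {U : Sp n → ℝ} (hU : IsAlmostHarmonic A ω U) {x₀ : Sp n}
    (hx₀ : x₀ ∈ unitBall n) {T : Sp n ≃L[ℝ] Sp n} (hT : ∀ y, T y = op (CFC.sqrt (A x₀)) y)
    (hsymm : ∀ v w, inner ℝ (T v) w = inner ℝ v (T w)) (hq : ∀ ξ, ‖T ξ‖ ^ 2 = quad (A x₀) ξ)
    {r : ℝ} (hr : 0 < r) (hr1 : r < 1) (hE : CompactlyIn (ellipsoid A x₀ r) (unitBall n)) :
    MemLp (fun y => T (weakGrad (unitBall n) U (frame T x₀ hr y))) 2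
        (volume.restrict (unitBall n)) ∧
      CurlFree (fun y => T (weakGrad (unitBall n) U (frame T x₀ hr y))) ∧
      AlmostMinimal (freezeConst M * r ^ (α : ℝ))
        (fun y => T (weakGrad (unitBall n) U (frame T x₀ hr y))) := by
  have hM := hA.one_le
  obtain ⟨⟨hex, hU2, hG2⟩, hmin⟩ := hU
  set G := weakGrad (unitBall n) U with hG
  have hWG : IsWeakGrad (unitBall n) U G := isWeakGrad_weakGrad hex
  set E := frame T x₀ hr '' unitBall n with hEdef
  have hEE : E = ellipsoid A x₀ r := image_frame_unitBall hT hr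
  have hEB : E ⊆ unitBall n := by
    rw [hEE]
    exact subset_closure.trans hE.2
  have hEo : IsOpen E := isOpen_image_frame T x₀ hr
  have hWE : IsWeakGrad E U G := hWG.mono hEB Metric.isOpen_ball.measurableSet
  have hUE := hU2.mono_measure (Measure.restrict_mono hEB le_rfl)
  have hGE := hG2.mono_measure (Measure.restrict_mono hEB le_rfl)
  have hcomp : ∀ {f : Sp n → Sp n}, MemLp f 2 (volume.restrict E) →
      MemLp (fun y => T (f (frame T x₀ hr y))) 2 (volume.restrict (unitBall n)) := fun hf =>
    (T : Sp n →L[ℝ] Sp n).comp_memLp' ((memLp_comp_aff_iff ((dil n r hr.ne').trans T) x₀).2 hf)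
  refine ⟨hcomp hGE, (hWE.comp_frame hsymm hr hUE hGE).curlFree, fun ψ hψ => ?_⟩
  obtain ⟨χ, hχ, -, hχ2⟩ := hψ.exists_frame (T := T) (x₀ := x₀) hr
  -- Subtracting `χ` from `U` on the ellipsoid amounts to subtracting the gradient of `ψ` from the
  -- transported field.
  have hgrad : ∀ y, T (gradient χ (frame T x₀ hr y)) = gradient ψ y := by
    intro y
    refine ext_inner_right ℝ fun v => ?_
    rw [hsymm, inner_gradient_left, inner_gradient_left, hχ2]
  have hWχ := IsWeakGrad.of_contDiff (Ω := E) (hχ.mono (subset_univ _))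
  have hχL : MemLp (gradient χ) 2 (volume.restrict E) :=
    hχ.continuous_gradient.memLp_of_hasCompactSupport hχ.hasCompactSupport_gradient
  set s : ℝ := r ^ (α : ℝ) with hs
  have hs0 : 0 ≤ s := by positivity
  have hs1 : s ≤ 1 := Real.rpow_le_one hr.le hr1.le (by positivity)
  set t : ℝ := 1 + M ^ 3 * s with ht
  have ht0 : 0 ≤ t := by positivity
  -- comparison of the energies with frozen and variable coefficients
  have hen : ∀ {f : Sp n → Sp n}, MemLp f 2 (volume.restrict E) →
      (∫ y in unitBall n, ‖T (f (frame T x₀ hr y))‖ ^ 2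
        ≤ t * (jac ((dil n r hr.ne').trans T) * ∫ x in E, quad (A x) (f x))) ∧
      jac ((dil n r hr.ne').trans T) * (∫ x in E, quad (A x) (f x))
        ≤ t * ∫ y in unitBall n, ‖T (f (frame T x₀ hr y))‖ ^ 2 := by
    intro f hf
    have hc := integral_comp_aff ((dil n r hr.ne').trans T) x₀ (unitBall n)
      (fun x => quad (A x) (f x))
    rw [smul_eq_mul] at hc
    change ∫ y in unitBall n, quad (A (frame T x₀ hr y)) (f (frame T x₀ hr y))
      = _ * ∫ x in E, _ at hc
    have hi1 : IntegrableOn (fun y => quad (A (frame T x₀ hr y)) (f (frame T x₀ hr y)))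
        (unitBall n) := by
      have h1 := hA.integrableOn_quad hα hEo.measurableSet hEB hf
      have h2 := (memLp_comp_aff_iff ((dil n r hr.ne').trans T) x₀).2
        (memLp_one_iff_integrable.2 h1)
      exact memLp_one_iff_integrable.1 h2
    have hi2 : IntegrableOn (fun y => ‖T (f (frame T x₀ hr y))‖ ^ 2) (unitBall n) :=
      (hcomp hf).integrable_norm_pow (by norm_num)
    rw [← hc, ← integral_const_mul, ← integral_const_mul]
    refine ⟨setIntegral_mono_on hi2 (hi1.const_mul t) Metric.isOpen_ball.measurableSet
      fun y hy => ?_, setIntegral_mono_on hi1 (hi2.const_mul t) Metric.isOpen_ball.measurableSet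
      fun y hy => ?_⟩
    · exact (hA.quad_freeze hx₀ hq hα₁ hr hy (hEB (mem_image_of_mem _ hy)) _).1
    · exact (hA.quad_freeze hx₀ hq hα₁ hr hy (hEB (mem_image_of_mem _ hy)) _).2
  have hV : MemW12Zero (ellipsoid A x₀ r) ((U - χ) - U) := by
    rw [sub_sub_cancel_left, ← hEE]
    exact hχ.neg.memW12Zero hEo
  have hcmp := hmin x₀ hx₀ r ⟨hr, hr1⟩ hE (U - χ) hV
  rw [← hEE] at hcmp
  have hVG : ∫ x in E, quad (A x) (weakGrad E (U - χ) x)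
      = ∫ x in E, quad (A x) (G x - gradient χ x) := by
    refine integral_congr_ae ?_
    filter_upwards [(hWE.sub hWχ).weakGrad_ae_eq hEo] with x hx
    rw [hx]
    rfl
  rw [hVG] at hcmp
  have h1 := (hen hGE).1
  have h2 := (hen (f := fun x => G x - gradient χ x) (hGE.sub hχL)).2
  simp only [map_sub, hgrad] at h2
  have hω1 : 1 + ω r ≤ 1 + M * s := by
    have := hω.2.2.2 r ⟨hr, hr1⟩
    linarith
  have hω0 : 0 ≤ 1 + ω r := by
    have := hω.1 r ⟨hr, hr1⟩
    linarith
  have hj := (jac_pos ((dil n r hr.ne').trans T)).le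
  set I := ∫ y in unitBall n, ‖T (G (frame T x₀ hr y)) - gradient ψ y‖ ^ 2 with hI
  have hI0 : 0 ≤ I := integral_nonneg fun _ => by positivity
  calc ∫ y in unitBall n, ‖T (G (frame T x₀ hr y))‖ ^ 2
      ≤ t * (jac ((dil n r hr.ne').trans T) * ∫ x in E, quad (A x) (G x)) := h1
    _ ≤ t * (jac ((dil n r hr.ne').trans T) *
        ((1 + ω r) * ∫ x in E, quad (A x) (G x - gradient χ x))) := by gcongr
    _ = t * (1 + ω r) * (jac ((dil n r hr.ne').trans T) *
        ∫ x in E, quad (A x) (G x - gradient χ x)) := by ring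
    _ ≤ t * (1 + ω r) * (t * I) := by gcongr
    _ ≤ t * (1 + M * s) * (t * I) := by gcongr
    _ = t ^ 2 * (1 + M * s) * I := by ring
    _ ≤ (1 + freezeConst M * s) * I :=
        mul_le_mul_of_nonneg_right
          (freeze_constant_le (by positivity) (by linarith) hs0 hs1) hI0

end Transport

end AlmostHarmonic

namespace AlmostHarmonic

/-! ### Iteration of the excess decay -/

section Iteration

/-- A discrete Gronwall argument. Here `e` is the excess and `a` the size of the approximating
constants; the two feed each other, but the coupling is damped by q^k, so a common majorant grows
only by the factors 1 + B q^k, whose product converges. -/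
theorem exists_bound_of_decay {q D : ℝ} (hq : 0 < q) (hq1 : q < 1) (hD : 0 ≤ D) :
    ∃ K : ℝ, 0 ≤ K ∧ ∀ e a : ℕ → ℝ, (∀ k, 0 ≤ e k) → a 0 = 0 →
      (∀ k, e (k + 1) ≤ q / 2 * e k + D * q ^ k * (e k + a k)) →
      (∀ k, a (k + 1) ≤ a k + e (k + 1) + D * e k) →
      ∀ k, e k ≤ K * q ^ k * e 0 ∧ a k ≤ K * e 0 := by
  -- The weight δ makes the source D q^k a_k cost at most (q/2) q^k Z_k; with the contraction q/2
  -- this gives exactly q^(k+1) Z_k.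
  set δ : ℝ := q / (2 * (D + 1)) with hδ
  have hδ0 : 0 < δ := by positivity
  have hδ1 : δ ≤ 1 := by
    rw [hδ, div_le_one (by positivity)]
    linarith
  have hδD : δ * D ≤ q / 2 := by
    rw [hδ, div_mul_eq_mul_div, div_le_div_iff₀ (by positivity) (by norm_num)]
    nlinarith
  -- B is large enough to absorb both the leftover D q^(2k) Z_k in the excess (hence D ≤ q B) and
  -- the increment of `a`, at most (1 + 2D) q^k Z_k after weighting by δ.
  set B : ℝ := (1 + 2 * D) / δ with hB
  have hB0 : 0 ≤ B := by positivity
  have hBδ : B * δ = 1 + 2 * D := by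
    rw [hB]
    field_simp
  have hqB : D ≤ q * B := by
    have : q * B = 2 * (1 + 2 * D) * (D + 1) := by
      rw [hB, hδ]
      field_simp
    rw [this]
    nlinarith
  refine ⟨Real.exp (B * (1 - q)⁻¹) / δ, by positivity, fun e a he ha0 h1 h2 => ?_⟩
  set Z : ℕ → ℝ := fun k => e 0 * ∏ j ∈ Finset.range k, (1 + B * q ^ j) with hZ
  have hZ0 : ∀ k, 0 ≤ Z k := fun k =>
    mul_nonneg (he 0) (Finset.prod_nonneg fun j _ => by positivity)
  have hZs : ∀ k, Z (k + 1) = Z k * (1 + B * q ^ k) := by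
    intro k
    simp only [hZ, Finset.prod_range_succ]
    ring
  have key : ∀ k, δ * e k ≤ q ^ k * Z k ∧ a k ≤ Z k := by
    intro k
    induction k with
    | zero =>
      simp only [hZ, pow_zero, Finset.range_zero, Finset.prod_empty, mul_one, one_mul, ha0]
      exact ⟨mul_le_of_le_one_left (he 0) hδ1, he 0⟩
    | succ k ih =>
      obtain ⟨i1, i2⟩ := ih
      set Q := q ^ k with hQ
      have hQ0 : 0 ≤ Q := by positivity
      have hQ1 : Q ≤ 1 := pow_le_one₀ hq.le hq1.le
      have hz := hZ0 k
      have s1 : δ * e (k + 1) ≤ q * Q * Z k + D * Q * (Q * Z k) := by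
        have t1 := mul_le_mul_of_nonneg_left (h1 k) hδ0.le
        have t2 := mul_le_mul_of_nonneg_left i1 (show 0 ≤ q / 2 + D * Q by positivity)
        have t3 := mul_le_mul_of_nonneg_left i2 (show 0 ≤ δ * D * Q by positivity)
        have t4 := mul_le_mul_of_nonneg_right hδD (mul_nonneg hQ0 hz)
        nlinarith
      have hQZ : 0 ≤ Q * Z k := mul_nonneg hQ0 hz
      rw [hZs, pow_succ, ← hQ]
      constructor
      · have t5 := mul_le_mul_of_nonneg_right hqB (mul_nonneg hQ0 hQZ)
        nlinarith
      · have t6 : D * Q * (Q * Z k) ≤ D * (Q * Z k) := by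
          have := mul_le_mul_of_nonneg_left hQ1 (mul_nonneg hD hQZ)
          nlinarith
        have t7 : δ * (e (k + 1) + D * e k) ≤ δ * (B * Q * Z k) := by
          have u1 := mul_le_mul_of_nonneg_left i1 hD
          have u2 : δ * (B * Q * Z k) = (1 + 2 * D) * (Q * Z k) := by
            rw [← hBδ]
            ring
          rw [u2]
          nlinarith
        have t8 := le_of_mul_le_mul_left t7 hδ0
        have := h2 k
        nlinarith
  have hZle : ∀ k, Z k ≤ Real.exp (B * (1 - q)⁻¹) * e 0 := by
    intro k
    rw [mul_comm]
    refine mul_le_mul_of_nonneg_left ?_ (he 0)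
    calc ∏ j ∈ Finset.range k, (1 + B * q ^ j)
        ≤ ∏ j ∈ Finset.range k, Real.exp (B * q ^ j) := by
          refine Finset.prod_le_prod (fun j _ => by positivity) fun j _ => ?_
          rw [add_comm]
          exact Real.add_one_le_exp _
      _ = Real.exp (B * ∑ j ∈ Finset.range k, q ^ j) := by
          rw [← Real.exp_sum, Finset.mul_sum]
      _ ≤ Real.exp (B * (1 - q)⁻¹) := by
          refine Real.exp_le_exp.2 (mul_le_mul_of_nonneg_left ?_ hB0)
          rw [← tsum_geometric_of_lt_one hq.le hq1]
          exact (summable_geometric_of_lt_one hq.le hq1).sum_le_tsum _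
            fun _ _ => by positivity
  intro k
  obtain ⟨i1, i2⟩ := key k
  have hQ0 : 0 < q ^ k := by positivity
  constructor
  · rw [← mul_le_mul_iff_right₀ hδ0]
    refine i1.trans ((mul_le_mul_of_nonneg_left (hZle k) hQ0.le).trans (le_of_eq ?_))
    field_simp
  · refine (i2.trans (hZle k)).trans ?_
    refine mul_le_mul_of_nonneg_right ?_ (he 0)
    rw [le_div_iff₀ hδ0]
    exact mul_le_of_le_one_right (Real.exp_pos _).le hδ1

/-- Since β < 1, C θ^(1-β) tends to 0 with θ. -/
theorem exists_small_ratio {C β : ℝ} (hβ1 : β < 1) :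
    ∃ θ : ℝ, 0 < θ ∧ θ ≤ 1 / 2 ∧ C * θ ≤ θ ^ β / 2 := by
  have h1 : Filter.Tendsto (fun θ : ℝ => C * θ ^ (1 - β)) (𝓝[>] 0) (𝓝 0) := by
    have : Filter.Tendsto (fun θ : ℝ => θ ^ (1 - β)) (𝓝 0) (𝓝 (0 ^ (1 - β))) :=
      (Real.continuousAt_rpow_const 0 (1 - β) (Or.inr (by linarith))).tendsto
    rw [Real.zero_rpow (by linarith)] at this
    simpa using (this.mono_left nhdsWithin_le_nhds).const_mul C
  have h2 := (h1.eventually (gt_mem_nhds (show (0 : ℝ) < 1 / 2 by norm_num))).and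
    (Ioo_mem_nhdsGT (show (0 : ℝ) < 1 / 2 by norm_num))
  obtain ⟨θ, h3, h4⟩ := h2.exists
  refine ⟨θ, h4.1, h4.2.le, ?_⟩
  have h5 : θ = θ ^ β * θ ^ (1 - β) := by
    rw [← Real.rpow_add h4.1]
    simp
  have h6 : 0 < θ ^ β := Real.rpow_pos_of_pos h4.1 _
  calc C * θ = θ ^ β * (C * θ ^ (1 - β)) := by
        conv_lhs => rw [h5]
        ring
    _ ≤ θ ^ β * (1 / 2) := mul_le_mul_of_nonneg_left h3.le h6.le
    _ = θ ^ β / 2 := by ring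

/-- Rescaled almost minimal gradient fields converge geometrically to a constant. -/
theorem exists_geometric_limit (n : ℕ) {β : ℝ} (hβ : 0 < β) (hβ1 : β < 1) {c : ℝ} (hc : 0 ≤ c) :
    ∃ θ : ℝ, 0 < θ ∧ θ < 1 ∧ ∃ K : ℝ, 0 ≤ K ∧ ∀ (g : ℕ → Sp n → Sp n) (κ : ℕ → ℝ),
      (∀ k y, g (k + 1) y = g k (θ • y)) →
      (∀ k, MemLp (g k) 2 (volume.restrict (unitBall n))) → (∀ k, CurlFree (g k)) →
      (∀ k, AlmostMinimal (κ k) (g k)) → (∀ k, 0 ≤ κ k) → (∀ k, √(κ k) ≤ c * (θ ^ β) ^ k) →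
      ∃ m : Sp n, ‖m‖ ≤ K * l2norm (unitBall n) (g 0) ∧
        ∀ k, l2norm (unitBall n) (fun y => g k y - m)
          ≤ K * (θ ^ β) ^ k * l2norm (unitBall n) (g 0) := by
  obtain ⟨C, hC0, hC⟩ := exists_one_step_decay n
  obtain ⟨θ, hθ0, hθ2, hθC⟩ := exists_small_ratio (C := C) hβ1
  obtain ⟨D, hD0, hD⟩ := hC θ hθ0 hθ2
  set q := θ ^ β with hq
  have hq0 : 0 < q := Real.rpow_pos_of_pos hθ0 _
  have hq1 : q < 1 := Real.rpow_lt_one hθ0.le (by linarith) hβ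
  set J := √(jac (dil n θ hθ0.ne')) with hJ
  have hJ0 : 0 ≤ J := Real.sqrt_nonneg _
  set b := √(volume.real (unitBall n)) with hb
  have hb0 : 0 < b := Real.sqrt_pos.2 (ENNReal.toReal_pos
    (Metric.measure_ball_pos volume _ one_pos).ne' measure_ball_lt_top.ne)
  -- A single constant serves both recursions: D c bounds the source term, J the loss under
  -- rescaling.
  obtain ⟨K, hK0, hK⟩ := exists_bound_of_decay hq0 hq1 (show 0 ≤ D * c + J by positivity)
  refine ⟨θ, hθ0, by linarith, b⁻¹ * K + (K + (b⁻¹ * (K * (1 + (D * c + J))) / (1 - q)) * b), ?_,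
    fun g κ hg hL hcurl hmin hκ0 hκ => ?_⟩
  · have : 0 < 1 - q := by linarith
    positivity
  choose next hnext using fun k m => hD (g k) (hL k) (hcurl k) (κ k) (hκ0 k) (hmin k) m
  -- Starting at 0 makes the initial excess the full L² norm of `g 0`.
  set m : ℕ → Sp n := fun k => Nat.rec 0 (fun k mk => next k mk) k with hm
  have hm0 : m 0 = 0 := rfl
  have hms : ∀ k, m (k + 1) = next k (m k) := fun k => rfl
  set e : ℕ → ℝ := fun k => l2norm (unitBall n) (fun y => g k y - m k) with he
  set a : ℕ → ℝ := fun k => ‖m k‖ * b with ha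
  have he0 : ∀ k, 0 ≤ e k := fun k => l2norm_nonneg _ _
  have hmc : ∀ v : Sp n, MemLp (fun _ : Sp n => v) 2 (volume.restrict (unitBall n)) :=
    fun v => memLp_const v
  have hl2const : ∀ v : Sp n, l2norm (unitBall n) (fun _ : Sp n => v) = ‖v‖ * b :=
    fun v => l2norm_const v
  have hgle : ∀ k, l2norm (unitBall n) (g k) ≤ e k + a k := by
    intro k
    have := l2norm_add_le (f := fun y => g k y - m k) ((hL k).sub (hmc (m k))) (hmc (m k))
    simpa only [hl2const, sub_add_cancel] using this
  have h1 : ∀ k, e (k + 1) ≤ q / 2 * e k + (D * c + J) * q ^ k * (e k + a k) := by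
    intro k
    have i1 := hnext k (m k)
    have i2 : e (k + 1) = l2norm (unitBall n) (fun y => g k (θ • y) - next k (m k)) := by
      simp only [he, hms, hg]
    rw [i2]
    have ha0 : 0 ≤ a k := by positivity
    have hek := he0 k
    calc _ ≤ _ := i1
      _ ≤ q / 2 * e k + D * (c * q ^ k) * (e k + a k) := by
        have := hκ k
        have := hgle k
        have := l2norm_nonneg (unitBall n) (g k)
        gcongr
      _ ≤ _ := by
        have : 0 ≤ J * q ^ k * (e k + a k) := by positivity
        linarith
  -- Both constants are compared with `g (k + 1)`: the new one through the new excess, the old one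
  -- through the old excess restricted to a smaller ball and rescaled.
  have hdist : ∀ k, ‖m (k + 1) - m k‖ * b ≤ e (k + 1) + (D * c + J) * e k := by
    intro k
    have hsub : aff (dil n θ hθ0.ne') 0 '' unitBall n ⊆ unitBall n := by
      rintro _ ⟨y, hy, rfl⟩
      rw [unitBall, mem_ball_zero_iff] at hy ⊢
      have : aff (dil n θ hθ0.ne') 0 y = θ • y := by
        rw [aff_apply, add_zero]
        rfl
      rw [this, norm_smul, Real.norm_of_nonneg hθ0.le]
      nlinarith [norm_nonneg y]
    have i1 : l2norm (unitBall n) (fun y => g (k + 1) y - m k) ≤ J * e k := by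
      have := l2norm_comp_aff (dil n θ hθ0.ne') 0 (unitBall n) (fun y => g k y - m k)
      have e2 : ∀ y, aff (dil n θ hθ0.ne') 0 y = θ • y := fun y => by
        rw [aff_apply, add_zero]
        rfl
      simp only [e2, ← hg] at this
      rw [this]
      exact mul_le_mul_of_nonneg_left (l2norm_mono_set (by simpa [e2] using hsub)
        ((hL k).sub (hmc (m k)))) hJ0
    have i2 := l2norm_add_le (S := unitBall n) (f := fun y => m (k + 1) - g (k + 1) y)
      (g := fun y => g (k + 1) y - m k) ((hmc _).sub (hL (k + 1))) ((hL (k + 1)).sub (hmc _))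
    have e3 : ∀ y, m (k + 1) - g (k + 1) y + (g (k + 1) y - m k) = m (k + 1) - m k :=
      fun y => by abel
    simp only [e3, hl2const] at i2
    rw [l2norm_sub_comm _ (fun _ => m (k + 1)) (g (k + 1))] at i2
    have := he0 k
    have : 0 ≤ D * c * e k := by positivity
    linarith
  have h2 : ∀ k, a (k + 1) ≤ a k + e (k + 1) + (D * c + J) * e k := by
    intro k
    have i1 := norm_le_norm_add_norm_sub' (m (k + 1)) (m k)
    have i2 := mul_le_mul_of_nonneg_right i1 hb0.le
    have := hdist k
    simp only [ha]
    linarith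
  have hfin := hK e a he0 (by simp [ha, hm0]) h1 h2
  have hee : e 0 = l2norm (unitBall n) (g 0) := by simp [he, hm0]
  set N := l2norm (unitBall n) (g 0) with hN
  have hN0 : 0 ≤ N := l2norm_nonneg _ _
  have hgeo : ∀ k, dist (m k) (m (k + 1)) ≤ (b⁻¹ * (K * (1 + (D * c + J)) * N)) * q ^ k := by
    intro k
    rw [dist_comm, dist_eq_norm, ← mul_le_mul_iff_left₀ hb0]
    refine (hdist k).trans ?_
    have i1 := (hfin k).1
    have i2 := (hfin (k + 1)).1
    rw [hee] at i1 i2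
    have i3 : K * q ^ (k + 1) * N ≤ K * q ^ k * N := by
      have : q ^ (k + 1) ≤ q ^ k := pow_le_pow_of_le_one hq0.le hq1.le (Nat.le_succ k)
      gcongr
    have i4 := mul_le_mul_of_nonneg_left i1 (show 0 ≤ D * c + J by positivity)
    calc _ ≤ K * q ^ k * N + (D * c + J) * (K * q ^ k * N) := by linarith
      _ = _ := by
        field_simp
  obtain ⟨m', hm'⟩ := cauchySeq_tendsto_of_complete (cauchySeq_of_le_geometric q _ hq1 hgeo)
  have hlim : ∀ k, ‖m k - m'‖ ≤ (b⁻¹ * (K * (1 + (D * c + J)) * N)) * q ^ k / (1 - q) := by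
    intro k
    rw [← dist_eq_norm]
    exact dist_le_of_le_geometric_of_tendsto q _ hq1 hgeo hm' k
  have hq1' : 0 < 1 - q := by linarith
  refine ⟨m', ?_, fun k => ?_⟩
  · have i1 : ‖m'‖ ≤ b⁻¹ * K * N := by
      refine le_of_tendsto hm'.norm (Filter.Eventually.of_forall fun k => ?_)
      have := (hfin k).2
      rw [hee] at this
      rw [← mul_le_mul_iff_left₀ hb0]
      refine this.trans (le_of_eq ?_)
      field_simp
    refine i1.trans (mul_le_mul_of_nonneg_right ?_ hN0)
    have : 0 ≤ K + (b⁻¹ * (K * (1 + (D * c + J))) / (1 - q)) * b := by positivity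
    linarith
  · have i1 := l2norm_add_le (S := unitBall n) (f := fun y => g k y - m k)
      (g := fun y => m k - m') ((hL k).sub (hmc _)) (hmc _)
    simp only [sub_add_sub_cancel, hl2const] at i1
    have i2 := (hfin k).1
    rw [hee] at i2
    have i3 := mul_le_mul_of_nonneg_right (hlim k) hb0.le
    have i4 : 0 ≤ b⁻¹ * K * q ^ k * N := by positivity
    calc _ ≤ _ := i1
      _ ≤ K * q ^ k * N + (b⁻¹ * (K * (1 + (D * c + J)) * N)) * q ^ k / (1 - q) * b :=
        add_le_add i2 i3
      _ ≤ b⁻¹ * K * q ^ k * N + (K * q ^ k * N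
          + (b⁻¹ * (K * (1 + (D * c + J)) * N)) * q ^ k / (1 - q) * b) := by linarith
      _ = _ := by ring

end Iteration

end AlmostHarmonic

namespace AlmostHarmonic

/-! ### Campanato decay of the weak gradient -/

section Campanato

variable {n : ℕ}

theorem l2norm_le_mul {S : Set (Sp n)} {f g : Sp n → Sp n} {c : ℝ} (hc : 0 ≤ c)
    (hg : MemLp g 2 (volume.restrict S)) (h : ∀ x, ‖f x‖ ≤ c * ‖g x‖) :
    l2norm S f ≤ c * l2norm S g := by
  have h1 := eLpNorm_le_mul_eLpNorm_of_ae_le_mul (μ := volume.restrict S)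
    (Filter.Eventually.of_forall h) 2
  have h2 := ENNReal.toReal_mono (ENNReal.mul_ne_top ENNReal.ofReal_ne_top hg.eLpNorm_ne_top) h1
  rwa [ENNReal.toReal_mul, ENNReal.toReal_ofReal hc] at h2

theorem volume_real_ball (x : Sp n) {r : ℝ} (hr : 0 < r) :
    volume.real (Metric.ball x r) = r ^ n * volume.real (unitBall n) := by
  rw [measureReal_def, Measure.addHaar_ball_of_pos _ _ hr, finrank_euclideanSpace, Fintype.card_fin,
    ENNReal.toReal_mul, ENNReal.toReal_ofReal (by positivity), measureReal_def]

theorem volume_real_unitBall_pos : 0 < volume.real (unitBall n) :=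
  ENNReal.toReal_pos (Metric.measure_ball_pos volume _ one_pos).ne' measure_ball_lt_top.ne

/-! ### Ellipsoids compared with balls, and the resulting Jacobian bounds. -/

variable {α : ℝ≥0} {M : ℝ} {A : Sp n → Matrix (Fin n) (Fin n) ℝ}

theorem image_frame_subset (hA : IsCoeff α M A) {x₀ : Sp n} (hx₀ : x₀ ∈ unitBall n)
    {T : Sp n ≃L[ℝ] Sp n} (hq : ∀ ξ, ‖T ξ‖ ^ 2 = quad (A x₀) ξ) {r : ℝ} (hr : 0 < r) : frame T x₀ hr '' unitBall n ⊆ Metric.ball x₀ (M * r) := by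
  rintro _ ⟨y, hy, rfl⟩
  have hM := hA.one_le
  rw [unitBall, mem_ball_zero_iff] at hy
  rw [Metric.mem_ball, dist_eq_norm, frame_apply, add_sub_cancel_right, norm_smul,
    Real.norm_of_nonneg hr.le, mul_comm]
  have := hA.norm_sqrt_le hx₀ hq y
  refine mul_lt_mul_of_pos_right ?_ hr
  nlinarith

theorem subset_image_frame (hA : IsCoeff α M A) {x₀ : Sp n} (hx₀ : x₀ ∈ unitBall n)
    {T : Sp n ≃L[ℝ] Sp n} (hq : ∀ ξ, ‖T ξ‖ ^ 2 = quad (A x₀) ξ) {r : ℝ} (hr : 0 < r) : Metric.ball x₀ (r / M) ⊆ frame T x₀ hr '' unitBall n := by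
  intro z hz
  have hM := hA.one_le
  have hM0 : 0 < M := by linarith
  rw [Metric.mem_ball, dist_eq_norm] at hz
  refine ⟨T.symm (r⁻¹ • (z - x₀)), ?_, ?_⟩
  · rw [unitBall, mem_ball_zero_iff]
    have h1 := hA.le_norm_sqrt hx₀ hq (T.symm (r⁻¹ • (z - x₀)))
    rw [ContinuousLinearEquiv.apply_symm_apply, norm_smul, norm_inv,
      Real.norm_of_nonneg hr.le] at h1
    refine h1.trans_lt ?_
    calc M * (r⁻¹ * ‖z - x₀‖) < M * (r⁻¹ * (r / M)) := by gcongr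
      _ = 1 := by field_simp
  · rw [frame_apply, ContinuousLinearEquiv.apply_symm_apply, smul_inv_smul₀ hr.ne',
      sub_add_cancel]

/-- Volume comparison: the ellipsoid contains a ball of radius r / M. The companion bound below uses
that it lies in a ball of radius M r. -/
theorem jac_le (hA : IsCoeff α M A) {x₀ : Sp n} (hx₀ : x₀ ∈ unitBall n)
    {T : Sp n ≃L[ℝ] Sp n} (hq : ∀ ξ, ‖T ξ‖ ^ 2 = quad (A x₀) ξ) {r : ℝ} (hr : 0 < r) : jac ((dil n r hr.ne').trans T) ≤ (M / r) ^ n := by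
  have hM := hA.one_le
  have hM0 : 0 < M := by linarith
  have h1 := jac_mul_volume ((dil n r hr.ne').trans T) x₀ (unitBall n)
  have h2 : volume.real (Metric.ball x₀ (r / M))
      ≤ volume.real (aff ((dil n r hr.ne').trans T) x₀ '' unitBall n) :=
    measureReal_mono (subset_image_frame hA hx₀ hq hr)
      ((measure_mono (image_frame_subset hA hx₀ hq hr)).trans_lt measure_ball_lt_top).ne
  rw [volume_real_ball _ (by positivity)] at h2
  have hb := volume_real_unitBall_pos (n := n)
  have h3 := mul_le_mul_of_nonneg_left h2 (jac_pos ((dil n r hr.ne').trans T)).le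
  rw [h1, ← mul_assoc] at h3
  have h4 : jac ((dil n r hr.ne').trans T) * (r / M) ^ n ≤ 1 := by
    by_contra hc
    nlinarith
  calc jac ((dil n r hr.ne').trans T)
      = jac ((dil n r hr.ne').trans T) * (r / M) ^ n * (M / r) ^ n := by
        rw [mul_assoc, ← mul_pow]
        field_simp
        simp
    _ ≤ 1 * (M / r) ^ n := by gcongr
    _ = _ := one_mul _

theorem one_le_jac_mul (hA : IsCoeff α M A) {x₀ : Sp n} (hx₀ : x₀ ∈ unitBall n)
    {T : Sp n ≃L[ℝ] Sp n} (hq : ∀ ξ, ‖T ξ‖ ^ 2 = quad (A x₀) ξ) {r : ℝ} (hr : 0 < r) : 1 ≤ jac ((dil n r hr.ne').trans T) * (M * r) ^ n := by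
  have hM := hA.one_le
  have hM0 : 0 < M := by linarith
  have h1 := jac_mul_volume ((dil n r hr.ne').trans T) x₀ (unitBall n)
  have h2 : volume.real (aff ((dil n r hr.ne').trans T) x₀ '' unitBall n)
      ≤ volume.real (Metric.ball x₀ (M * r)) :=
    measureReal_mono (image_frame_subset hA hx₀ hq hr) measure_ball_lt_top.ne
  rw [volume_real_ball _ (by positivity)] at h2
  have hb := volume_real_unitBall_pos (n := n)
  have h3 := mul_le_mul_of_nonneg_left h2 (jac_pos ((dil n r hr.ne').trans T)).le
  rw [h1, ← mul_assoc] at h3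
  by_contra hc
  nlinarith

/-- Campanato estimate: near `x₀`, the weak gradient is close to a constant vector in `L²`. -/
theorem exists_campanato (n : ℕ) (α : ℝ≥0) (hα₀ : 0 < α) (hα₁ : α < 1) (M : ℝ) (hM : 1 ≤ M)
    {ρ : ℝ} (hρ1 : ρ < 1) (hρ0 : 0 ≤ ρ) :
    ∃ d : ℝ, 0 < d ∧ d ≤ (1 - ρ) / 2 ∧ ∃ K : ℝ, 0 ≤ K ∧
      ∀ (A : Sp n → Matrix (Fin n) (Fin n) ℝ) (ω : ℝ → ℝ) (U : Sp n → ℝ),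
        IsCoeff α M A → IsGauge α M ω → IsAlmostHarmonic A ω U →
        ∀ x₀ : Sp n, ‖x₀‖ ≤ ρ → ∃ p : Sp n,
          ‖p‖ ≤ K * l2norm (unitBall n) (weakGrad (unitBall n) U) ∧
          ∀ s, 0 < s → s ≤ d →
            l2norm (Metric.ball x₀ s) (fun x => weakGrad (unitBall n) U x - p) ≤
              K * l2norm (unitBall n) (weakGrad (unitBall n) U) * (√(s ^ n) * s ^ ((α : ℝ) / 2)) := by
  set β : ℝ := (α : ℝ) / 2 with hβ
  have hα0' : (0 : ℝ) < α := by exact_mod_cast hα₀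
  have hα1' : (α : ℝ) < 1 := by exact_mod_cast hα₁
  have hβ0 : 0 < β := by positivity
  have hβ1 : β < 1 := by linarith
  have hM0 : 0 < M := by linarith
  have hf0 : 0 ≤ freezeConst M := by
    unfold freezeConst
    positivity
  obtain ⟨θ, hθ0, hθ1, K, hK0, hK⟩ := exists_geometric_limit n hβ0 hβ1
    (Real.sqrt_nonneg (freezeConst M))
  -- The ellipsoid of size R about x₀ lies in the ball of radius M R = (1 - ρ)/2, hence compactly in
  -- the unit ball.
  set R : ℝ := (1 - ρ) / (2 * M) with hR
  have hR0 : 0 < R := div_pos (by linarith) (by positivity)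
  have hMR : M * R = (1 - ρ) / 2 := by
    rw [hR]
    field_simp
  have hR1 : R < 1 := by nlinarith
  set J := √((M / R) ^ n) with hJ
  have hJ0 : 0 ≤ J := Real.sqrt_nonneg _
  set W := √((M * (M / θ)) ^ n) * (M / (θ * R)) ^ β with hW
  have hW0 : 0 ≤ W := by positivity
  refine ⟨R / M, by positivity, ?_, M * K * (M * J) + W * (M * K * (M * J)), by positivity,
    fun A ω U hA hω hU x₀ hx₀ => ?_⟩
  · rw [div_le_iff₀ hM0, ← hMR]
    nlinarith
  have hxB : x₀ ∈ unitBall n := by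
    rw [unitBall, mem_ball_zero_iff]
    linarith
  have hquad : ∀ ξ, M⁻¹ * ‖ξ‖ ^ 2 ≤ quad (A x₀) ξ := by
    intro ξ
    rw [inv_mul_le_iff₀ hM0]
    exact hA.le_quad hxB ξ
  obtain ⟨T, hT, hsymm, hq⟩ := exists_sqrt_equiv (hA.1 x₀ hxB) (inv_pos.2 hM0) hquad
  set G := weakGrad (unitBall n) U with hG
  set N := l2norm (unitBall n) G with hN
  have hN0 : 0 ≤ N := l2norm_nonneg _ _
  have hG2 : MemLp G 2 (volume.restrict (unitBall n)) := hU.1.2.2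
  have hrk : ∀ k : ℕ, 0 < θ ^ k * R := fun k => by positivity
  have hrkR : ∀ k : ℕ, θ ^ k * R ≤ R := fun k =>
    mul_le_of_le_one_left hR0.le (pow_le_one₀ hθ0.le hθ1.le)
  have hEB : ∀ k : ℕ, Metric.closedBall x₀ (M * (θ ^ k * R)) ⊆ unitBall n := by
    intro k z hz
    rw [Metric.mem_closedBall, dist_eq_norm] at hz
    rw [unitBall, mem_ball_zero_iff]
    have h1 := norm_le_norm_add_norm_sub' z x₀
    have h2 := mul_le_mul_of_nonneg_left (hrkR k) hM0.le
    linarith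
  have hsubB : ∀ k : ℕ, frame T x₀ (hrk k) '' unitBall n ⊆ unitBall n := fun k =>
    (image_frame_subset hA hxB hq (hrk k)).trans
      (Metric.ball_subset_closedBall.trans (hEB k))
  have hE : ∀ k : ℕ, CompactlyIn (ellipsoid A x₀ (θ ^ k * R)) (unitBall n) := by
    intro k
    rw [← image_frame_unitBall hT (hrk k)]
    have h1 : closure (frame T x₀ (hrk k) '' unitBall n)
        ⊆ Metric.closedBall x₀ (M * (θ ^ k * R)) :=
      closure_minimal ((image_frame_subset hA hxB hq (hrk k)).trans
        Metric.ball_subset_closedBall) Metric.isClosed_closedBall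
    exact ⟨(isCompact_closedBall x₀ _).of_isClosed_subset isClosed_closure h1,
      h1.trans (hEB k)⟩
  have htr := fun k => hU.transport hA hα₀ hα₁ hω hxB hT hsymm hq (hrk k)
    ((hrkR k).trans_lt hR1) (hE k)
  -- The centre is fixed and the radii are θ^k R, so successive fields differ by the dilation θ.
  obtain ⟨m, hm1, hm2⟩ := hK (fun k y => T (G (frame T x₀ (hrk k) y)))
    (fun k => freezeConst M * (θ ^ k * R) ^ (α : ℝ))
    (fun k y => by
      have e : θ ^ (k + 1) * R = θ ^ k * R * θ := by ring
      simp only [frame_apply, map_smul, smul_smul, e])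
    (fun k => (htr k).1) (fun k => (htr k).2.1) (fun k => (htr k).2.2)
    (fun k => by positivity)
    (fun k => by
      rw [Real.sqrt_mul hf0]
      refine mul_le_mul_of_nonneg_left ?_ (Real.sqrt_nonneg _)
      have h1 : √((θ ^ k * R) ^ (α : ℝ)) = (θ ^ k * R) ^ β := by
        rw [Real.sqrt_eq_rpow, ← Real.rpow_mul (hrk k).le, hβ]
        congr 1
        ring
      have h2 : (θ ^ β) ^ k = (θ ^ k) ^ β := by
        rw [← Real.rpow_natCast, ← Real.rpow_mul hθ0.le, mul_comm, Real.rpow_mul hθ0.le,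
          Real.rpow_natCast]
      rw [h1, h2]
      refine Real.rpow_le_rpow (hrk k).le ?_ hβ0.le
      exact mul_le_of_le_one_right (by positivity) hR1.le)
  have hg0 : l2norm (unitBall n) (fun y => T (G (frame T x₀ (hrk 0) y))) ≤ M * J * N := by
    have hmem := (memLp_comp_aff_iff ((dil n _ (hrk 0).ne').trans T) x₀).2
      (hG2.mono_measure (Measure.restrict_mono (hsubB 0) le_rfl))
    have h1 := l2norm_le_mul hM0.le hmem (f := fun y => T (G (frame T x₀ (hrk 0) y)))
      fun y => hA.norm_sqrt_le hxB hq _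
    rw [l2norm_comp_aff] at h1
    refine h1.trans ?_
    rw [mul_assoc]
    refine mul_le_mul_of_nonneg_left ?_ hM0.le
    refine mul_le_mul ?_ (l2norm_mono_set (hsubB 0) hG2) (l2norm_nonneg _ _) hJ0
    refine Real.sqrt_le_sqrt ((jac_le hA hxB hq (hrk 0)).trans (le_of_eq ?_))
    simp
  have hm1' : ‖m‖ ≤ K * (M * J * N) := hm1.trans (mul_le_mul_of_nonneg_left hg0 hK0)
  refine ⟨T.symm m, ?_, fun s hs hsd => ?_⟩
  · have h1 := hA.le_norm_sqrt hxB hq (T.symm m)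
    rw [ContinuousLinearEquiv.apply_symm_apply] at h1
    calc ‖T.symm m‖ ≤ M * (K * (M * J * N)) :=
          h1.trans (mul_le_mul_of_nonneg_left hm1' hM0.le)
      _ = M * K * (M * J) * N := by ring
      _ ≤ _ := by
        refine mul_le_mul_of_nonneg_right ?_ hN0
        have : 0 ≤ W * (M * K * (M * J)) := by positivity
        linarith
  · have hsM : s * M / R ≤ 1 := by
      rw [div_le_one hR0]
      rwa [le_div_iff₀ hM0] at hsd
    -- The size r = θ^k R is the one just above M s: the ball of radius s fits in the ellipsoid, and
    -- r < M s / θ bounds the loss.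
    obtain ⟨k, hk1, hk2⟩ := exists_nat_pow_near_of_lt_one (x := s * M / R) (y := θ)
      (by positivity) hsM hθ0 hθ1
    set r := θ ^ k * R with hr
    have hr0 : 0 < r := hrk k
    have hsr : s ≤ r / M := by
      rw [le_div_iff₀ hM0, hr]
      rwa [div_le_iff₀ hR0] at hk2
    have hrs : r ≤ M / θ * s := by
      rw [lt_div_iff₀ hR0, pow_succ] at hk1
      rw [div_mul_eq_mul_div, le_div_iff₀ hθ0]
      nlinarith
    have hmem : MemLp (fun x => G x - T.symm m) 2 (volume.restrict (unitBall n)) :=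
      hG2.sub (memLp_const _)
    have hmemE := hmem.mono_measure (Measure.restrict_mono (hsubB k) le_rfl)
    have h1 : l2norm (Metric.ball x₀ s) (fun x => G x - T.symm m)
        ≤ l2norm (frame T x₀ (hrk k) '' unitBall n) (fun x => G x - T.symm m) :=
      l2norm_mono_set ((Metric.ball_subset_ball hsr).trans
        (subset_image_frame hA hxB hq (hrk k))) hmemE
    have h2 := l2norm_comp_aff ((dil n _ (hrk k).ne').trans T) x₀ (unitBall n)
      (fun x => G x - T.symm m)
    change l2norm (unitBall n) (fun y => G (frame T x₀ (hrk k) y) - T.symm m)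
      = _ * l2norm (frame T x₀ (hrk k) '' unitBall n) _ at h2
    have hTm : MemLp (fun y => T (G (frame T x₀ (hrk k) y)) - m) 2
        (volume.restrict (unitBall n)) := (htr k).1.sub (memLp_const _)
    have h3 := l2norm_le_mul hM0.le hTm
      (f := fun y => G (frame T x₀ (hrk k) y) - T.symm m) fun y => by
        have := hA.le_norm_sqrt hxB hq (G (frame T x₀ (hrk k) y) - T.symm m)
        rwa [map_sub, ContinuousLinearEquiv.apply_symm_apply] at this
    set X := l2norm (frame T x₀ (hrk k) '' unitBall n) (fun x => G x - T.symm m) with hX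
    have hX0 : 0 ≤ X := l2norm_nonneg _ _
    have hqk : (θ ^ β) ^ k ≤ (M / (θ * R)) ^ β * s ^ β := by
      rw [← Real.rpow_natCast, ← Real.rpow_mul hθ0.le, mul_comm, Real.rpow_mul hθ0.le,
        Real.rpow_natCast, ← Real.mul_rpow (by positivity) hs.le]
      refine Real.rpow_le_rpow (by positivity) ?_ hβ0.le
      rw [hr] at hrs
      rw [div_mul_eq_mul_div, le_div_iff₀ (by positivity)]
      rw [div_mul_eq_mul_div, le_div_iff₀ hθ0] at hrs
      nlinarith
    -- The lower Jacobian bound returns from the unit ball to the ellipsoid; the factor (M r)^(n/2)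
    -- supplies s^(n/2).
    have h4 : X ≤ √((M * r) ^ n) * (√(jac ((dil n _ (hrk k).ne').trans T)) * X) := by
      rw [← mul_assoc, ← Real.sqrt_mul (by positivity), mul_comm ((M * r) ^ n)]
      refine le_mul_of_one_le_left hX0 ?_
      rw [Real.one_le_sqrt]
      exact one_le_jac_mul hA hxB hq (hrk k)
    rw [← h2] at h4
    have h5 : √((M * r) ^ n) ≤ √((M * (M / θ)) ^ n) * √(s ^ n) := by
      rw [← Real.sqrt_mul (by positivity), ← mul_pow, mul_assoc]
      gcongr
    have hP0 : 0 ≤ l2norm (unitBall n) (fun y => T (G (frame T x₀ (hrk k) y)) - m) :=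
      l2norm_nonneg _ _
    calc _ ≤ X := h1
      _ ≤ √((M * r) ^ n) * (M * l2norm (unitBall n)
          (fun y => T (G (frame T x₀ (hrk k) y)) - m)) :=
        h4.trans (mul_le_mul_of_nonneg_left h3 (Real.sqrt_nonneg _))
      _ ≤ √((M * r) ^ n) * (M * (K * (θ ^ β) ^ k * (M * J * N))) := by
        refine mul_le_mul_of_nonneg_left (mul_le_mul_of_nonneg_left ?_ hM0.le)
          (Real.sqrt_nonneg _)
        exact (hm2 k).trans (mul_le_mul_of_nonneg_left hg0 (by positivity))
      _ ≤ (√((M * (M / θ)) ^ n) * √(s ^ n)) *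
          (M * (K * ((M / (θ * R)) ^ β * s ^ β) * (M * J * N))) := by gcongr
      _ = W * (M * K * (M * J)) * N * (√(s ^ n) * s ^ β) := by
        rw [hW]
        ring
      _ ≤ _ := by
        have : 0 ≤ M * K * (M * J) * N * (√(s ^ n) * s ^ β) := by positivity
        linarith

end Campanato

end AlmostHarmonic

namespace AlmostHarmonic

/-! ### From Campanato decay to Hölder continuity -/

section Holder

variable {n : ℕ} {G : Sp n → Sp n}

/-- `G` is `s ^ β`-close to `p` in mean square on the balls of radius `s ≤ d` around `x`. -/
def CampanatoAt (G : Sp n → Sp n) (β H d : ℝ) (x p : Sp n) : Prop :=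
  ∀ s, 0 < s → s ≤ d →
    l2norm (Metric.ball x s) (fun x => G x - p) ≤ H * (√(s ^ n) * s ^ β)

variable (n) in
/-- The constant in the comparison of Campanato values at nearby points. -/
noncomputable def campConst (β : ℝ) : ℝ :=
  (√(volume.real (unitBall n)))⁻¹ * (√(2 ^ n) * 2 ^ β + 1)

theorem campConst_nonneg (β : ℝ) : 0 ≤ campConst n β := by
  unfold campConst
  positivity

/-- Both constants approximate `G` on the ball of radius s about y, which lies in the ball of radius
2s about x; dividing by the root of its volume leaves s^β. -/
theorem CampanatoAt.norm_sub_le {β H d : ℝ} {x y p p' : Sp n} (hx : CampanatoAt G β H d x p)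
    (hy : CampanatoAt G β H d y p') (hxd : Metric.ball x d ⊆ unitBall n)
    (hG : MemLp G 2 (volume.restrict (unitBall n))) {s : ℝ} (hs : 0 < s) (hsd : 2 * s ≤ d)
    (hxy : ‖x - y‖ ≤ s) : ‖p - p'‖ ≤ campConst n β * H * s ^ β := by
  have hsub2 : Metric.ball x (2 * s) ⊆ unitBall n :=
    (Metric.ball_subset_ball hsd).trans hxd
  have hsub : Metric.ball y s ⊆ Metric.ball x (2 * s) := by
    refine Metric.ball_subset_ball' ?_
    rw [dist_comm, dist_eq_norm]
    linarith
  have hGx := hG.mono_measure (Measure.restrict_mono hsub2 le_rfl)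
  have hfin : IsFiniteMeasure (volume.restrict (Metric.ball x (2 * s))) :=
    ⟨by simpa using measure_ball_lt_top⟩
  have hfin' : IsFiniteMeasure (volume.restrict (Metric.ball y s)) :=
    ⟨by simpa using measure_ball_lt_top⟩
  have hGy := hGx.mono_measure (Measure.restrict_mono hsub le_rfl)
  have h1 := (l2norm_mono_set hsub (hGx.sub (memLp_const p))).trans (hx _ (by positivity) hsd)
  have h2 := hy s hs (by linarith)
  have h3 := l2norm_add_le (S := Metric.ball y s) (f := fun z => p - G z)
    (g := fun z => G z - p') ((memLp_const p).sub hGy) (hGy.sub (memLp_const p'))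
  have e : ∀ z, p - G z + (G z - p') = p - p' := fun z => by abel
  simp only [e] at h3
  rw [l2norm_const, volume_real_ball _ hs, Real.sqrt_mul (by positivity),
    l2norm_sub_comm _ (fun _ => p) G] at h3
  have hb := Real.sqrt_pos.2 (volume_real_unitBall_pos (n := n))
  have hs0 : 0 < √(s ^ n) := Real.sqrt_pos.2 (by positivity)
  rw [mul_pow, Real.sqrt_mul (by positivity), Real.mul_rpow (by norm_num) hs.le] at h1
  have h4 : ‖p - p'‖ * (√(s ^ n) * √(volume.real (unitBall n)))
      ≤ (campConst n β * H * s ^ β) * (√(s ^ n) * √(volume.real (unitBall n))) := by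
    refine h3.trans ((add_le_add h1 h2).trans (le_of_eq ?_))
    unfold campConst
    field_simp
  exact le_of_mul_le_mul_right h4 (by positivity)

theorem CampanatoAt.mono {β H H' d d' : ℝ} {x p : Sp n} (h : CampanatoAt G β H d x p)
    (hH : H ≤ H') (hd : d' ≤ d) : CampanatoAt G β H' d' x p := fun s hs hsd =>
  (h s hs (hsd.trans hd)).trans (mul_le_mul_of_nonneg_right hH (by positivity))

theorem CampanatoAt.eq {β H H' d d' : ℝ} (hβ : 0 < β) (hd : 0 < d) (hd' : 0 < d') {x p p' : Sp n}
    (h : CampanatoAt G β H d x p) (h' : CampanatoAt G β H' d' x p')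
    (hxd : Metric.ball x d ⊆ unitBall n) (hG : MemLp G 2 (volume.restrict (unitBall n))) :
    p = p' := by
  have h1 := h.mono (le_max_left H H') (min_le_left d d')
  have h2 := h'.mono (le_max_right H H') (min_le_right d d')
  have hlim : Filter.Tendsto (fun s : ℝ => campConst n β * max H H' * s ^ β) (𝓝[>] 0) (𝓝 0) := by
    have : Filter.Tendsto (fun s : ℝ => s ^ β) (𝓝 0) (𝓝 (0 ^ β)) :=
      (Real.continuousAt_rpow_const 0 β (Or.inr hβ.le)).tendsto
    rw [Real.zero_rpow hβ.ne'] at this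
    simpa using (this.mono_left nhdsWithin_le_nhds).const_mul (campConst n β * max H H')
  have h3 : ‖p - p'‖ ≤ 0 := by
    refine ge_of_tendsto hlim ?_
    have : 0 < min d d' / 2 := by positivity
    filter_upwards [Ioo_mem_nhdsGT this] with s hs
    exact h1.norm_sub_le h2 ((Metric.ball_subset_ball (min_le_left _ _)).trans hxd) hG hs.1
      (by linarith [hs.2]) (by simpa using hs.1.le)
  rwa [norm_le_zero_iff, sub_eq_zero] at h3

/-- At a Lebesgue point the averages over shrinking balls converge to `G x`, while the Campanato
bound forces them to `g x`. -/
theorem ae_eq_of_campanatoAt {β : ℝ} (hβ : 0 < β) {g : Sp n → Sp n}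
    (hG : MemLp G 2 (volume.restrict (unitBall n)))
    (h : ∀ x ∈ unitBall n, ∃ H d, 0 < d ∧ CampanatoAt G β H d x (g x)) :
    G =ᵐ[volume.restrict (unitBall n)] g := by
  set f := (unitBall n).indicator G with hf
  have hGi : IntegrableOn G (unitBall n) := hG.integrable (by norm_num)
  have hfi : Integrable f := hGi.integrable_indicator Metric.isOpen_ball.measurableSet
  have hL := IsUnifLocDoublingMeasure.ae_tendsto_average_norm_sub volume
    hfi.locallyIntegrable 1
  filter_upwards [ae_restrict_of_ae hL, ae_restrict_mem Metric.isOpen_ball.measurableSet]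
    with x hx hxB
  have h1 := hx (ι := ℝ) (l := 𝓝[>] 0) (fun _ => x) id Filter.tendsto_id
    (by
      filter_upwards [self_mem_nhdsWithin] with t ht
      exact Metric.mem_closedBall_self (by simpa using (mem_Ioi.1 ht).le))
  obtain ⟨H, d, hd, hC⟩ := h x hxB
  set b := volume.real (unitBall n) with hb
  have hb0 : 0 < b := volume_real_unitBall_pos
  have hfx : f x = G x := indicator_of_mem hxB G
  have hlim : Filter.Tendsto (fun s : ℝ => (√b * H * s ^ β +
      b * ⨍ y in Metric.closedBall x s, ‖f y - f x‖)) (𝓝[>] 0) (𝓝 0) := by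
    have : Filter.Tendsto (fun s : ℝ => s ^ β) (𝓝 0) (𝓝 (0 ^ β)) :=
      (Real.continuousAt_rpow_const 0 β (Or.inr hβ.le)).tendsto
    rw [Real.zero_rpow hβ.ne'] at this
    have h2 := (this.mono_left (nhdsWithin_le_nhds (s := Ioi 0))).const_mul (√b * H)
    simpa using h2.add (h1.const_mul b)
  have h3 : b * ‖G x - g x‖ ≤ 0 := by
    refine ge_of_tendsto hlim ?_
    have hx1 : ‖x‖ < 1 := by simpa using hxB
    filter_upwards [Ioo_mem_nhdsGT hd, Ioo_mem_nhdsGT (show 0 < 1 - ‖x‖ by linarith)]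
      with s hs hs1
    have hs0 : 0 < s := hs.1
    have hsub : Metric.ball x s ⊆ unitBall n :=
      Metric.ball_subset_ball' (by rw [dist_zero_right]; linarith [hs1.2])
    have hfin : IsFiniteMeasure (volume.restrict (Metric.ball x s)) :=
      ⟨by simpa using measure_ball_lt_top⟩
    have hGs := hG.mono_measure (Measure.restrict_mono hsub le_rfl)
    have i1 := integral_norm_le_l2norm (S := Metric.ball x s) (f := fun y => G y - g x)
      measure_ball_lt_top.ne
      (hGs.sub (memLp_const (g x)))
    have i2 := i1.trans (mul_le_mul_of_nonneg_left (hC s hs0 hs.2.le) (Real.sqrt_nonneg _))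
    have i3 : ∫ y in Metric.ball x s, ‖f y - f x‖
        ≤ ∫ y in Metric.closedBall x s, ‖f y - f x‖ := by
      refine setIntegral_mono_set ?_ (Filter.Eventually.of_forall fun _ => norm_nonneg _)
        (Filter.Eventually.of_forall Metric.ball_subset_closedBall)
      exact (hfi.integrableOn.sub (integrableOn_const measure_closedBall_lt_top.ne)).norm
    have i4 : ∫ y in Metric.ball x s, ‖f y - f x‖ = ∫ y in Metric.ball x s, ‖G y - G x‖ := by
      refine setIntegral_congr_fun Metric.isOpen_ball.measurableSet fun y hy => ?_
      have : f y = G y := indicator_of_mem (hsub hy) G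
      simp only [hfx, this]
    have hvol : volume.real (Metric.closedBall x s) = s ^ n * b := by
      rw [Measure.addHaar_real_closedBall _ _ hs0.le, finrank_euclideanSpace, Fintype.card_fin]
    have hsn : 0 < s ^ n := by positivity
    have i5 : ∫ y in Metric.closedBall x s, ‖f y - f x‖
        = s ^ n * (b * ⨍ y in Metric.closedBall x s, ‖f y - f x‖) := by
      rw [setAverage_eq, hvol, smul_eq_mul]
      field_simp
    have i6 : s ^ n * (b * ‖G x - g x‖) ≤ (∫ y in Metric.ball x s, ‖G y - g x‖)
        + ∫ y in Metric.ball x s, ‖G y - G x‖ := by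
      have hi1 : IntegrableOn (fun y => ‖G y - g x‖) (Metric.ball x s) :=
        ((hGs.sub (memLp_const (g x))).integrable (by norm_num)).norm
      have hi2 : IntegrableOn (fun y => ‖G y - G x‖) (Metric.ball x s) :=
        ((hGs.sub (memLp_const (G x))).integrable (by norm_num)).norm
      have : s ^ n * (b * ‖G x - g x‖) = ∫ y in Metric.ball x s, ‖G x - g x‖ := by
        rw [setIntegral_const, volume_real_ball _ hs0, smul_eq_mul, mul_assoc]
      rw [this, ← integral_add hi1 hi2]
      refine setIntegral_mono (integrableOn_const measure_ball_lt_top.ne) (hi1.add hi2)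
        fun y => ?_
      have := norm_sub_le_norm_sub_add_norm_sub (G x) (G y) (g x)
      rw [norm_sub_rev (G x) (G y)] at this
      linarith
    rw [volume_real_ball _ hs0, Real.sqrt_mul (by positivity)] at i2
    have i7 : √(s ^ n) * √b * (H * (√(s ^ n) * s ^ β)) = s ^ n * (√b * H * s ^ β) := by
      have := Real.mul_self_sqrt hsn.le
      calc _ = (√(s ^ n) * √(s ^ n)) * (√b * H * s ^ β) := by ring
        _ = _ := by rw [this]
    refine le_of_mul_le_mul_left ?_ hsn
    rw [← hb, i7] at i2
    rw [mul_add, ← i5]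
    linarith
  have h4 : ‖G x - g x‖ ≤ 0 := by
    by_contra hc
    nlinarith
  rwa [norm_le_zero_iff, sub_eq_zero] at h4

theorem exists_holder_gradient (n : ℕ) (α : ℝ≥0) (hα₀ : 0 < α) (hα₁ : α < 1) (M : ℝ)
    (hM : 1 ≤ M) :
    ∃ K : ℝ → ℝ, (∀ ρ, 0 ≤ K ρ) ∧
      ∀ (A : Sp n → Matrix (Fin n) (Fin n) ℝ) (ω : ℝ → ℝ) (U : Sp n → ℝ),
        IsCoeff α M A → IsGauge α M ω → IsAlmostHarmonic A ω U →
        ∃ g : Sp n → Sp n, weakGrad (unitBall n) U =ᵐ[volume.restrict (unitBall n)] g ∧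
          ∀ ρ, 0 ≤ ρ → ρ < 1 →
            (∀ x, ‖x‖ ≤ ρ → ‖g x‖ ≤ K ρ * l2norm (unitBall n) (weakGrad (unitBall n) U)) ∧
            ∀ x y, ‖x‖ ≤ ρ → ‖y‖ ≤ ρ → ‖g x - g y‖ ≤
              K ρ * l2norm (unitBall n) (weakGrad (unitBall n) U) * ‖x - y‖ ^ ((α : ℝ) / 2) := by
  have hα0' : (0 : ℝ) < α := by exact_mod_cast hα₀
  set β : ℝ := (α : ℝ) / 2 with hβ
  have hβ0 : 0 < β := by positivity
  have hex : ∀ ρ : ℝ, ∃ d K : ℝ, 0 < d ∧ 0 ≤ K ∧ (0 ≤ ρ → ρ < 1 → d ≤ (1 - ρ) / 2 ∧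
      ∀ (A : Sp n → Matrix (Fin n) (Fin n) ℝ) (ω : ℝ → ℝ) (U : Sp n → ℝ),
        IsCoeff α M A → IsGauge α M ω → IsAlmostHarmonic A ω U →
        ∀ x₀ : Sp n, ‖x₀‖ ≤ ρ → ∃ p : Sp n,
          ‖p‖ ≤ K * l2norm (unitBall n) (weakGrad (unitBall n) U) ∧
          CampanatoAt (weakGrad (unitBall n) U) β
            (K * l2norm (unitBall n) (weakGrad (unitBall n) U)) d x₀ p) := by
    intro ρ
    by_cases hρ : 0 ≤ ρ ∧ ρ < 1
    · obtain ⟨d, hd, hd1, K, hK, h⟩ := exists_campanato n α hα₀ hα₁ M hM hρ.2 hρ.1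
      exact ⟨d, K, hd, hK, fun _ _ => ⟨hd1, h⟩⟩
    · exact ⟨1, 0, one_pos, le_rfl, fun h1 h2 => (hρ ⟨h1, h2⟩).elim⟩
  choose d K hd hK h using hex
  refine ⟨fun ρ => K ρ + campConst n β * K ρ + 2 * K ρ * (2 / d ρ) ^ β, fun ρ => ?_,
    fun A ω U hA hω hU => ?_⟩
  · have := hK ρ
    have := hd ρ
    have := campConst_nonneg (n := n) β
    positivity
  set G := weakGrad (unitBall n) U with hGdef
  have hG : MemLp G 2 (volume.restrict (unitBall n)) := hU.1.2.2
  set N := l2norm (unitBall n) G with hN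
  have hN0 : 0 ≤ N := l2norm_nonneg _ _
  -- The value at x is chosen with ρ = ‖x‖, so `g` does not depend on ρ. Uniqueness of Campanato
  -- values (`CampanatoAt.eq`) then gives the bounds for every larger ρ.
  have hgex : ∀ x : Sp n, ∃ p, x ∈ unitBall n → CampanatoAt G β (K ‖x‖ * N) (d ‖x‖) x p := by
    intro x
    by_cases hx : x ∈ unitBall n
    · obtain ⟨p, -, hp⟩ := (h ‖x‖ (norm_nonneg x) (by simpa using hx)).2 A ω U hA hω hU x le_rfl
      exact ⟨p, fun _ => hp⟩
    · exact ⟨0, fun hc => (hx hc).elim⟩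
  choose g hg using hgex
  have hball : ∀ ρ, 0 ≤ ρ → ρ < 1 → ∀ x : Sp n, ‖x‖ ≤ ρ → Metric.ball x (d ρ) ⊆ unitBall n := by
    intro ρ hρ0 hρ1 x hx
    refine Metric.ball_subset_ball' ?_
    rw [dist_zero_right]
    linarith [(h ρ hρ0 hρ1).1]
  have hgρ : ∀ ρ, 0 ≤ ρ → ρ < 1 → ∀ x : Sp n, ‖x‖ ≤ ρ →
      ‖g x‖ ≤ K ρ * N ∧ CampanatoAt G β (K ρ * N) (d ρ) x (g x) := by
    intro ρ hρ0 hρ1 x hx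
    obtain ⟨p, hp1, hp2⟩ := (h ρ hρ0 hρ1).2 A ω U hA hω hU x hx
    have hxB : x ∈ unitBall n := by
      rw [unitBall, mem_ball_zero_iff]
      linarith
    have := hp2.eq hβ0 (hd ρ) (hd ‖x‖) (hg x hxB) (hball ρ hρ0 hρ1 x hx) hG
    rw [← this]
    exact ⟨hp1, hp2⟩
  refine ⟨g, ae_eq_of_campanatoAt hβ0 hG fun x hx => ⟨_, _, hd _, hg x hx⟩,
    fun ρ hρ0 hρ1 => ⟨fun x hx => ?_, fun x y hx hy => ?_⟩⟩
  · refine (hgρ ρ hρ0 hρ1 x hx).1.trans (mul_le_mul_of_nonneg_right ?_ hN0)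
    have := hK ρ
    have := hd ρ
    have := campConst_nonneg (n := n) β
    have : 0 ≤ campConst n β * K ρ + 2 * K ρ * (2 / d ρ) ^ β := by positivity
    linarith
  · have hK0 := hK ρ
    have hd0 := hd ρ
    have hc0 := campConst_nonneg (n := n) β
    have hs0 : 0 ≤ ‖x - y‖ ^ β := by positivity
    have t1 : 0 ≤ K ρ * N * ‖x - y‖ ^ β := by positivity
    have t2 : 0 ≤ campConst n β * K ρ * N * ‖x - y‖ ^ β := by positivity
    have t3 : 0 ≤ 2 * K ρ * (2 / d ρ) ^ β * N * ‖x - y‖ ^ β := by positivity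
    rcases eq_or_ne x y with rfl | hxy
    · simp only [sub_self, norm_zero]
      rw [Real.zero_rpow hβ0.ne', mul_zero]
    have hpos : 0 < ‖x - y‖ := norm_pos_iff.2 (sub_ne_zero.2 hxy)
    obtain ⟨hx1, hx2⟩ := hgρ ρ hρ0 hρ1 x hx
    obtain ⟨hy1, hy2⟩ := hgρ ρ hρ0 hρ1 y hy
    by_cases hs : 2 * ‖x - y‖ ≤ d ρ
    · have := hx2.norm_sub_le hy2 (hball ρ hρ0 hρ1 x hx) hG hpos hs le_rfl
      nlinarith
    -- Points further apart than d/2: the sup bound suffices, since (2/d)^β ‖x - y‖^β ≥ 1.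
    · rw [not_le] at hs
      have h1 : 1 ≤ (2 / d ρ) ^ β * ‖x - y‖ ^ β := by
        rw [← Real.mul_rpow (by positivity) hpos.le]
        refine Real.one_le_rpow ?_ hβ0.le
        rw [div_mul_eq_mul_div, le_div_iff₀ hd0]
        linarith
      have h2 := norm_sub_le (g x) (g y)
      have h3 := mul_le_mul_of_nonneg_left h1 (show 0 ≤ 2 * K ρ * N by positivity)
      nlinarith

end Holder

end AlmostHarmonic

namespace AlmostHarmonic

/-! ### Functions with a continuous weak gradient -/

section Smooth

variable {n : ℕ}

theorem IsWeakGrad.congr {Ω : Set (Sp n)} {u : Sp n → ℝ} {G G' : Sp n → Sp n}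
    (h : IsWeakGrad Ω u G) (he : G =ᵐ[volume.restrict Ω] G')
    (hG' : LocallyIntegrableOn G' Ω) : IsWeakGrad Ω u G' := by
  refine ⟨h.1, hG', fun φ hφ i => ?_⟩
  rw [h.2.2 φ hφ i]
  congr 1
  refine integral_congr_ae ?_
  filter_upwards [he] with x hx
  rw [hx]

-- The derivative falls on the mollifier, and its reflection about x is an admissible test function
-- as long as its support stays in the unit ball.
open ContinuousLinearMap in
theorem IsWeakGrad.hasGradientAt_convolution {U : Sp n → ℝ} {G : Sp n → Sp n}
    (hW : IsWeakGrad (unitBall n) U G) (hU : IntegrableOn U (unitBall n))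
    (hG : IntegrableOn G (unitBall n)) (φ : ContDiffBump (0 : Sp n)) {x : Sp n}
    (hx : ‖x‖ + φ.rOut < 1) :
    HasGradientAt (convolution (φ.normed volume) ((unitBall n).indicator U) (lsmul ℝ ℝ) volume)
      (convolution (φ.normed volume) ((unitBall n).indicator G) (lsmul ℝ ℝ) volume x) x := by
  set F := φ.normed volume with hF
  have hFs : ContDiff ℝ ((⊤ : ℕ∞) : WithTop ℕ∞) F := φ.contDiff_normed
  have hFc : HasCompactSupport F := φ.hasCompactSupport_normed
  have hUi : Integrable ((unitBall n).indicator U) :=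
    hU.integrable_indicator Metric.isOpen_ball.measurableSet
  have hGi : Integrable ((unitBall n).indicator G) :=
    hG.integrable_indicator Metric.isOpen_ball.measurableSet
  have hd := hFc.hasFDerivAt_convolution_left (lsmul ℝ ℝ) (hFs.of_le (by simp))
    hUi.locallyIntegrable x
  have hdc : Continuous (fderiv ℝ F) := hFs.continuous_fderiv (by simp)
  -- the reflected mollifier is a test function
  set χ : Sp n → ℝ := fun y => F (x - y) with hχ
  have hχt : IsTestFun (unitBall n) χ := by
    have hs : tsupport χ ⊆ Metric.closedBall x φ.rOut := by
      refine closure_minimal (fun y hy => ?_) Metric.isClosed_closedBall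
      have : x - y ∈ Function.support F := hy
      rw [hF, φ.support_normed_eq, mem_ball_zero_iff] at this
      rw [Metric.mem_closedBall, dist_comm, dist_eq_norm]
      exact this.le
    refine ⟨hFs.comp (contDiff_const.sub contDiff_id),
      (isCompact_closedBall x φ.rOut).of_isClosed_subset (isClosed_tsupport _) hs,
      hs.trans fun y hy => ?_⟩
    rw [Metric.mem_closedBall, dist_eq_norm] at hy
    rw [unitBall, mem_ball_zero_iff]
    have := norm_le_norm_add_norm_sub' y x
    linarith
  have hχd : ∀ y v, fderiv ℝ χ y v = - fderiv ℝ F (x - y) v := by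
    intro y v
    have h1 : HasFDerivAt (fun y : Sp n => x - y) (-ContinuousLinearMap.id ℝ (Sp n)) y :=
      (hasFDerivAt_id y).const_sub x
    have := (((hFs.differentiable (by simp)) (x - y)).hasFDerivAt.comp y h1).fderiv
    simp only [Function.comp_def] at this
    rw [hχ, this]
    simp
  rw [hasGradientAt_iff_hasFDerivAt]
  refine hd.congr_fderiv ?_
  ext v
  rw [InnerProductSpace.toDual_apply_apply]
  have hex := (hFc.fderiv ℝ).convolutionExists_left ((lsmul ℝ ℝ).precompL (Sp n)) hdc
    hUi.locallyIntegrable x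
  have e1 : (convolution (fderiv ℝ F) ((unitBall n).indicator U) ((lsmul ℝ ℝ).precompL (Sp n))
      volume x) v = ∫ y in unitBall n, fderiv ℝ F (x - y) v * U y := by
    rw [convolution_def, ContinuousLinearMap.integral_apply hex,
      ← integral_sub_left_eq_self _ volume x,
      ← integral_indicator Metric.isOpen_ball.measurableSet]
    congr 1
    ext y
    simp only [ContinuousLinearMap.precompL_apply, lsmul_apply, sub_sub_cancel, smul_eq_mul]
    by_cases hy : y ∈ unitBall n
    · rw [indicator_of_mem hy, indicator_of_mem hy]
    · rw [indicator_of_notMem hy, indicator_of_notMem hy, mul_zero]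
  have hint : IntegrableOn (fun y => F (x - y) • G y) (unitBall n) :=
    hG.locallyIntegrableOn.integrable_smul_of_tsupport_subset hχt.continuous hχt.2.1 hχt.2.2
  have e2 : inner ℝ (convolution F ((unitBall n).indicator G) (lsmul ℝ ℝ) volume x) v
      = ∫ y in unitBall n, inner ℝ (G y) v * χ y := by
    have e3 : convolution F ((unitBall n).indicator G) (lsmul ℝ ℝ) volume x
        = ∫ y in unitBall n, F (x - y) • G y := by
      rw [convolution_lsmul_swap, ← integral_indicator Metric.isOpen_ball.measurableSet]
      congr 1
      ext1 y
      by_cases hy : y ∈ unitBall n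
      · rw [indicator_of_mem hy, indicator_of_mem hy]
      · rw [indicator_of_notMem hy, indicator_of_notMem hy, smul_zero]
    rw [e3, real_inner_comm, ← integral_inner hint]
    refine integral_congr_ae (Filter.Eventually.of_forall fun y => ?_)
    simp only [hχ, real_inner_smul_right, real_inner_comm (G y)]
    ring
  have key := hW.integral_mul_fderiv hχt v
  rw [e1, e2, ← neg_eq_iff_eq_neg.2 key, ← integral_neg]
  refine integral_congr_ae (Filter.Eventually.of_forall fun y => ?_)
  simp only [hχd]
  ring

-- The mollified functions converge almost everywhere to `U` and their gradients converge locally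
-- uniformly to `g`. Convergence at one point of a ball then propagates to the whole ball, and the
-- limit may be differentiated.
open ContinuousLinearMap in
theorem IsWeakGrad.exists_hasGradientAt {U : Sp n → ℝ} {g : Sp n → Sp n}
    (hW : IsWeakGrad (unitBall n) U g) (hU : IntegrableOn U (unitBall n))
    (hg : IntegrableOn g (unitBall n)) (hgc : ContinuousOn g (unitBall n)) :
    ∃ u : Sp n → ℝ, u =ᵐ[volume.restrict (unitBall n)] U ∧
      ∀ x ∈ unitBall n, HasGradientAt u (g x) x := by
  set φ : ℕ → ContDiffBump (0 : Sp n) := fun j =>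
    ⟨1 / ((j : ℝ) + 1) / 2, 1 / ((j : ℝ) + 1), by positivity, half_lt_self (by positivity)⟩ with hφ
  have hrOut : Filter.Tendsto (fun j => (φ j).rOut) Filter.atTop (𝓝 0) :=
    tendsto_one_div_add_atTop_nhds_zero_nat
  set f := (unitBall n).indicator U with hf
  set h := (unitBall n).indicator g with hh
  have hfi : Integrable f := hU.integrable_indicator Metric.isOpen_ball.measurableSet
  have hhi : Integrable h := hg.integrable_indicator Metric.isOpen_ball.measurableSet
  set u' : ℕ → Sp n → ℝ := fun j => convolution ((φ j).normed volume) f (lsmul ℝ ℝ) volume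
    with hu'
  set v' : ℕ → Sp n → Sp n := fun j => convolution ((φ j).normed volume) h (lsmul ℝ ℝ) volume
    with hv'
  have hae : ∀ᵐ x : Sp n, Filter.Tendsto (fun j => u' j x) Filter.atTop (𝓝 (f x)) :=
    -- 2 is the fixed ratio of outer to inner radius of the bumps.
    ContDiffBump.ae_convolution_tendsto_right_of_locallyIntegrable (K := 2) hrOut
      (Filter.Eventually.of_forall fun j => by
        change 1 / ((j : ℝ) + 1) ≤ 2 * (1 / ((j : ℝ) + 1) / 2)
        linarith) hfi.locallyIntegrable
  -- uniform convergence of the mollified gradients on smaller balls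
  have hunif : ∀ ρ < 1, TendstoUniformlyOn v' g Filter.atTop (Metric.ball 0 ρ) := by
    intro ρ hρ
    rw [Metric.tendstoUniformlyOn_iff]
    intro ε hε
    set ρ' := (1 + ρ) / 2 with hρ'
    have hsub : Metric.closedBall (0 : Sp n) ρ' ⊆ unitBall n :=
      Metric.closedBall_subset_ball (by linarith)
    have huc := (isCompact_closedBall (0 : Sp n) ρ').uniformContinuousOn_of_continuous
      (hgc.mono hsub)
    rw [Metric.uniformContinuousOn_iff] at huc
    obtain ⟨δ, hδ, huc⟩ := huc (ε / 2) (by positivity)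
    have hρρ : 0 < ρ' - ρ := by linarith
    filter_upwards [hrOut.eventually (gt_mem_nhds hδ), hrOut.eventually (gt_mem_nhds hρρ)]
      with j hj1 hj2 x hx
    rw [mem_ball_zero_iff] at hx
    have hxρ : x ∈ Metric.closedBall (0 : Sp n) ρ' := by
      rw [mem_closedBall_zero_iff]
      linarith
    have hhx : h x = g x := indicator_of_mem (hsub hxρ) g
    have := (φ j).dist_normed_convolution_le (μ := volume) (g := h) (x₀ := x) (ε := ε / 2)
      hhi.aestronglyMeasurable (fun y hy => ?_)
    · rw [dist_comm, ← hhx]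
      exact this.trans_lt (by linarith)
    · rw [Metric.mem_ball, dist_eq_norm] at hy
      have hyρ : y ∈ Metric.closedBall (0 : Sp n) ρ' := by
        rw [mem_closedBall_zero_iff]
        have := norm_le_norm_add_norm_sub' y x
        linarith
      have hhy : h y = g y := indicator_of_mem (hsub hyρ) g
      rw [hhx, hhy]
      exact (huc y hyρ x hxρ (by rw [dist_eq_norm]; linarith)).le
  -- On the ball of radius ρ the gradient formula holds only once the mollification radius is below
  -- 1 - ρ, so the first J terms are dropped.
  have hshift : ∀ ρ < 1, ∃ J : ℕ, ∀ j : ℕ, ∀ x ∈ Metric.ball (0 : Sp n) ρ,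
      HasFDerivAt (u' (j + J)) (InnerProductSpace.toDual ℝ (Sp n) (v' (j + J) x)) x := by
    intro ρ hρ
    obtain ⟨J, hJ⟩ := Filter.eventually_atTop.1
      (hrOut.eventually (gt_mem_nhds (show 0 < 1 - ρ by linarith)))
    refine ⟨J, fun j x hx => ?_⟩
    rw [mem_ball_zero_iff] at hx
    exact (hW.hasGradientAt_convolution hU hg (φ (j + J))
      (by linarith [hJ (j + J) (Nat.le_add_left J j)])).hasFDerivAt
  have hunif' : ∀ ρ < 1, ∀ J : ℕ, TendstoUniformlyOn
      (fun j x => InnerProductSpace.toDual ℝ (Sp n) (v' (j + J) x))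
      (fun x => InnerProductSpace.toDual ℝ (Sp n) (g x)) Filter.atTop (Metric.ball 0 ρ) := by
    intro ρ hρ J
    have h1 := hunif ρ hρ
    rw [Metric.tendstoUniformlyOn_iff] at h1 ⊢
    intro ε hε
    filter_upwards [(Filter.tendsto_add_atTop_nat J).eventually (h1 ε hε)] with j hj x hx
    rw [(InnerProductSpace.toDual ℝ (Sp n)).dist_map]
    exact hj x hx
  have hconv : ∀ x ∈ unitBall n, ∃ c, Filter.Tendsto (fun j => u' j x) Filter.atTop (𝓝 c) := by
    intro x hx
    rw [unitBall, mem_ball_zero_iff] at hx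
    set ρ := (1 + ‖x‖) / 2 with hρ
    have hρ1 : ρ < 1 := by linarith
    have hρ0 : 0 < ρ := by positivity
    obtain ⟨J, hJ⟩ := hshift ρ hρ1
    -- The ball has positive measure, so it contains a point of almost everywhere convergence.
    obtain ⟨x₀, hx₀, hlim⟩ : ∃ x₀ ∈ Metric.ball (0 : Sp n) ρ,
        Filter.Tendsto (fun j => u' j x₀) Filter.atTop (𝓝 (f x₀)) := by
      have hne : volume.restrict (Metric.ball (0 : Sp n) ρ) ≠ 0 := by
        rw [Ne, Measure.restrict_eq_zero]
        exact (Metric.measure_ball_pos volume _ hρ0).ne'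
      have : (ae (volume.restrict (Metric.ball (0 : Sp n) ρ))).NeBot := ae_neBot.2 hne
      obtain ⟨x₀, h1, h2⟩ := ((ae_restrict_mem Metric.isOpen_ball.measurableSet).and
        (ae_restrict_of_ae hae)).exists (f := ae (volume.restrict (Metric.ball (0 : Sp n) ρ)))
      exact ⟨x₀, h1, h2⟩
    have hcau := cauchy_map_of_uniformCauchySeqOn_fderiv Metric.isOpen_ball
      (convex_ball (0 : Sp n) ρ).isPreconnected (hunif' ρ hρ1 J).uniformCauchySeqOn hJ hx₀
      (x := x) (by rw [mem_ball_zero_iff]; linarith)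
      ((hlim.comp (Filter.tendsto_add_atTop_nat J)).cauchy_map)
    obtain ⟨c, hc⟩ := cauchy_map_iff_exists_tendsto.1 hcau
    exact ⟨c, (Filter.tendsto_add_atTop_iff_nat J).1 hc⟩
  choose! u hu using hconv
  refine ⟨u, ?_, fun x hx => ?_⟩
  · filter_upwards [ae_restrict_of_ae hae, ae_restrict_mem Metric.isOpen_ball.measurableSet]
      with x hx hxB
    rw [tendsto_nhds_unique (hu x hxB) hx, hf, indicator_of_mem hxB]
  · have hx1 : ‖x‖ < 1 := by simpa using hx
    have hρ1 : (1 + ‖x‖) / 2 < 1 := by linarith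
    obtain ⟨J, hJ⟩ := hshift _ hρ1
    exact hasGradientAt_iff_hasFDerivAt.2 (hasFDerivAt_of_tendstoUniformlyOn Metric.isOpen_ball (hunif' _ hρ1 J) hJ
      (fun y hy => (hu y (Metric.ball_subset_ball hρ1.le hy)).comp
        (Filter.tendsto_add_atTop_nat J))
      (x := x) (by rw [mem_ball_zero_iff]; linarith))

end Smooth

end AlmostHarmonic

namespace AlmostHarmonic

/-! ### The regularity theorem -/

section Main

variable {n : ℕ}

/-! ### Passage to the norms of the statement. -/

theorem l2norm_le_toReal {F : Type*} [NormedAddCommGroup F] {f : Sp n → F} {S : Set (Sp n)}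
    {W : ℝ≥0∞} (hW : W ≠ ∞) (h : (∫⁻ x in S, ‖f x‖ₑ ^ 2) ^ (1 / 2 : ℝ) ≤ W) :
    l2norm S f ≤ W.toReal := by
  refine ENNReal.toReal_mono hW (le_trans (le_of_eq ?_) h)
  rw [eLpNorm_eq_lintegral_rpow_enorm_toReal (by norm_num) (by norm_num)]
  simp

theorem MemW12.w12ENorm_ne_top {Ω : Set (Sp n)} {U : Sp n → ℝ} (hU : MemW12 Ω U) :
    W12ENorm Ω U ≠ ∞ := by
  have h : ∀ {F : Type} [NormedAddCommGroup F] {f : Sp n → F}, MemLp f 2 (volume.restrict Ω) →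
      ∫⁻ x in Ω, ‖f x‖ₑ ^ 2 ≠ ∞ := by
    intro F _ f hf
    have := lintegral_rpow_enorm_lt_top_of_eLpNorm_lt_top (p := 2) (by norm_num) (by norm_num)
      hf.2
    simpa using this.ne
  exact ENNReal.rpow_ne_top_of_nonneg (by norm_num)
    (ENNReal.add_ne_top.2 ⟨h hU.2.1, h hU.2.2⟩)

theorem continuousOn_of_local_holder {g : Sp n → Sp n} {β : ℝ} (hβ : 0 < β)
    (h : ∀ ρ, 0 ≤ ρ → ρ < 1 → ∃ H : ℝ, ∀ x y, ‖x‖ ≤ ρ → ‖y‖ ≤ ρ → ‖g x - g y‖ ≤ H * ‖x - y‖ ^ β) :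
    ContinuousOn g (unitBall n) := by
  intro x hx
  refine ContinuousAt.continuousWithinAt ?_
  have hx1 : ‖x‖ < 1 := by simpa using hx
  obtain ⟨H, hH⟩ := h ((1 + ‖x‖) / 2) (by positivity) (by linarith)
  rw [ContinuousAt, tendsto_iff_norm_sub_tendsto_zero]
  have h1 : Filter.Tendsto (fun y : Sp n => H * ‖y - x‖ ^ β) (𝓝 x) (𝓝 0) := by
    have hc : Continuous fun y : Sp n => H * ‖y - x‖ ^ β :=
      continuous_const.mul ((continuous_id.sub continuous_const).norm.rpow_const
        fun _ => Or.inr hβ.le)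
    have := hc.tendsto x
    simp only [sub_self, norm_zero] at this
    rwa [Real.zero_rpow hβ.ne', mul_zero] at this
  refine squeeze_zero' (Filter.Eventually.of_forall fun _ => norm_nonneg _) ?_ h1
  have hxm : x ∈ Metric.ball (0 : Sp n) ((1 + ‖x‖) / 2) := by
    rw [mem_ball_zero_iff]
    linarith
  filter_upwards [Metric.isOpen_ball.mem_nhds hxm] with y hy
  rw [mem_ball_zero_iff] at hy
  exact hH y x hy.le (by linarith)

/-- A function with bounded gradient is bounded by its `L²` norm, in the interior. -/
theorem norm_le_of_gradient_bound {u : Sp n → ℝ} {g : Sp n → Sp n}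
    (hu : ∀ x ∈ unitBall n, HasGradientAt u (g x) x)
    (hu2 : MemLp u 2 (volume.restrict (unitBall n))) {ρ H : ℝ} (hρ1 : ρ < 1)
    (hH : ∀ x, ‖x‖ ≤ (1 + ρ) / 2 → ‖g x‖ ≤ H) {x : Sp n} (hx : ‖x‖ ≤ ρ) :
    |u x| ≤ (√(((1 - ρ) / 2) ^ n * volume.real (unitBall n)))⁻¹ * l2norm (unitBall n) u
      + H * ((1 - ρ) / 2) := by
  set r := (1 - ρ) / 2 with hr
  have hr0 : 0 < r := by
    rw [hr]
    linarith
  have hsub : ∀ y ∈ Metric.ball x r, ‖y‖ ≤ (1 + ρ) / 2 := by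
    intro y hy
    rw [Metric.mem_ball, dist_eq_norm] at hy
    have := norm_le_norm_add_norm_sub' y x
    linarith
  have hsubB : Metric.ball x r ⊆ unitBall n := fun y hy => by
    rw [unitBall, mem_ball_zero_iff]
    linarith [hsub y hy]
  have hxr : x ∈ Metric.ball x r := Metric.mem_ball_self hr0
  have hH0 : 0 ≤ H := (norm_nonneg _).trans (hH x (hsub x hxr))
  have hfin : IsFiniteMeasure (volume.restrict (Metric.ball x r)) :=
    ⟨by simpa using measure_ball_lt_top⟩
  -- Mean value inequality; averaging over y then brings in the L² norm.
  have hpt : ∀ y ∈ Metric.ball x r, |u x| ≤ |u y| + H * r := by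
    intro y hy
    have h1 := (convex_ball x r).norm_image_sub_le_of_norm_hasFDerivWithin_le (𝕜 := ℝ)
      (f := u) (f' := fun z => InnerProductSpace.toDual ℝ (Sp n) (g z)) (C := H)
      (fun z hz => (hu z (hsubB hz)).hasFDerivAt.hasFDerivWithinAt)
      (fun z hz => by
        rw [LinearIsometryEquiv.norm_map]
        exact hH z (hsub z hz)) hy hxr
    have h2 : ‖x - y‖ ≤ r := by
      rw [norm_sub_rev, ← dist_eq_norm]
      exact (Metric.mem_ball.1 hy).le
    have h3 := norm_le_norm_add_norm_sub' (u x) (u y)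
    simp only [Real.norm_eq_abs] at h1 h3
    have := mul_le_mul_of_nonneg_left h2 hH0
    linarith
  have hu2r := hu2.mono_measure (Measure.restrict_mono hsubB le_rfl)
  have hui : IntegrableOn (fun y => |u y|) (Metric.ball x r) :=
    (hu2r.integrable (by norm_num)).abs
  have hv := volume_real_ball x hr0
  set v := r ^ n * volume.real (unitBall n) with hvdef
  have hv0 : 0 < v := mul_pos (by positivity) volume_real_unitBall_pos
  have hc : IntegrableOn (fun _ : Sp n => H * r) (Metric.ball x r) :=
    integrableOn_const measure_ball_lt_top.ne
  have h4 : v * |u x| ≤ (∫ y in Metric.ball x r, |u y|) + v * (H * r) := by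
    have : ∫ y in Metric.ball x r, |u x| ≤ ∫ y in Metric.ball x r, (|u y| + H * r) :=
      setIntegral_mono_on (integrableOn_const measure_ball_lt_top.ne) (hui.add hc)
        Metric.isOpen_ball.measurableSet hpt
    rw [integral_add hui hc, setIntegral_const, setIntegral_const, hv, smul_eq_mul,
      smul_eq_mul] at this
    exact this
  have h5 := integral_norm_le_l2norm (S := Metric.ball x r) measure_ball_lt_top.ne hu2r
  rw [hv] at h5
  simp only [Real.norm_eq_abs] at h5
  have h6 := mul_le_mul_of_nonneg_left (l2norm_mono_set hsubB hu2) (Real.sqrt_nonneg v)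
  have h7 : √v * l2norm (unitBall n) u = v * ((√v)⁻¹ * l2norm (unitBall n) u) := by
    have hs := Real.sqrt_pos.2 hv0
    nth_rewrite 2 [← Real.mul_self_sqrt hv0.le]
    field_simp
  refine le_of_mul_le_mul_left ?_ hv0
  rw [mul_add]
  linarith

theorem CompactlyIn.exists_norm_le {K : Set (Sp n)} (h : CompactlyIn K (unitBall n)) :
    ∃ ρ : ℝ, 0 ≤ ρ ∧ ρ < 1 ∧ ∀ x ∈ K, ‖x‖ ≤ ρ := by
  rcases (closure K).eq_empty_or_nonempty with he | hne
  · refine ⟨0, le_rfl, one_pos, fun x hx => ?_⟩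
    have := subset_closure hx
    simp [he] at this
  · obtain ⟨z, hz, hmax⟩ := h.1.exists_isMaxOn hne continuous_norm.continuousOn
    exact ⟨‖z‖, norm_nonneg z, by simpa using h.2 hz, fun x hx => hmax (subset_closure hx)⟩

theorem C1HolderENorm_le {β : ℝ≥0} {K : Set (Sp n)} {u : Sp n → ℝ} {a b w : ℝ} (ha : 0 ≤ a)
    (hb : 0 ≤ b) (hw : 0 ≤ w) (h0 : ∀ x ∈ K, ‖u x‖ ≤ a * w) (h1 : ∀ x ∈ K, ‖gradient u x‖ ≤ b * w)
    (h2 : ∀ x ∈ K, ∀ y ∈ K, ‖gradient u x - gradient u y‖ ≤ b * w * ‖x - y‖ ^ (β : ℝ)) :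
    C1HolderENorm β K u ≤ ENNReal.ofReal (a + 2 * b) * ENNReal.ofReal w := by
  have e0 : (⨆ x ∈ K, ‖u x‖ₑ) ≤ ENNReal.ofReal (a * w) := iSup₂_le fun x hx => by
    rw [← ofReal_norm]
    exact ENNReal.ofReal_le_ofReal (h0 x hx)
  have e1 : (⨆ x ∈ K, ‖gradient u x‖ₑ) ≤ ENNReal.ofReal (b * w) := iSup₂_le fun x hx => by
    rw [← ofReal_norm]
    exact ENNReal.ofReal_le_ofReal (h1 x hx)
  have e2 : eHolderNorm β (K.domRestrict (gradient u)) ≤ ENNReal.ofReal (b * w) := by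
    refine HolderWith.eHolderNorm_le (C := (b * w).toNNReal) fun x y => ?_
    have := h2 x x.2 y y.2
    have e : ENNReal.ofReal (dist x y) ^ (β : ℝ) = ENNReal.ofReal (dist x y ^ (β : ℝ)) :=
      ENNReal.ofReal_rpow_of_nonneg dist_nonneg β.coe_nonneg
    rw [edist_dist, edist_dist, e]
    change _ ≤ ENNReal.ofReal (b * w) * _
    rw [← ENNReal.ofReal_mul (by positivity)]
    refine ENNReal.ofReal_le_ofReal ?_
    rw [Subtype.dist_eq, dist_eq_norm, dist_eq_norm]
    simpa using this
  calc C1HolderENorm β K u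
      ≤ ENNReal.ofReal (a * w) + (ENNReal.ofReal (b * w) + ENNReal.ofReal (b * w)) :=
        add_le_add e0 (add_le_add e1 e2)
    _ = ENNReal.ofReal (a + 2 * b) * ENNReal.ofReal w := by
        rw [← ENNReal.ofReal_add (by positivity) (by positivity),
          ← ENNReal.ofReal_add (by positivity) (by positivity),
          ← ENNReal.ofReal_mul (by positivity)]
        congr 1
        ring

end Main

end AlmostHarmonic

open AlmostHarmonic in
theorem theorem3p5 (n : ℕ) (hn : 2 ≤ n) (α : ℝ≥0) (hα₀ : 0 < α) (hα₁ : α < 1)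
    (M : ℝ) :
    ∃ C : Set (Sp n) → ℝ≥0,
      ∀ (A : Sp n → Matrix (Fin n) (Fin n) ℝ) (ω : ℝ → ℝ) (U : Sp n → ℝ),
        IsCoeff α M A → IsGauge α M ω → IsAlmostHarmonic A ω U →
        ∃ u : Sp n → ℝ, u =ᵐ[volume.restrict (unitBall n)] U ∧
          MemC1Holder (α / 2) (unitBall n) u ∧
          ∀ K : Set (Sp n), CompactlyIn K (unitBall n) →
            C1HolderENorm (α / 2) K u ≤ (C K : ℝ≥0∞) * W12ENorm (unitBall n) U := by
  by_cases hM : 1 ≤ M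
  swap
  -- For M < 1 there are no admissible coefficients.
  · exact ⟨fun _ => 0, fun A ω U hA => (hM hA.one_le).elim⟩
  obtain ⟨H, hH0, hH⟩ := exists_holder_gradient n α hα₀ hα₁ M hM
  have hR : ∀ K : Set (Sp n), ∃ ρ : ℝ, CompactlyIn K (unitBall n) →
      0 ≤ ρ ∧ ρ < 1 ∧ ∀ x ∈ K, ‖x‖ ≤ ρ := by
    intro K
    by_cases hK : CompactlyIn K (unitBall n)
    · obtain ⟨ρ, hρ⟩ := hK.exists_norm_le
      exact ⟨ρ, fun _ => hρ⟩
    · exact ⟨0, fun h => (hK h).elim⟩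
  choose R hR using hR
  -- The constant in the sup bound for `u`, with gradient controlled on the larger radius (1 + ρ)/2.
  -- The absolute value keeps it nonnegative for all real ρ.
  set a : ℝ → ℝ := fun ρ => (√(((1 - ρ) / 2) ^ n * volume.real (unitBall n)))⁻¹
    + H ((1 + ρ) / 2) * |(1 - ρ) / 2| with ha
  have ha0 : ∀ ρ, 0 ≤ a ρ := fun ρ => by
    have := hH0 ((1 + ρ) / 2)
    positivity
  -- `H` is counted twice: for the supremum of the gradient and for its Hölder seminorm.
  refine ⟨fun K => (a (R K) + 2 * H (R K)).toNNReal, fun A ω U hA hω hU => ?_⟩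
  obtain ⟨g, hGg, hg⟩ := hH A ω U hA hω hU
  have hα0 : (0 : ℝ) < α := by exact_mod_cast hα₀
  have hW := hU.1.w12ENorm_ne_top
  set w := (W12ENorm (unitBall n) U).toReal with hw
  have hw0 : 0 ≤ w := ENNReal.toReal_nonneg
  have hUw : l2norm (unitBall n) U ≤ w :=
    l2norm_le_toReal hW (ENNReal.rpow_le_rpow le_self_add (by norm_num))
  have hGw : l2norm (unitBall n) (weakGrad (unitBall n) U) ≤ w :=
    l2norm_le_toReal hW (ENNReal.rpow_le_rpow le_add_self (by norm_num))
  have hgc : ContinuousOn g (unitBall n) :=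
    continuousOn_of_local_holder (β := (α : ℝ) / 2) (by positivity)
      fun ρ h0 h1 => ⟨_, (hg ρ h0 h1).2⟩
  have hgi : IntegrableOn g (unitBall n) :=
    (hU.1.2.2.integrable (by norm_num)).congr hGg
  have hUi : IntegrableOn U (unitBall n) := hU.1.2.1.integrable (by norm_num)
  obtain ⟨u, huU, hu⟩ := ((isWeakGrad_weakGrad hU.1.1).congr hGg
    hgi.locallyIntegrableOn).exists_hasGradientAt hUi hgi hgc
  have hgrad : ∀ x ∈ unitBall n, gradient u x = g x := fun x hx => (hu x hx).gradient
  have hu2 : MemLp u 2 (volume.restrict (unitBall n)) := (memLp_congr_ae huU).2 hU.1.2.1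
  have hbound : ∀ K : Set (Sp n), CompactlyIn K (unitBall n) →
      C1HolderENorm (α / 2) K u
        ≤ ((a (R K) + 2 * H (R K)).toNNReal : ℝ≥0∞) * W12ENorm (unitBall n) U := by
    intro K hK
    obtain ⟨hρ0, hρ1, hKρ⟩ := hR K hK
    have hKB : ∀ x ∈ K, x ∈ unitBall n := fun x hx => hK.2 (subset_closure hx)
    obtain ⟨hg1, hg2⟩ := hg (R K) hρ0 hρ1
    have hb := hH0 (R K)
    have hb' := hH0 ((1 + R K) / 2)
    rw [← ENNReal.ofReal_toReal hW, ← hw]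
    refine C1HolderENorm_le (ha0 _) hb hw0 (fun x hx => ?_) (fun x hx => ?_)
      fun x hx y hy => ?_
    · have h1 := norm_le_of_gradient_bound hu hu2 hρ1
        (hg ((1 + R K) / 2) (by linarith) (by linarith)).1 (hKρ x hx)
      rw [l2norm_congr huU] at h1
      rw [Real.norm_eq_abs]
      refine h1.trans ?_
      rw [ha, add_mul, abs_of_nonneg (by linarith)]
      refine add_le_add (mul_le_mul_of_nonneg_left hUw (by positivity)) ?_
      rw [mul_right_comm]
      exact mul_le_mul_of_nonneg_left hGw (mul_nonneg hb' (by linarith))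
    · rw [hgrad x (hKB x hx)]
      exact (hg1 x (hKρ x hx)).trans (mul_le_mul_of_nonneg_left hGw hb)
    · rw [hgrad x (hKB x hx), hgrad y (hKB y hy)]
      refine (hg2 x y (hKρ x hx) (hKρ y hy)).trans ?_
      have : ((α / 2 : ℝ≥0) : ℝ) = (α : ℝ) / 2 := by simp
      rw [this]
      gcongr
  refine ⟨u, huU, ⟨?_, fun K hK => ?_⟩, hbound⟩
  · rw [← zero_add (1 : WithTop ℕ∞), contDiffOn_succ_iff_fderiv_of_isOpen Metric.isOpen_ball]
    refine ⟨fun x hx => (hu x hx).differentiableAt.differentiableWithinAt, by simp, ?_⟩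
    rw [contDiffOn_zero]
    refine ((InnerProductSpace.toDual ℝ (Sp n)).continuous.comp_continuousOn hgc).congr
      fun x hx => ?_
    exact (hu x hx).hasFDerivAt.fderiv
  · exact (hbound K hK).trans_lt (ENNReal.mul_lt_top ENNReal.coe_lt_top hW.lt_top)
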